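/- All algebras are unital and over $\mathbb{C}$. A Hopf $*$-algebra is a Hopf algebra with a conjugate-linear anti-multiplicative involution for which the coproduct is a $*$-homomorphism. A compact quantum group algebra is a Hopf $*$-algebra spanned by the matrix coefficients of its irreducible unitary finite-dimensional corepresentations. Let $\pi : A \to H$ be a surjective homomorphism of Hopf $*$-algebras, where $H$ is a compact quantum group algebra, and let $B = A^{\mathrm{co}(H)} = \{a \in A : (\mathrm{id}\otimes\pi)\Delta(a) = a \otimes 1\}$. Assume that $B$ is a quantum homogeneous space, i.e. that $A$ is faithfully flat as a right $B$-module. Then $\Delta$ restricts to a left coaction $B \to A \otimes B$. Let $(\Omega^\bullet, \wedge, d)$ be a left $A$-covariant $*$-differential calculus on $B$: a differential graded algebra with $\Omega^0 = B$ generated by $B$ and $dB$, with a degree-preserving conjugate-linear involution that extends that of $B$, commutes with $d$ and satisfies $(\omega\wedge\nu)^* = (-1)^{kl}\nu^*\wedge\omega^*$ for $\omega\in\Omega^k$, $\nu\in\Omega^l$, and with a degree-preserving left $A$-comodule $*$-algebra structure that extends the coaction of $B$ and commutes with $d$. Put $B^+ = B \cap \ker \epsilon$, and assume that $\Omega^1$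 is finitely generated as a left $B$-module and that $\Omega^1 B^+ = B^+ \Omega^1$. Let $\Phi(\Omega^1) = \Omega^1/B^+\Omega^1$ with the left $H$-coaction $[\omega] \mapsto \pi(\omega_{(-1)}) \otimes [\omega_{(0)}]$. A left $A$-covariant metric on $\Omega^1$ is a pair $(g, (\,,))$, where $g \in \Omega^1\otimes_B\Omega^1$ and $(\,,) : \Omega^1 \otimes_B \Omega^1 \to B$ is $B$-bilinear, such that $((\omega, \cdot)\otimes_B \mathrm{id})g = \omega = (\mathrm{id}\otimes_B(\cdot,\omega))g$ for all $\omega \in \Omega^1$, and such that $(\,,)$ and $B \to \Omega^1\otimes_B\Omega^1$, $b \mapsto bg$, are left $A$-colinear. Then: 1. The set of left $A$-covariant metrics on $\Omega^1$ is non-empty. 2. Let $\mathrm{Aut}(\Omega^1)$ be the group of $B$-bilinear, left $A$-colinear automorphisms of $\Omega^1$, and $\mathrm{Aut}(\Phi(\Omega^1))$ the group of $H$-comodule automorphisms of $\Phi(\Omega^1)$. The homomorphism $f \mapsto \Phi(f)$, $\Phi(f)[\omega] = [f(\omega)]$, from $\mathrm{Aut}(\Omega^1)$ to $\mathrm{Aut}(\Phi(\Omega^1))$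 is bijective, and $$\Phi(f)\cdot(g, (\,,)) = \big((\mathrm{id}\otimes_B f)g,\ (\,,)\circ(f^{-1}\otimes_B \mathrm{id})\big)$$ defines a free and transitive action of $\mathrm{Aut}(\Phi(\Omega^1))$ on the set of left $A$-covariant metrics on $\Omega^1$. 3. There are finitely many pairwise non-isomorphic irreducible left $H$-comodules $V_1,\dots,V_m$ and integers $n_i \ge 1$ with $\Phi(\Omega^1) \cong \bigoplus_{i=1}^m V_i^{\oplus n_i}$. For every such decomposition, with its chosen isomorphism, letting $\prod_i \mathrm{GL}_{n_i}(\mathbb{C})$ act on $\bigoplus_i V_i^{\oplus n_i}$ by matrix multiplication on the multiplicities gives a group isomorphism $$\prod_{i=1}^m \mathrm{GL}_{n_i}(\mathbb{C}) \cong \mathrm{Aut}(\Phi(\Omega^1)),$$ and the set of left $A$-covariant metrics on $\Omega^1$ is parametrized by $\prod_{i=1}^m \mathrm{GL}_{n_i}(\mathbb{C})$: for each covariant metric $x$, the map $\gamma \mapsto \gamma\cdot x$ is a bijection onto the set of covariant metrics. -/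

import Mathlib

open scoped TensorProduct

namespace QHS

universe u v w

/-! ### Left comodules over a complex bialgebra -/

section Comodules

/-- A left comodule over `C`: a coassociative and counital map `V → C ⊗ V`. -/
class LeftComodule (C : Type*) (V : Type*) [Ring C] [Bialgebra ℂ C]
    [AddCommGroup V] [Module ℂ V] where
  coact : V →ₗ[ℂ] C ⊗[ℂ] V
  coassoc : ∀ x, TensorProduct.assoc ℂ C C V
    ((Coalgebra.comul (R := ℂ) (A := C)).rTensor V (coact x)) = coact.lTensor C (coact x)
  counit : ∀ x, (Coalgebra.counit (R := ℂ) (A := C)).rTensor V (coact x) = 1 ⊗ₜ[ℂ] x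

variable (C : Type*) [Ring C] [Bialgebra ℂ C]
variable {V W : Type*} [AddCommGroup V] [Module ℂ V] [AddCommGroup W] [Module ℂ W]

/-- The coaction `V → C ⊗ V`. -/
def coaction [LeftComodule C V] : V →ₗ[ℂ] C ⊗[ℂ] V := LeftComodule.coact

/-- Morphisms of left comodules. -/
def IsColinear [LeftComodule C V] [LeftComodule C W] (f : V →ₗ[ℂ] W) : Prop :=
  ∀ x, coaction C (f x) = f.lTensor C (coaction C x)

/-- Subcomodules: `δ(U) ⊆ C ⊗ U`. -/
def IsSubcomodule [LeftComodule C V] (U : Submodule ℂ V) : Prop :=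
  ∀ x ∈ U, coaction C x ∈ LinearMap.range (U.subtype.lTensor C)

variable (V) in
/-- Irreducible (simple) comodules. -/
def IsIrreducible [LeftComodule C V] : Prop :=
  Nontrivial V ∧ ∀ U : Submodule ℂ V, IsSubcomodule C U → U = ⊥ ∨ U = ⊤

lemma lTensor_injective {f : V →ₗ[ℂ] W} (hf : Function.Injective f)
    (X : Type*) [AddCommGroup X] [Module ℂ X] : Function.Injective (f.lTensor X) :=
  Module.Flat.lTensor_preserves_injective_linearMap f hf

/-- Restriction of a coaction along an injective map onto a `δ`-stable subspace. -/
noncomputable def restrictCoact (δ : V →ₗ[ℂ] C ⊗[ℂ] V) (i : W →ₗ[ℂ] V)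
    (hi : Function.Injective i) (h : ∀ x, δ (i x) ∈ LinearMap.range (i.lTensor C)) :
    W →ₗ[ℂ] C ⊗[ℂ] W :=
  (LinearEquiv.ofInjective (i.lTensor C) (lTensor_injective hi C)).symm.toLinearMap ∘ₗ
    (δ ∘ₗ i).codRestrict (LinearMap.range (i.lTensor C)) h

lemma lTensor_restrictCoact (δ : V →ₗ[ℂ] C ⊗[ℂ] V) (i : W →ₗ[ℂ] V)
    (hi : Function.Injective i) (h : ∀ x, δ (i x) ∈ LinearMap.range (i.lTensor C)) (x : W) :
    i.lTensor C (restrictCoact C δ i hi h x) = δ (i x) := by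
  have := LinearEquiv.apply_symm_apply
    (LinearEquiv.ofInjective (i.lTensor C) (lTensor_injective hi C)) ⟨δ (i x), h x⟩
  exact congrArg Subtype.val this

/-- The comodule structure on a stable subspace. -/
@[reducible] noncomputable def LeftComodule.restrict [LeftComodule C V] (i : W →ₗ[ℂ] V)
    (hi : Function.Injective i)
    (h : ∀ x, coaction C (i x) ∈ LinearMap.range (i.lTensor C)) : LeftComodule C W where
  coact := restrictCoact C (coaction C) i hi h
  coassoc x := by
    have key := lTensor_restrictCoact C (coaction C) i hi h
    set ρ := restrictCoact C (coaction C) i hi h with hρ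
    apply lTensor_injective (lTensor_injective hi C) C
    have h1 : ∀ y : C ⊗[ℂ] W, (i.lTensor C).lTensor C (ρ.lTensor C y)
        = (coaction C).lTensor C (i.lTensor C y) := by
      intro y
      rw [← LinearMap.lTensor_comp_apply, ← LinearMap.lTensor_comp_apply]
      congr 2
      ext z
      exact key z
    have h2 : ∀ y : (C ⊗[ℂ] C) ⊗[ℂ] W, (i.lTensor C).lTensor C (TensorProduct.assoc ℂ C C W y)
        = TensorProduct.assoc ℂ C C V (i.lTensor (C ⊗[ℂ] C) y) := by
      intro y
      induction y with
      | zero => simp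
      | add a b ha hb => simp only [map_add, ha, hb]
      | tmul a b =>
        induction a with
        | zero => simp
        | add a b ha hb => simp only [TensorProduct.add_tmul, map_add, ha, hb]
        | tmul a c => simp
    rw [h1, key, h2, ← LinearMap.comp_apply (LinearMap.lTensor _ i), LinearMap.lTensor_comp_rTensor,
      ← LinearMap.rTensor_comp_lTensor, LinearMap.comp_apply, key]
    exact LeftComodule.coassoc (i x)
  counit x := by
    have key := lTensor_restrictCoact C (coaction C) i hi h
    set ρ := restrictCoact C (coaction C) i hi h with hρ
    apply lTensor_injective hi ℂ
    rw [← LinearMap.comp_apply (LinearMap.lTensor _ i), LinearMap.lTensor_comp_rTensor,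
      ← LinearMap.rTensor_comp_lTensor, LinearMap.comp_apply, key]
    simpa [QHS.coaction] using LeftComodule.counit (C := C) (i x)

variable (V) in
/-- The group of automorphisms of a left comodule. -/
def ComoduleAut [LeftComodule C V] : Subgroup (V ≃ₗ[ℂ] V) where
  carrier := {f | IsColinear C f.toLinearMap}
  one_mem' x := by
    simp
  mul_mem' {f g} hf hg x := by
    have h1 : ((f * g : V ≃ₗ[ℂ] V) : V →ₗ[ℂ] V) = f.toLinearMap ∘ₗ g.toLinearMap := rfl
    rw [h1, LinearMap.lTensor_comp_apply, ← hg x, ← hf (g.toLinearMap x)]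
    rfl
  inv_mem' {f} hf x := by
    have h1 : ((f⁻¹ : V ≃ₗ[ℂ] V) : V →ₗ[ℂ] V) = f.symm.toLinearMap := rfl
    have h2 : f.toLinearMap ∘ₗ f.symm.toLinearMap = LinearMap.id := by ext; simp
    apply lTensor_injective (f := f.toLinearMap) f.injective C
    rw [h1, ← LinearMap.lTensor_comp_apply, h2, ← hf]
    simp

/-- A decomposition of a comodule `V ≅ ⨁ᵢ Wᵢ^{⊕ nᵢ}` with irreducible, pairwise
non-isomorphic `Wᵢ`. A map into a finite direct sum is colinear if and only if all its
components are. -/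
structure IrreducibleDecomposition (C : Type u) (V : Type v) [Ring C] [Bialgebra ℂ C]
    [AddCommGroup V] [Module ℂ V] [LeftComodule C V] where
  m : ℕ
  n : Fin m → ℕ
  W : Fin m → Type w
  [addCommGroup : ∀ i, AddCommGroup (W i)]
  [module : ∀ i, Module ℂ (W i)]
  [comodule : ∀ i, LeftComodule C (W i)]
  irreducible : ∀ i, IsIrreducible C (W i)
  not_iso : ∀ i j, i ≠ j → ¬ ∃ e : W i ≃ₗ[ℂ] W j, IsColinear C e.toLinearMap
  equiv : V ≃ₗ[ℂ] (∀ i, Fin (n i) → W i)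
  colinear : ∀ i k, IsColinear C
    (LinearMap.proj k ∘ₗ LinearMap.proj i ∘ₗ equiv.toLinearMap : V →ₗ[ℂ] W i)

attribute [instance] IrreducibleDecomposition.addCommGroup IrreducibleDecomposition.module
  IrreducibleDecomposition.comodule

end Comodules

/-! ### Hopf `*`-algebras and compact quantum group algebras -/

section HopfStar

/-- A Hopf `*`-algebra: the coproduct is a `*`-homomorphism. -/
class HopfStarAlgebra (A : Type*) [Ring A] [HopfAlgebra ℂ A] [StarRing A] [StarModule ℂ A] :
    Prop where
  comul_star : ∀ a : A, Coalgebra.comul (R := ℂ) (star a) = star (Coalgebra.comul (R := ℂ) a)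

variable (H : Type*) [Ring H] [HopfAlgebra ℂ H]

/-- Matrix corepresentations: `Δ(uᵢⱼ) = ∑ₖ uᵢₖ ⊗ uₖⱼ` and `ε(uᵢⱼ) = δᵢⱼ`. -/
structure IsCorepresentation {n : ℕ} (c : Matrix (Fin n) (Fin n) H) : Prop where
  comul : ∀ i j, Coalgebra.comul (R := ℂ) (c i j) = ∑ k, c i k ⊗ₜ[ℂ] c k j
  counit : ∀ i j, Coalgebra.counit (R := ℂ) (c i j) = if i = j then 1 else 0

/-- Irreducibility: `ℂⁿ ≠ 0` has no nontrivial subspace that is invariant under all matrices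
obtained by applying a linear functional to the entries of `c`. -/
def IsIrreducibleMatrix {n : ℕ} (c : Matrix (Fin n) (Fin n) H) : Prop :=
  0 < n ∧ ∀ U : Submodule ℂ (Fin n → ℂ),
    (∀ φ : H →ₗ[ℂ] ℂ, ∀ x ∈ U, Matrix.vecMul x (c.map φ) ∈ U) → U = ⊥ ∨ U = ⊤

/-- A compact quantum group algebra: a Hopf `*`-algebra that is spanned by the matrix
coefficients of its irreducible unitary corepresentations. -/
def IsCQGAlgebra [StarRing H] : Prop :=
  Submodule.span ℂ {h : H | ∃ (n : ℕ) (c : Matrix (Fin n) (Fin n) H),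
    IsCorepresentation H c ∧ c ∈ unitary (Matrix (Fin n) (Fin n) H) ∧
    IsIrreducibleMatrix H c ∧ ∃ i j, h = c i j} = ⊤

/-- Homomorphisms of Hopf `*`-algebras. (A bialgebra map between Hopf algebras automatically
preserves the antipode.) -/
structure HopfStarHom (A H : Type*) [Ring A] [HopfAlgebra ℂ A] [StarRing A]
    [Ring H] [HopfAlgebra ℂ H] [StarRing H] extends A →ₐc[ℂ] H where
  map_star : ∀ a, toBialgHom (star a) = star (toBialgHom a)

end HopfStar

/-! ### The tensor product over a noncommutative algebra -/

noncomputable section BTensor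

open MulOpposite

variable (B : Type*) [Ring B]

section
variable [Algebra ℂ B] (M : Type*) [AddCommGroup M] [Module ℂ M]

/-- The left action `(b, m) ↦ b m`. -/
def lact [Module B M] [IsScalarTower ℂ B M] : B →ₗ[ℂ] M →ₗ[ℂ] M :=
  LinearMap.mk₂ ℂ (fun b m => b • m) (fun _ _ _ => add_smul _ _ _)
    (fun _ _ _ => smul_assoc _ _ _) (fun _ _ _ => smul_add _ _ _)
    (fun c b m => smul_comm b c m)

/-- The right action `(m, b) ↦ m b`. -/
def ract [Module Bᵐᵒᵖ M] [IsScalarTower ℂ Bᵐᵒᵖ M] : M →ₗ[ℂ] B →ₗ[ℂ] M :=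
  LinearMap.mk₂ ℂ (fun m b => op b • m) (fun _ _ _ => smul_add _ _ _)
    (fun c m b => smul_comm (op b) c m) (fun m a b => by rw [op_add, add_smul])
    (fun c m b => by rw [op_smul, smul_assoc])

@[simp] lemma lact_apply [Module B M] [IsScalarTower ℂ B M] (b : B) (m : M) :
    lact B M b m = b • m := rfl

@[simp] lemma ract_apply [Module Bᵐᵒᵖ M] [IsScalarTower ℂ Bᵐᵒᵖ M] (b : B) (m : M) :
    ract B M m b = op b • m := rfl
end

section
variable (M N : Type*) [AddCommGroup M] [Module ℂ M] [Module Bᵐᵒᵖ M]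
  [AddCommGroup N] [Module ℂ N] [Module B N]

/-- The relations `m b ⊗ n = m ⊗ b n`. -/
def balancing : Submodule ℂ (M ⊗[ℂ] N) :=
  Submodule.span ℂ {t | ∃ (m : M) (b : B) (n : N),
    t = (op b • m) ⊗ₜ[ℂ] n - m ⊗ₜ[ℂ] (b • n)}

/-- The tensor product `M ⊗_B N` of a right and a left `B`-module. -/
def BTensor : Type _ := (M ⊗[ℂ] N) ⧸ balancing B M N

noncomputable instance : AddCommGroup (BTensor B M N) :=
  inferInstanceAs (AddCommGroup ((M ⊗[ℂ] N) ⧸ balancing B M N))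

noncomputable instance : Module ℂ (BTensor B M N) :=
  inferInstanceAs (Module ℂ ((M ⊗[ℂ] N) ⧸ balancing B M N))

/-- The quotient map `M ⊗ N → M ⊗_B N`. -/
def BTensor.proj : M ⊗[ℂ] N →ₗ[ℂ] BTensor B M N := (balancing B M N).mkQ

/-- The bilinear map `(m, n) ↦ m ⊗_B n`. -/
def BTensor.mk : M →ₗ[ℂ] N →ₗ[ℂ] BTensor B M N :=
  (TensorProduct.mk ℂ M N).compr₂ (BTensor.proj B M N)

variable {M N}

lemma BTensor.balanced (m : M) (b : B) (n : N) :
    BTensor.mk B M N (op b • m) n = BTensor.mk B M N m (b • n) := by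
  refine (Submodule.Quotient.eq (balancing B M N)).2 ?_
  exact Submodule.subset_span ⟨m, b, n, rfl⟩

/-- The map `M ⊗_B N → P` induced by a `B`-balanced bilinear map. -/
def BTensor.lift {P : Type*} [AddCommGroup P] [Module ℂ P] (f : M →ₗ[ℂ] N →ₗ[ℂ] P)
    (hf : ∀ m (b : B) n, f (op b • m) n = f m (b • n)) : BTensor B M N →ₗ[ℂ] P :=
  (balancing B M N).liftQ (TensorProduct.lift f) <| by
    refine Submodule.span_le.2 ?_
    rintro _ ⟨m, b, n, rfl⟩
    simp [hf]

@[simp] lemma BTensor.lift_mk {P : Type*} [AddCommGroup P] [Module ℂ P] (f : M →ₗ[ℂ] N →ₗ[ℂ] P)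
    (hf : ∀ m (b : B) n, f (op b • m) n = f m (b • n)) (m : M) (n : N) :
    BTensor.lift B f hf (BTensor.mk B M N m n) = f m n := by
  exact TensorProduct.lift.tmul m n

/-- `f ⊗_B g` for a right `B`-linear `f` and a left `B`-linear `g`. -/
def BTensor.map {M' N' : Type*} [AddCommGroup M'] [Module ℂ M'] [Module Bᵐᵒᵖ M']
    [AddCommGroup N'] [Module ℂ N'] [Module B N'] (f : M →ₗ[ℂ] M') (g : N →ₗ[ℂ] N')
    (hf : ∀ m (b : B), f (op b • m) = op b • f m) (hg : ∀ (b : B) n, g (b • n) = b • g n) :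
    BTensor B M N →ₗ[ℂ] BTensor B M' N' :=
  BTensor.lift B ((BTensor.mk B M' N').compl₁₂ f g) fun m b n => by
    simp [hf, hg, BTensor.balanced]

end

lemma BTensor.ext {M N P : Type*} [AddCommGroup M] [Module ℂ M] [Module Bᵐᵒᵖ M]
    [AddCommGroup N] [Module ℂ N] [Module B N] [AddCommGroup P] [Module ℂ P]
    {f g : BTensor B M N →ₗ[ℂ] P}
    (h : ∀ m n, f (BTensor.mk B M N m n) = g (BTensor.mk B M N m n)) : f = g := by
  apply Submodule.linearMap_qext (balancing B M N)
  exact TensorProduct.ext' h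

variable [Algebra ℂ B]

/-- The left `B`-action `(b, t) ↦ b t` on `M ⊗_B N` for a bimodule `M`. -/
def BTensor.lsmul {M N : Type*} [AddCommGroup M] [Module ℂ M] [Module B M] [Module Bᵐᵒᵖ M]
    [IsScalarTower ℂ B M] [SMulCommClass B Bᵐᵒᵖ M]
    [AddCommGroup N] [Module ℂ N] [Module B N] (b : B) :
    BTensor B M N →ₗ[ℂ] BTensor B M N :=
  BTensor.map B (lact B M b) LinearMap.id (fun m c => smul_comm b (op c) m) (fun _ _ => rfl)

/-- `b ↦ b t` as a linear map `B → M ⊗_B N`. -/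
def BTensor.orbit {M N : Type*} [AddCommGroup M] [Module ℂ M] [Module B M] [Module Bᵐᵒᵖ M]
    [IsScalarTower ℂ B M] [SMulCommClass B Bᵐᵒᵖ M]
    [AddCommGroup N] [Module ℂ N] [Module B N] (t : BTensor B M N) :
    B →ₗ[ℂ] BTensor B M N where
  toFun b := BTensor.lsmul B b t
  map_add' b c := by
    have : BTensor.lsmul B (b + c) (M := M) (N := N) = BTensor.lsmul B b + BTensor.lsmul B c :=
      BTensor.ext B fun m n => by simp [BTensor.lsmul, BTensor.map]
    rw [this]; rfl
  map_smul' z b := by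
    have : BTensor.lsmul B (z • b) (M := M) (N := N) = z • BTensor.lsmul B b :=
      BTensor.ext B fun m n => by simp [BTensor.lsmul, BTensor.map]
    rw [this]; rfl

/-- Faithful flatness of a right `B`-module `X`: the functor `X ⊗_B -` preserves and reflects
exactness. -/
def IsFaithfullyFlatRight (B : Type u) [Ring B] [Algebra ℂ B] (X : Type v) [AddCommGroup X]
    [Module ℂ X] [Module Bᵐᵒᵖ X] : Prop :=
  ∀ (N₁ N₂ N₃ : Type u) [AddCommGroup N₁] [AddCommGroup N₂] [AddCommGroup N₃]
    [Module ℂ N₁] [Module ℂ N₂] [Module ℂ N₃] [Module B N₁] [Module B N₂] [Module B N₃]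
    [IsScalarTower ℂ B N₁] [IsScalarTower ℂ B N₂] [IsScalarTower ℂ B N₃]
    (f : N₁ →ₗ[B] N₂) (g : N₂ →ₗ[B] N₃),
    Function.Exact
      (BTensor.map B (LinearMap.id : X →ₗ[ℂ] X) (f.restrictScalars ℂ) (fun _ _ => rfl) f.map_smul)
      (BTensor.map B (LinearMap.id : X →ₗ[ℂ] X) (g.restrictScalars ℂ) (fun _ _ => rfl) g.map_smul)
    ↔ Function.Exact f g

end BTensor

/-! ### Comodule algebras, relative Hopf modules and covariant metrics -/

section RelHopf

open MulOpposite

variable (A B : Type*) [Ring A] [HopfAlgebra ℂ A] [Ring B] [Algebra ℂ B] [LeftComodule A B]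

/-- A left `A`-comodule algebra: the coaction is an algebra map. -/
class ComoduleAlgebra : Prop where
  coact_one : coaction A (1 : B) = 1
  coact_mul : ∀ b c : B, coaction A (b * c) = coaction A b * coaction A c

variable (M : Type*) [AddCommGroup M] [Module ℂ M] [Module B M] [Module Bᵐᵒᵖ M]
  [IsScalarTower ℂ B M] [IsScalarTower ℂ Bᵐᵒᵖ M] [SMulCommClass B Bᵐᵒᵖ M] [LeftComodule A M]

/-- Relative Hopf modules: a `B`-bimodule with a left `A`-coaction such that
`δ(b m) = b₍₁₎ m₍₋₁₎ ⊗ b₍₂₎ m₍₀₎` and `δ(m b) = m₍₋₁₎ b₍₁₎ ⊗ m₍₀₎ b₍₂₎`. -/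
class RelHopfModule : Prop where
  coact_smul : ∀ (b : B) (m : M), coaction A (b • m) =
    TensorProduct.map₂ (LinearMap.mul ℂ A) (lact B M) (coaction A b) (coaction A m)
  coact_op_smul : ∀ (m : M) (b : B), coaction A (op b • m) =
    TensorProduct.map₂ (LinearMap.mul ℂ A) (ract B M) (coaction A m) (coaction A b)

/-- The automorphism group of a relative Hopf module: bijective, `B`-bilinear, `A`-colinear. -/
def RelHopfAut : Subgroup (M ≃ₗ[ℂ] M) where
  carrier := {f | (∀ (b : B) m, f (b • m) = b • f m) ∧ (∀ (b : B) m, f (op b • m) = op b • f m) ∧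
    f ∈ ComoduleAut A M}
  one_mem' := ⟨fun _ _ => rfl, fun _ _ => rfl, one_mem _⟩
  mul_mem' {f g} hf hg :=
    ⟨fun b m => by simp [hf.1, hg.1], fun b m => by simp [hf.2.1, hg.2.1],
      mul_mem hf.2.2 hg.2.2⟩
  inv_mem' {f} hf :=
    ⟨fun b m => f.injective (by
        rw [hf.1]; exact (f.apply_symm_apply _).trans (congrArg _ (f.apply_symm_apply m).symm)),
      fun b m => f.injective (by
        rw [hf.2.1]; exact (f.apply_symm_apply _).trans (congrArg _ (f.apply_symm_apply m).symm)),
      inv_mem hf.2.2⟩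

variable [RelHopfModule A B M]

/-- The diagonal coaction `m ⊗ n ↦ m₍₋₁₎ n₍₋₁₎ ⊗ (m₍₀₎ ⊗_B n₍₀₎)` on `M ⊗_B M`. -/
noncomputable def tensorCoact : BTensor B M M →ₗ[ℂ] A ⊗[ℂ] BTensor B M M :=
  BTensor.lift B
    ((TensorProduct.map₂ (LinearMap.mul ℂ A) (BTensor.mk B M M)).compl₁₂ (coaction A) (coaction A))
    fun m b n => by
      simp only [LinearMap.compl₁₂_apply, RelHopfModule.coact_smul, RelHopfModule.coact_op_smul]
      generalize coaction A m = x
      generalize coaction A n = y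
      generalize coaction A b = z
      induction x with
      | zero => simp
      | add x x' hx hx' => simp only [map_add, LinearMap.add_apply, hx, hx']
      | tmul a m =>
        induction z with
        | zero => simp
        | add z z' hz hz' => simp only [map_add, LinearMap.add_apply, hz, hz']
        | tmul c b =>
          induction y with
          | zero => simp
          | add y y' hy hy' => simp only [map_add, hy, hy']
          | tmul d n => simp [TensorProduct.map₂_apply_tmul, mul_assoc, BTensor.balanced]

/-- Covariant metrics on a relative Hopf module `M`. -/
structure CovariantMetric where
  g : BTensor B M M
  pairing : BTensor B M M →ₗ[ℂ] B
  pairing_smul : ∀ (b : B) m n,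
    pairing (BTensor.mk B M M (b • m) n) = b * pairing (BTensor.mk B M M m n)
  pairing_op_smul : ∀ (b : B) m n,
    pairing (BTensor.mk B M M m (op b • n)) = pairing (BTensor.mk B M M m n) * b
  /-- `((x, ·) ⊗_B id) g = x` -/
  left_inv : ∀ x : M, BTensor.lift B
    ((lact B M) ∘ₗ pairing ∘ₗ (BTensor.mk B M M x))
    (fun m b n => by simp [pairing_op_smul, mul_smul]) g = x
  /-- `(id ⊗_B (·, x)) g = x` -/
  right_inv : ∀ x : M, BTensor.lift B
    ((ract B M).compl₂ (pairing ∘ₗ (BTensor.mk B M M).flip x))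
    (fun m b n => by simp [pairing_smul, mul_smul]) g = x
  /-- the pairing is covariant -/
  pairing_colinear : ∀ t, coaction A (pairing t) = pairing.lTensor A (tensorCoact A B M t)
  /-- the map `b ↦ b g` is covariant -/
  coev_colinear : ∀ b : B, tensorCoact A B M (BTensor.orbit B g b) =
    (BTensor.orbit B g).lTensor A (coaction A b)

end RelHopf

/-! ### Quantum homogeneous spaces -/

noncomputable section Homogeneous

open MulOpposite

variable {A H : Type*} [Ring A] [HopfAlgebra ℂ A] [StarRing A]
  [Ring H] [HopfAlgebra ℂ H] [StarRing H]

/-- The homogeneous right coaction `(id ⊗ π) ∘ Δ : A → A ⊗ H`. -/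
def rightCoaction (π : HopfStarHom A H) : A →ₐ[ℂ] A ⊗[ℂ] H :=
  (Algebra.TensorProduct.map (AlgHom.id ℂ A) (π.toBialgHom : A →ₐ[ℂ] H)).comp
    (Bialgebra.comulAlgHom ℂ A)

/-- The algebra of coinvariants `B = A^{co(H)} = {a | (id ⊗ π) Δ(a) = a ⊗ 1}`. -/
def coinv (π : HopfStarHom A H) : Subalgebra ℂ A :=
  AlgHom.equalizer (rightCoaction π) Algebra.TensorProduct.includeLeft

variable (π : HopfStarHom A H)

lemma mem_coinv {a : A} : a ∈ coinv π ↔ rightCoaction π a = a ⊗ₜ[ℂ] 1 := Iff.rfl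

lemma rightCoaction_eq (a : A) : rightCoaction π a =
    (π.toBialgHom : A →ₗ[ℂ] H).lTensor A (Coalgebra.comul (R := ℂ) a) := rfl

instance : Module (coinv π)ᵐᵒᵖ A :=
  Module.compHom A ((coinv π).val.toRingHom.op)

lemma op_smul_eq_mul (a : A) (b : coinv π) : op b • a = a * b := rfl

lemma apply_coinv (b : coinv π) :
    π.toBialgHom (b : A) = algebraMap ℂ H (Coalgebra.counit (R := ℂ) (b : A)) := by
  have h := (mem_coinv π).1 b.2
  rw [rightCoaction_eq] at h
  have h2 := congrArg (fun t => TensorProduct.lid ℂ H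
    ((Coalgebra.counit (R := ℂ) (A := A)).rTensor H t)) h
  simp only [LinearMap.rTensor_tmul, TensorProduct.lid_tmul] at h2
  rw [Algebra.algebraMap_eq_smul_one, ← h2, ← LinearMap.comp_apply (LinearMap.rTensor _ _),
    LinearMap.rTensor_comp_lTensor, ← LinearMap.lTensor_comp_rTensor, LinearMap.comp_apply,
    Coalgebra.rTensor_counit_comul]
  simp

lemma comul_mem_range (b : coinv π) : Coalgebra.comul (R := ℂ) (b : A) ∈
    LinearMap.range ((coinv π).val.toLinearMap.lTensor A) := by
  set D : A →ₗ[ℂ] A ⊗[ℂ] H := (rightCoaction π).toLinearMap -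
    (Algebra.TensorProduct.includeLeft : A →ₐ[ℂ] A ⊗[ℂ] H).toLinearMap with hD
  have hex : Function.Exact (coinv π).val.toLinearMap D := by
    intro a
    constructor
    · intro h
      exact ⟨⟨a, (mem_coinv π).2 (sub_eq_zero.1 h)⟩, rfl⟩
    · rintro ⟨c, rfl⟩
      exact sub_eq_zero.2 ((mem_coinv π).1 c.2)
  refine (Module.Flat.lTensor_exact A hex _).1 ?_
  rw [hD, LinearMap.lTensor_sub, LinearMap.sub_apply, sub_eq_zero]
  have h := (mem_coinv π).1 b.2
  rw [rightCoaction_eq] at h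
  have e1 : ∀ t : A ⊗[ℂ] A, (rightCoaction π).toLinearMap.lTensor A t =
      TensorProduct.assoc ℂ A A H ((π.toBialgHom : A →ₗ[ℂ] H).lTensor (A ⊗[ℂ] A)
        ((TensorProduct.assoc ℂ A A A).symm
          ((Coalgebra.comul (R := ℂ) (A := A)).lTensor A t))) := by
    intro t
    induction t with
    | zero => simp
    | add x y hx hy => simp only [map_add, hx, hy]
    | tmul x y =>
      simp only [LinearMap.lTensor_tmul, AlgHom.toLinearMap_apply, rightCoaction_eq]
      generalize Coalgebra.comul (R := ℂ) y = z
      induction z with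
      | zero => simp
      | add x y hx hy => simp only [map_add, TensorProduct.tmul_add, hx, hy]
      | tmul x y => simp
  rw [e1, Coalgebra.coassoc_symm_apply, ← LinearMap.comp_apply (LinearMap.lTensor _ _),
    LinearMap.lTensor_comp_rTensor, ← LinearMap.rTensor_comp_lTensor, LinearMap.comp_apply, h,
    LinearMap.rTensor_tmul]
  generalize Coalgebra.comul (R := ℂ) (b : A) = z
  induction z with
  | zero => simp
  | add x y hx hy => simp only [map_add, TensorProduct.add_tmul, hx, hy]
  | tmul x y => simp

/-- `A` coacts on itself by `Δ`. -/
instance : LeftComodule A A where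
  coact := Coalgebra.comul
  coassoc := Coalgebra.coassoc_apply
  counit := Coalgebra.rTensor_counit_comul

/-- The left `A`-coaction `Δ : B → A ⊗ B`. -/
instance : LeftComodule A (coinv π) :=
  LeftComodule.restrict A (V := A) (coinv π).val.toLinearMap Subtype.val_injective
    (comul_mem_range π)

lemma lTensor_val_coaction (b : coinv π) :
    (coinv π).val.toLinearMap.lTensor A (coaction A b) = Coalgebra.comul (R := ℂ) (b : A) :=
  lTensor_restrictCoact A (Coalgebra.comul (R := ℂ) (A := A)) (coinv π).val.toLinearMap
    Subtype.val_injective (comul_mem_range π) b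

instance : ComoduleAlgebra A (coinv π) where
  coact_one := by
    apply lTensor_injective (f := (coinv π).val.toLinearMap) Subtype.val_injective A
    rw [lTensor_val_coaction]
    simp [Algebra.TensorProduct.one_def]
  coact_mul b c := by
    apply lTensor_injective (f := (coinv π).val.toLinearMap) Subtype.val_injective A
    have hm : ∀ x y : A ⊗[ℂ] coinv π, (coinv π).val.toLinearMap.lTensor A (x * y) =
        (coinv π).val.toLinearMap.lTensor A x * (coinv π).val.toLinearMap.lTensor A y :=
      map_mul (Algebra.TensorProduct.map (AlgHom.id ℂ A) (coinv π).val)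
    rw [hm]
    simp only [lTensor_val_coaction]
    exact Bialgebra.comul_mul _ _

section Star

variable [StarModule ℂ A] [StarModule ℂ H] [HopfStarAlgebra A]

lemma star_mem_coinv {a : A} (ha : a ∈ coinv π) : star a ∈ coinv π := by
  rw [mem_coinv, rightCoaction_eq] at *
  have h : ∀ t : A ⊗[ℂ] A, (π.toBialgHom : A →ₗ[ℂ] H).lTensor A (star t) =
      star ((π.toBialgHom : A →ₗ[ℂ] H).lTensor A t) := by
    intro t
    induction t with
    | zero => simp
    | add x y hx hy => simp only [map_add, star_add, hx, hy]
    | tmul x y => simpa using congrArg (star x ⊗ₜ[ℂ] ·) (π.map_star y)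
  rw [HopfStarAlgebra.comul_star, h, ha]
  simp

/-- The `*`-structure of `B`. -/
instance : Star (coinv π) := ⟨fun b => ⟨star (b : A), star_mem_coinv π b.2⟩⟩

end Star

/-! ### Takeuchi's functor `Φ(M) = M / B⁺M` -/

section Takeuchi

variable (M : Type*) [AddCommGroup M] [Module ℂ M] [Module (coinv π) M]

/-- `B⁺M`, where `B⁺ = B ∩ ker ε`. -/
def plusLeft : Submodule ℂ M :=
  Submodule.span ℂ {x | ∃ (b : coinv π) (m : M),
    Coalgebra.counit (R := ℂ) (b : A) = 0 ∧ x = b • m}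

/-- `MB⁺`, where `B⁺ = B ∩ ker ε`. -/
def plusRight [Module (coinv π)ᵐᵒᵖ M] : Submodule ℂ M :=
  Submodule.span ℂ {x | ∃ (b : coinv π) (m : M),
    Coalgebra.counit (R := ℂ) (b : A) = 0 ∧ x = op b • m}

/-- `Φ(M) = M / B⁺M`. -/
def Phi : Type _ := M ⧸ plusLeft π M

instance : AddCommGroup (Phi π M) := inferInstanceAs (AddCommGroup (M ⧸ plusLeft π M))

instance : Module ℂ (Phi π M) := inferInstanceAs (Module ℂ (M ⧸ plusLeft π M))

/-- The quotient map `m ↦ [m]`. -/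
def Phi.mk : M →ₗ[ℂ] Phi π M := (plusLeft π M).mkQ

lemma Phi.mk_surjective : Function.Surjective (Phi.mk π M) := Submodule.mkQ_surjective _

variable {M} in
lemma Phi.mk_smul [IsScalarTower ℂ (coinv π) M] (b : coinv π) (m : M) :
    Phi.mk π M (b • m) = Coalgebra.counit (R := ℂ) (b : A) • Phi.mk π M m := by
  rw [← map_smul]
  refine (Submodule.Quotient.eq (plusLeft π M)).2 ?_
  refine Submodule.subset_span ⟨b - algebraMap ℂ _ (Coalgebra.counit (R := ℂ) (b : A)), m, ?_, ?_⟩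
  · simp
  · rw [sub_smul, algebraMap_smul]

variable [Module (coinv π)ᵐᵒᵖ M] [IsScalarTower ℂ (coinv π) M] [IsScalarTower ℂ (coinv π)ᵐᵒᵖ M]
  [LeftComodule A M]

/-- The map `m ↦ π(m₍₋₁₎) ⊗ [m₍₀₎]`. -/
def Phi.preCoact : M →ₗ[ℂ] H ⊗[ℂ] Phi π M :=
  TensorProduct.map (π.toBialgHom : A →ₗ[ℂ] H) (Phi.mk π M) ∘ₗ coaction A

variable [RelHopfModule A (coinv π) M]

lemma Phi.preCoact_smul (b : coinv π) (m : M) :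
    Phi.preCoact π M (b • m) = Coalgebra.counit (R := ℂ) (b : A) • Phi.preCoact π M m := by
  have h : ∀ (x : A ⊗[ℂ] coinv π) (y : A ⊗[ℂ] M),
      TensorProduct.map (π.toBialgHom : A →ₗ[ℂ] H) (Phi.mk π M)
        (TensorProduct.map₂ (LinearMap.mul ℂ A) (lact (coinv π) M) x y) =
      (LinearMap.mulLeft ℂ (π.toBialgHom (TensorProduct.rid ℂ A
        ((Coalgebra.counit (R := ℂ) (A := A)).lTensor A
          ((coinv π).val.toLinearMap.lTensor A x))))).rTensor (Phi π M)
        (TensorProduct.map (π.toBialgHom : A →ₗ[ℂ] H) (Phi.mk π M) y) := by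
    intro x y
    induction x with
    | zero => simp
    | add x x' hx hx' =>
      simp only [map_add, LinearMap.add_apply, hx, hx']
      rw [← LinearMap.add_apply, ← LinearMap.rTensor_add]
      congr 2
      ext z
      simp [add_mul]
    | tmul a b =>
      induction y with
      | zero => simp
      | add y y' hy hy' => simp only [map_add, hy, hy']
      | tmul c m =>
        simp [TensorProduct.map₂_apply_tmul, Phi.mk_smul, TensorProduct.tmul_smul,
          TensorProduct.smul_tmul']
  change TensorProduct.map (π.toBialgHom : A →ₗ[ℂ] H) (Phi.mk π M) (coaction A (b • m)) = _
  rw [RelHopfModule.coact_smul, h, lTensor_val_coaction, Coalgebra.lTensor_counit_comul,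
    TensorProduct.rid_tmul, one_smul, apply_coinv]
  change _ = _ • TensorProduct.map (π.toBialgHom : A →ₗ[ℂ] H) (Phi.mk π M) (coaction A m)
  generalize TensorProduct.map (π.toBialgHom : A →ₗ[ℂ] H) (Phi.mk π M) (coaction A m) = z
  induction z with
  | zero => simp
  | add y y' hy hy' => simp only [map_add, smul_add, hy, hy']
  | tmul c m => simp [Algebra.algebraMap_eq_smul_one, TensorProduct.smul_tmul']

/-- The coaction `[m] ↦ π(m₍₋₁₎) ⊗ [m₍₀₎]` on `Φ(M)`. -/
def Phi.coact : Phi π M →ₗ[ℂ] H ⊗[ℂ] Phi π M :=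
  (plusLeft π M).liftQ (Phi.preCoact π M) <| by
    refine Submodule.span_le.2 ?_
    rintro _ ⟨b, m, hb, rfl⟩
    simp [Phi.preCoact_smul, hb]

lemma Phi.coact_mk (m : M) : Phi.coact π M (Phi.mk π M m) =
    TensorProduct.map (π.toBialgHom : A →ₗ[ℂ] H) (Phi.mk π M) (coaction A m) := rfl

instance : LeftComodule H (Phi π M) where
  coact := Phi.coact π M
  coassoc x := by
    obtain ⟨m, rfl⟩ := Phi.mk_surjective π M x
    have h1 : ∀ y : A ⊗[ℂ] M, (Phi.coact π M).lTensor H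
        (TensorProduct.map (π.toBialgHom : A →ₗ[ℂ] H) (Phi.mk π M) y) =
        TensorProduct.map (π.toBialgHom : A →ₗ[ℂ] H)
          (TensorProduct.map (π.toBialgHom : A →ₗ[ℂ] H) (Phi.mk π M))
          ((coaction A).lTensor A y) := by
      intro y
      induction y with
      | zero => simp
      | add y y' hy hy' => simp only [map_add, hy, hy']
      | tmul c m => simp [Phi.coact_mk]
    have h2 : ∀ y : A ⊗[ℂ] M, TensorProduct.assoc ℂ H H (Phi π M)
        ((Coalgebra.comul (R := ℂ) (A := H)).rTensor (Phi π M)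
          (TensorProduct.map (π.toBialgHom : A →ₗ[ℂ] H) (Phi.mk π M) y)) =
        TensorProduct.map (π.toBialgHom : A →ₗ[ℂ] H)
          (TensorProduct.map (π.toBialgHom : A →ₗ[ℂ] H) (Phi.mk π M))
          (TensorProduct.assoc ℂ A A M ((Coalgebra.comul (R := ℂ) (A := A)).rTensor M y)) := by
      intro y
      induction y with
      | zero => simp
      | add y y' hy hy' => simp only [map_add, hy, hy']
      | tmul c m =>
        have := CoalgHomClass.map_comp_comul_apply π.toBialgHom c
        simp only [TensorProduct.map_tmul, LinearMap.rTensor_tmul]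
        change TensorProduct.assoc ℂ H H (Phi π M)
          (Coalgebra.comul (R := ℂ) (π.toBialgHom c) ⊗ₜ _) = _
        rw [← this]
        generalize Coalgebra.comul (R := ℂ) c = z
        induction z with
        | zero => simp
        | add y y' hy hy' => simp only [map_add, TensorProduct.add_tmul, hy, hy']
        | tmul c m => simp
    rw [Phi.coact_mk, h1, h2]
    exact congrArg _ (LeftComodule.coassoc m)
  counit x := by
    obtain ⟨m, rfl⟩ := Phi.mk_surjective π M x
    have h2 : ∀ y : A ⊗[ℂ] M, (Coalgebra.counit (R := ℂ) (A := H)).rTensor (Phi π M)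
          (TensorProduct.map (π.toBialgHom : A →ₗ[ℂ] H) (Phi.mk π M) y) =
        (Phi.mk π M).lTensor ℂ ((Coalgebra.counit (R := ℂ) (A := A)).rTensor M y) := by
      intro y
      induction y with
      | zero => simp
      | add y y' hy hy' => simp only [map_add, hy, hy']
      | tmul c m => simp
    rw [Phi.coact_mk, h2]
    exact congrArg ((Phi.mk π M).lTensor ℂ) (LeftComodule.counit m)

lemma Phi.coaction_mk (m : M) : coaction H (Phi.mk π M m) =
    TensorProduct.map (π.toBialgHom : A →ₗ[ℂ] H) (Phi.mk π M) (coaction A m) := rfl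

variable {M} in
/-- `Φ(f)` for a left `B`-linear `f`. -/
def Phi.map (f : M →ₗ[ℂ] M) (hf : ∀ (b : coinv π) m, f (b • m) = b • f m) :
    Phi π M →ₗ[ℂ] Phi π M :=
  (plusLeft π M).liftQ (Phi.mk π M ∘ₗ f) <| by
    refine Submodule.span_le.2 ?_
    rintro _ ⟨b, m, hb, rfl⟩
    simp [hf, Phi.mk_smul, hb]

/-- The group homomorphism `Aut(M) → Aut(Φ(M))`, `f ↦ Φ(f)`, `Φ(f)[m] = [f(m)]`. -/
def Phi.aut : RelHopfAut A (coinv π) M →* ComoduleAut H (Phi π M) where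
  toFun f := ⟨LinearEquiv.ofLinearMap (Phi.map π f.1.toLinearMap f.2.1)
      (Phi.map π (f⁻¹).1.toLinearMap (f⁻¹).2.1)
      (by
        apply Submodule.linearMap_qext (plusLeft π M)
        ext m
        exact congrArg (Phi.mk π M) (f.1.apply_symm_apply m))
      (by
        apply Submodule.linearMap_qext (plusLeft π M)
        ext m
        exact congrArg (Phi.mk π M) (f.1.symm_apply_apply m)), by
      intro x
      obtain ⟨m, rfl⟩ := Phi.mk_surjective π M x
      change coaction H (Phi.mk π M (f.1 m)) = (Phi.map π f.1.toLinearMap f.2.1).lTensor H _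
      have hf := f.2.2.2 m
      rw [LinearEquiv.coe_coe] at hf
      rw [Phi.coaction_mk, Phi.coaction_mk, hf]
      generalize coaction A m = y
      induction y with
      | zero => simp
      | add y y' hy hy' => simp only [map_add, hy, hy']
      | tmul c m => rfl⟩
  map_one' := by
    ext x
    obtain ⟨m, rfl⟩ := Phi.mk_surjective π M x
    rfl
  map_mul' f g := by
    ext x
    obtain ⟨m, rfl⟩ := Phi.mk_surjective π M x
    rfl

end Takeuchi

end Homogeneous

/-! ### Covariant `*`-differential calculi -/

noncomputable section Calculus

open MulOpposite

/-- A differential calculus over `B`: a differential graded algebra `Ω = ⨁ₖ Ωᵏ` with `Ω⁰ = B`,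
generated by `B` and `dB`. -/
structure DifferentialCalculus (B Ω : Type*) [Ring B] [Algebra ℂ B] [Ring Ω] [Algebra ℂ Ω] where
  grading : ℕ → Submodule ℂ Ω
  [gradedAlgebra : GradedAlgebra grading]
  ι : B →ₐ[ℂ] Ω
  ι_injective : Function.Injective ι
  range_ι : LinearMap.range ι.toLinearMap = grading 0
  d : Ω →ₗ[ℂ] Ω
  d_mem : ∀ k, ∀ ω ∈ grading k, d ω ∈ grading (k + 1)
  d_d : ∀ ω, d (d ω) = 0
  leibniz : ∀ k, ∀ ω ∈ grading k, ∀ ν, d (ω * ν) = d ω * ν + (-1 : ℤ) ^ k • (ω * d ν)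
  generated : Algebra.adjoin ℂ (Set.range ι ∪ Set.range fun b => d (ι b)) = ⊤

/-- A left `A`-covariant `*`-differential calculus over a left `A`-comodule algebra `B` with
involution. -/
structure CovariantStarCalculus (A B Ω : Type*) [Ring A] [HopfAlgebra ℂ A] [StarRing A]
    [StarModule ℂ A] [Ring B] [Algebra ℂ B] [Star B] [LeftComodule A B]
    [Ring Ω] [Algebra ℂ Ω] extends DifferentialCalculus B Ω where
  involution : Ω →ₗ⋆[ℂ] Ω
  involution_involution : ∀ ω, involution (involution ω) = ω
  involution_ι : ∀ b, involution (ι b) = ι (star b)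
  involution_mem : ∀ k, ∀ ω ∈ grading k, involution ω ∈ grading k
  involution_d : ∀ ω, involution (d ω) = d (involution ω)
  involution_mul : ∀ k l, ∀ ω ∈ grading k, ∀ ν ∈ grading l,
    involution (ω * ν) = (-1 : ℤ) ^ (k * l) • (involution ν * involution ω)
  [comodule : LeftComodule A Ω]
  [comoduleAlgebra : ComoduleAlgebra A Ω]
  ι_colinear : IsColinear A ι.toLinearMap
  subcomodule : ∀ k, IsSubcomodule A (grading k)
  d_colinear : IsColinear A d
  coaction_involution : ∀ ω, coaction A (involution ω) =
    TensorProduct.map (starLinearEquiv ℂ (A := A)).toLinearMap involution (coaction A ω)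

attribute [instance] DifferentialCalculus.gradedAlgebra

variable {A B Ω : Type*} [Ring A] [HopfAlgebra ℂ A] [StarRing A]
    [StarModule ℂ A] [Ring B] [Algebra ℂ B] [Star B] [LeftComodule A B]
    [Ring Ω] [Algebra ℂ Ω] (C : CovariantStarCalculus A B Ω)

namespace CovariantStarCalculus

/-- The space of one-forms `Ω¹`. -/
def OneForms : Type _ := C.grading 1

instance : AddCommGroup C.OneForms := inferInstanceAs (AddCommGroup (C.grading 1))

instance : Module ℂ C.OneForms := inferInstanceAs (Module ℂ (C.grading 1))

/-- The inclusion `Ω¹ → Ω`. -/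
def incl : C.OneForms →ₗ[ℂ] Ω := (C.grading 1).subtype

lemma incl_injective : Function.Injective C.incl := Subtype.val_injective

lemma ι_mem (b : B) : C.ι b ∈ C.grading 0 := C.range_ι ▸ LinearMap.mem_range_self _ b

instance : SMul B C.OneForms :=
  ⟨fun b ω => ⟨C.ι b * C.incl ω, by
    have h := SetLike.mul_mem_graded (C.ι_mem b) ω.2
    rw [zero_add] at h
    exact h⟩⟩

instance : SMul Bᵐᵒᵖ C.OneForms :=
  ⟨fun b ω => ⟨C.incl ω * C.ι (unop b), by
    have h := SetLike.mul_mem_graded ω.2 (C.ι_mem (unop b))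
    rw [add_zero] at h
    exact h⟩⟩

@[simp] lemma incl_smul (b : B) (ω : C.OneForms) : C.incl (b • ω) = C.ι b * C.incl ω := rfl

@[simp] lemma incl_op_smul (b : Bᵐᵒᵖ) (ω : C.OneForms) :
    C.incl (b • ω) = C.incl ω * C.ι (unop b) := rfl

instance : Module B C.OneForms where
  one_smul ω := C.incl_injective (by simp)
  mul_smul b c ω := C.incl_injective (by simp [mul_assoc])
  smul_zero b := C.incl_injective (by simp)
  smul_add b ω ν := C.incl_injective (by simp [mul_add])
  add_smul b c ω := C.incl_injective (by simp [add_mul])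
  zero_smul ω := C.incl_injective (by simp)

instance : Module Bᵐᵒᵖ C.OneForms where
  one_smul ω := C.incl_injective (by simp)
  mul_smul b c ω := C.incl_injective (by simp [mul_assoc])
  smul_zero b := C.incl_injective (by simp)
  smul_add b ω ν := C.incl_injective (by simp [add_mul])
  add_smul b c ω := C.incl_injective (by simp [mul_add])
  zero_smul ω := C.incl_injective (by simp)

instance : IsScalarTower ℂ B C.OneForms where
  smul_assoc z b ω := C.incl_injective (by simp)

instance : IsScalarTower ℂ Bᵐᵒᵖ C.OneForms where
  smul_assoc z b ω := C.incl_injective (by simp)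

instance : SMulCommClass B Bᵐᵒᵖ C.OneForms where
  smul_comm b c ω := C.incl_injective (by simp [mul_assoc])

/-- The coaction on `Ω¹`: the restriction of the coaction on `Ω`. -/
instance : LeftComodule A C.OneForms :=
  letI := C.comodule
  LeftComodule.restrict A C.incl C.incl_injective fun ω => C.subcomodule 1 _ ω.2

lemma lTensor_incl_coaction (ω : C.OneForms) :
    letI := C.comodule
    C.incl.lTensor A (coaction A ω) = coaction A (C.incl ω) :=
  letI := C.comodule
  lTensor_restrictCoact A (coaction A) C.incl C.incl_injective
    (fun ω => C.subcomodule 1 _ ω.2) ω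

instance : RelHopfModule A B C.OneForms where
  coact_smul b ω := by
    let _ := C.comodule
    have _ := C.comoduleAlgebra
    apply lTensor_injective C.incl_injective A
    rw [lTensor_incl_coaction, incl_smul, ComoduleAlgebra.coact_mul]
    have h := C.ι_colinear b
    rw [AlgHom.toLinearMap_apply] at h
    rw [h, ← lTensor_incl_coaction]
    generalize coaction A ω = y
    generalize coaction A b = x
    induction x with
    | zero => simp
    | add x x' hx hx' => simp only [map_add, LinearMap.add_apply, add_mul, hx, hx']
    | tmul a b =>
      induction y with
      | zero => simp
      | add y y' hy hy' => simp only [map_add, mul_add, hy, hy']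
      | tmul c m => simp [TensorProduct.map₂_apply_tmul]
  coact_op_smul ω b := by
    let _ := C.comodule
    have _ := C.comoduleAlgebra
    apply lTensor_injective C.incl_injective A
    rw [lTensor_incl_coaction, incl_op_smul, ComoduleAlgebra.coact_mul]
    have h := C.ι_colinear b
    rw [AlgHom.toLinearMap_apply] at h
    rw [unop_op, h, ← lTensor_incl_coaction]
    generalize coaction A ω = y
    generalize coaction A b = x
    induction x with
    | zero => simp
    | add x x' hx hx' => simp only [map_add, mul_add, hx, hx']
    | tmul a b =>
      induction y with
      | zero => simp
      | add y y' hy hy' => simp only [map_add, LinearMap.add_apply, add_mul, hy, hy']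
      | tmul c m => simp [TensorProduct.map₂_apply_tmul]

end CovariantStarCalculus

end Calculus

end QHS

open QHS

universe u v w w'

/-! Write `B` for the coinvariants and `M` for `Ω¹`. Takeuchi's functor replaces `M` by the
finite-dimensional `H`-comodule `Φ(M)`, and all questions about covariant metrics are settled there.

The main tool is the Haar functional `h` of `H`. Since `H` is spanned by coefficients of irreducible
corepresentations, it is a semisimple comodule, and `h` is the colinear projection onto `ℂ1`. It
yields `E(a) = a₍₁₎ h(π(a₍₂₎))`, a unital, right `B`-linear and left `A`-colinear map `A → B`. The
averaging map `a ⊗ n ↦ E(a S(n₍₋₁₎)) n₍₀₎` descends to `A ⊗ Φ(M)` and inverts the unit map `m ↦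
m₍₋₁₎ ⊗ [m₍₀₎]` on the cotensor product `A □ Φ(M)` (`takeuchiInv_takeuchi`, `takeuchi_takeuchiInv`).
An automorphism `τ` of `Φ(M)` therefore lifts to `M` by applying `id ⊗ τ` in the cotensor product.
The condition `MB⁺ = B⁺M` makes the right action of `B` visible as right multiplication on the
`A`-leg, so the lift is a bimodule map (`Phi.aut_bijective`).

A pairing determines its metric tensor as an inverse (`ext_pairing`) and is nondegenerate. Given two
metrics, `x ↦ (x, g'⁽¹⁾) g'⁽²⁾` carries one pairing to the other and is the only automorphism to do
so (`exists_smul_eq`, `eq_one_of_smul_eq`).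

For existence, the involution of the calculus descends to a conjugate-linear involution `J` of
`Φ(M)`, again by `MB⁺ = B⁺M`. A basis `e` with unitary coefficient matrix gives an invariant inner
product, so `⟨v, J w⟩` is an invariant bilinear form with inverse `∑ J(eᵢ) ⊗ eᵢ`. The pairing is
`ω₍₋₁₎ η₍₋₁₎ ⟨[ω₍₀₎], J[η₍₀₎]⟩`, and `g` is the average of any lift of the inverse tensor to `M ⊗ M`
(`nonempty_invariantForm`, `nonempty_covariantMetric`).

For decompositions, left comodules are regarded as modules over the free algebra on the dual space
of the coalgebra. Subcomodules and colinear maps are then exactly submodules and linear maps, so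
semisimplicity, isotypic components and Schur's lemma apply. Only submodules and homomorphisms
matter, so the free algebra serves as well as the convolution algebra and needs no relations
checked. -/

namespace QHS

/-! ### Comodules as modules over a free algebra of functionals -/

section DualAction

variable {C : Type*} [Ring C] [Bialgebra ℂ C]
variable {V W : Type*} [AddCommGroup V] [Module ℂ V] [AddCommGroup W] [Module ℂ W]

/-- Contraction of the left leg with a functional. -/
noncomputable def slice (X V : Type*) [AddCommGroup X] [Module ℂ X] [AddCommGroup V] [Module ℂ V]
    (φ : X →ₗ[ℂ] ℂ) : X ⊗[ℂ] V →ₗ[ℂ] V :=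
  TensorProduct.lid ℂ V ∘ₗ φ.rTensor V

@[simp] lemma slice_tmul {X : Type*} [AddCommGroup X] [Module ℂ X] (φ : X →ₗ[ℂ] ℂ) (x : X) (v : V) :
    slice X V φ (x ⊗ₜ v) = φ x • v := by simp [slice]

lemma slice_lTensor {X : Type*} [AddCommGroup X] [Module ℂ X] (φ : X →ₗ[ℂ] ℂ) (f : V →ₗ[ℂ] W)
    (t : X ⊗[ℂ] V) : slice X W φ (f.lTensor X t) = f (slice X V φ t) := by
  induction t with
  | zero => simp
  | add a b ha hb => simp only [map_add, ha, hb]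
  | tmul a b => simp

/-- Expand `t` along a basis of `X`: slicing with a coordinate functional returns the corresponding
coefficient in `V`. -/
lemma eq_zero_of_slice {X : Type*} [AddCommGroup X] [Module ℂ X] (t : X ⊗[ℂ] V)
    (h : ∀ φ, slice X V φ t = 0) : t = 0 := by
  classical
  let b := Module.Basis.ofVectorSpace ℂ X
  obtain ⟨s, rfl⟩ := (TensorProduct.equivFinsuppOfBasisLeft b (N := V)).symm.surjective t
  have hs : s = 0 := by
    ext i
    have := h (b.coord i)
    rw [TensorProduct.equivFinsuppOfBasisLeft_symm_apply] at this
    rw [Finsupp.sum, map_sum] at this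
    simp only [slice_tmul, Module.Basis.coord_apply, Module.Basis.repr_self, Finsupp.single_apply,
      ite_smul, one_smul, zero_smul] at this
    simpa [Finset.sum_ite_eq'] using this
  simp [hs]

lemma ext_slice {X : Type*} [AddCommGroup X] [Module ℂ X] {s t : X ⊗[ℂ] V}
    (h : ∀ φ, slice X V φ s = slice X V φ t) : s = t := by
  rw [← sub_eq_zero]
  exact eq_zero_of_slice _ fun φ => by rw [map_sub, h, sub_self]

variable (C)

/-- The ring acting on every left comodule over `C`. -/
abbrev DualRing := FreeAlgebra ℂ (C →ₗ[ℂ] ℂ)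

variable (V) in
/-- The action `φ · v = φ(v₍₋₁₎) v₍₀₎`. -/
noncomputable def dualRep [LeftComodule C V] : DualRing C →ₐ[ℂ] Module.End ℂ V :=
  FreeAlgebra.lift ℂ fun φ => slice C V φ ∘ₗ coaction C

noncomputable instance comodModule [LeftComodule C V] : Module (DualRing C) V :=
  Module.compHom V (dualRep C V).toRingHom

lemma dualRing_smul_def [LeftComodule C V] (r : DualRing C) (v : V) :
    r • v = dualRep C V r v := rfl

lemma ι_smul [LeftComodule C V] (φ : C →ₗ[ℂ] ℂ) (v : V) :
    FreeAlgebra.ι ℂ φ • v = slice C V φ (coaction C v) := by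
  rw [dualRing_smul_def, dualRep, FreeAlgebra.lift_ι_apply]
  rfl

instance [LeftComodule C V] : IsScalarTower ℂ (DualRing C) V where
  smul_assoc z r v := by simp [dualRing_smul_def]

variable {C}

lemma smul_mem_of_slice_mem [LeftComodule C V] {U : Submodule ℂ V}
    (hU : ∀ φ, ∀ x ∈ U, slice C V φ (coaction C x) ∈ U) (r : DualRing C) :
    ∀ x ∈ U, r • x ∈ U := by
  induction r using FreeAlgebra.induction with
  | grade0 z => intro x hx; rw [algebraMap_smul]; exact U.smul_mem z hx
  | grade1 φ => intro x hx; rw [ι_smul]; exact hU φ x hx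
  | mul a b ha hb => intro x hx; rw [mul_smul]; exact ha _ (hb _ hx)
  | add a b ha hb => intro x hx; rw [add_smul]; exact U.add_mem (ha _ hx) (hb _ hx)

/-- A subspace that is stable under the contractions of the coaction, as a submodule. -/
def stableSubmodule [LeftComodule C V] (U : Submodule ℂ V)
    (hU : ∀ φ, ∀ x ∈ U, slice C V φ (coaction C x) ∈ U) : Submodule (DualRing C) V :=
  { U with smul_mem' := fun r x hx => smul_mem_of_slice_mem hU r x hx }

/-- By flatness `X ⊗ U` is the kernel of `X ⊗ V → X ⊗ V/U`, and vanishing in the target is detected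
by slices. -/
lemma mem_range_lTensor_iff {X : Type*} [AddCommGroup X] [Module ℂ X] (U : Submodule ℂ V)
    (t : X ⊗[ℂ] V) :
    t ∈ LinearMap.range (U.subtype.lTensor X) ↔ ∀ φ, slice X V φ t ∈ U := by
  constructor
  · rintro ⟨s, rfl⟩ φ
    rw [slice_lTensor]
    exact Subtype.property _
  · intro h
    have hex : Function.Exact U.subtype U.mkQ := LinearMap.exact_subtype_mkQ U
    refine (Module.Flat.lTensor_exact X hex _).1 ?_
    refine eq_zero_of_slice _ fun φ => ?_
    rw [slice_lTensor]
    exact (Submodule.Quotient.mk_eq_zero U).2 (h φ)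

/-- With `isColinear_iff`, this is the dictionary between comodules and `DualRing C`-modules: the
conditions need testing only on the generators `φ`. -/
lemma isSubcomodule_iff [LeftComodule C V] (U : Submodule ℂ V) :
    IsSubcomodule C U ↔ ∀ φ, ∀ x ∈ U, slice C V φ (coaction C x) ∈ U := by
  simp only [IsSubcomodule, mem_range_lTensor_iff]
  exact ⟨fun h φ x hx => h x hx φ, fun h x hx φ => h φ x hx⟩

lemma isColinear_iff [LeftComodule C V] [LeftComodule C W] (f : V →ₗ[ℂ] W) :
    IsColinear C f ↔ ∀ φ v, slice C W φ (coaction C (f v)) = f (slice C V φ (coaction C v)) := by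
  constructor
  · intro h φ v
    rw [h, slice_lTensor]
  · intro h v
    exact ext_slice fun φ => by rw [h, slice_lTensor]

/-- A colinear map is linear over the ring of functionals. -/
def IsColinear.toLinearMap [LeftComodule C V] [LeftComodule C W] {f : V →ₗ[ℂ] W}
    (hf : IsColinear C f) : V →ₗ[DualRing C] W where
  toFun := f
  map_add' := f.map_add
  map_smul' r := by
    rw [isColinear_iff] at hf
    induction r using FreeAlgebra.induction with
    | grade0 z => intro x; simp
    | grade1 φ => intro x; simp [ι_smul, hf]
    | mul a b ha hb => intro x; simp only [mul_smul, ha, hb, RingHom.id_apply] at *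
    | add a b ha hb => intro x; simp only [add_smul, map_add, ha, hb, RingHom.id_apply] at *

@[simp] lemma IsColinear.toLinearMap_apply [LeftComodule C V] [LeftComodule C W] {f : V →ₗ[ℂ] W}
    (hf : IsColinear C f) (v : V) : hf.toLinearMap v = f v := rfl

lemma isColinear_of_dualRing [LeftComodule C V] [LeftComodule C W] (f : V →ₗ[DualRing C] W) :
    IsColinear C (f.restrictScalars ℂ) := by
  rw [isColinear_iff]
  intro φ v
  rw [← ι_smul, ← ι_smul]
  exact (f.map_smul _ _).symm

/-- Both notions concern the same subspaces; a `DualRing C`-submodule is automatically complex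
because the ring contains `ℂ`. -/
lemma isSimpleModule_iff_isIrreducible [LeftComodule C V] :
    IsSimpleModule (DualRing C) V ↔ IsIrreducible C V := by
  constructor
  · intro h
    refine ⟨IsSimpleModule.nontrivial (DualRing C) V, fun U hU => ?_⟩
    rw [isSubcomodule_iff] at hU
    rcases eq_bot_or_eq_top (stableSubmodule U hU) with h | h
    · left
      ext x
      exact (SetLike.ext_iff.1 h x : x ∈ stableSubmodule U hU ↔ x ∈ ⊥)
    · right
      ext x
      exact (SetLike.ext_iff.1 h x : x ∈ stableSubmodule U hU ↔ x ∈ ⊤)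
  · rintro ⟨hn, h⟩
    rw [isSimpleModule_iff]
    have : Nontrivial (Submodule (DualRing C) V) := (Submodule.nontrivial_iff _).2 hn
    refine ⟨fun U => ?_⟩
    have hU : IsSubcomodule C (U.restrictScalars ℂ) := by
      rw [isSubcomodule_iff]
      intro φ x hx
      rw [← ι_smul]
      exact U.smul_mem _ hx
    rcases h _ hU with h | h
    · left; ext x; exact (SetLike.ext_iff.1 h x : x ∈ U.restrictScalars ℂ ↔ x ∈ ⊥)
    · right; ext x; exact (SetLike.ext_iff.1 h x : x ∈ U.restrictScalars ℂ ↔ x ∈ ⊤)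

end DualAction

end QHS

namespace QHS

/-! ### Complete reducibility and unitary bases -/

section Reducibility

variable {H : Type*} [Ring H] [HopfAlgebra ℂ H]

/-- The matrix coefficient map `v ↦ v₍₋₁₎ ψ(v₍₀₎)`. -/
noncomputable def coefMap {V : Type*} [AddCommGroup V] [Module ℂ V] [LeftComodule H V]
    (ψ : V →ₗ[ℂ] ℂ) : V →ₗ[ℂ] H :=
  TensorProduct.rid ℂ H ∘ₗ ψ.lTensor H ∘ₗ coaction H

/-- Coassociativity with `ψ` applied to the last leg. These maps carry information about the regular
comodule `H` over to arbitrary comodules. -/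
lemma coefMap_colinear {V : Type*} [AddCommGroup V] [Module ℂ V] [LeftComodule H V]
    (ψ : V →ₗ[ℂ] ℂ) : IsColinear H (coefMap (H := H) ψ) := by
  intro v
  change Coalgebra.comul (R := ℂ) (coefMap (H := H) ψ v) = _
  have h1 : ∀ t : H ⊗[ℂ] V, Coalgebra.comul (R := ℂ) (TensorProduct.rid ℂ H (ψ.lTensor H t)) =
      (TensorProduct.rid ℂ H ∘ₗ ψ.lTensor H).lTensor H
        (TensorProduct.assoc ℂ H H V ((Coalgebra.comul (R := ℂ) (A := H)).rTensor V t)) := by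
    intro t
    induction t with
    | zero => simp
    | add a b ha hb => simp only [map_add, ha, hb]
    | tmul a b =>
      simp only [LinearMap.lTensor_tmul, TensorProduct.rid_tmul, map_smul, LinearMap.rTensor_tmul]
      generalize Coalgebra.comul (R := ℂ) a = z
      induction z with
      | zero => simp
      | add a b ha hb => simp only [map_add, TensorProduct.add_tmul, smul_add, ha, hb]
      | tmul a b => simp
  have h2 : coefMap (H := H) ψ v = TensorProduct.rid ℂ H (ψ.lTensor H (coaction H v)) := rfl
  rw [h2, h1, coaction, LeftComodule.coassoc, ← LinearMap.lTensor_comp_apply]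
  rfl

/-- The counit axiom. Since `ψ v` is recovered from the coefficient, the coefficient maps of a basis
of functionals jointly separate points. -/
lemma counit_coefMap {V : Type*} [AddCommGroup V] [Module ℂ V] [LeftComodule H V]
    (ψ : V →ₗ[ℂ] ℂ) (v : V) : Coalgebra.counit (R := ℂ) (coefMap (H := H) ψ v) = ψ v := by
  have h1 : ∀ t : H ⊗[ℂ] V, Coalgebra.counit (R := ℂ) (TensorProduct.rid ℂ H (ψ.lTensor H t)) =
      ψ (TensorProduct.lid ℂ V ((Coalgebra.counit (R := ℂ) (A := H)).rTensor V t)) := by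
    intro t
    induction t with
    | zero => simp
    | add a b ha hb => simp only [map_add, ha, hb]
    | tmul a b => simp [mul_comm]
  have h2 : coefMap (H := H) ψ v = TensorProduct.rid ℂ H (ψ.lTensor H (coaction H v)) := rfl
  rw [h2, h1, coaction, LeftComodule.counit]
  simp

/-- The comodule `ℂⁿ` of a matrix corepresentation, with `δ(eᵢ) = ∑ⱼ cᵢⱼ ⊗ eⱼ`. -/
@[reducible] noncomputable def rowComodule {n : ℕ} (c : Matrix (Fin n) (Fin n) H)
    (hc : IsCorepresentation H c) : LeftComodule H (Fin n → ℂ) where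
  coact := (Pi.basisFun ℂ (Fin n)).constr ℂ fun i => ∑ j, c i j ⊗ₜ[ℂ] Pi.basisFun ℂ (Fin n) j
  coassoc x := by
    rw [← LinearMap.comp_apply, ← LinearEquiv.coe_toLinearMap, ← LinearMap.comp_apply,
      ← LinearMap.comp_apply]
    congr 1
    refine (Pi.basisFun ℂ (Fin n)).ext fun i => ?_
    simp only [LinearMap.comp_apply, Module.Basis.constr_basis, map_sum, LinearMap.rTensor_tmul,
      LinearMap.lTensor_tmul, hc.comul, TensorProduct.sum_tmul, LinearEquiv.coe_coe,
      TensorProduct.assoc_tmul, TensorProduct.tmul_sum]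
    exact Finset.sum_comm
  counit x := by
    change _ = TensorProduct.mk ℂ ℂ (Fin n → ℂ) 1 x
    rw [← LinearMap.comp_apply]
    congr 1
    refine (Pi.basisFun ℂ (Fin n)).ext fun i => ?_
    simp only [LinearMap.comp_apply, Module.Basis.constr_basis, map_sum, LinearMap.rTensor_tmul,
      hc.counit, TensorProduct.mk_apply]
    rw [Finset.sum_eq_single i] <;> simp +contextual [eq_comm]

lemma rowComodule_coaction {n : ℕ} (c : Matrix (Fin n) (Fin n) H)
    (hc : IsCorepresentation H c) (i : Fin n) :
    letI := rowComodule c hc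
    coaction H (Pi.basisFun ℂ (Fin n) i) = ∑ j, c i j ⊗ₜ[ℂ] Pi.basisFun ℂ (Fin n) j := by
  let _ := rowComodule c hc
  exact Module.Basis.constr_basis _ _ _ _

/-- Matches the row-vector invariance in `IsIrreducibleMatrix` with stability under the generators
of `DualRing H`. -/
lemma rowComodule_slice {n : ℕ} (c : Matrix (Fin n) (Fin n) H)
    (hc : IsCorepresentation H c) (φ : H →ₗ[ℂ] ℂ) (x : Fin n → ℂ) :
    letI := rowComodule c hc
    slice H (Fin n → ℂ) φ (coaction H x) = Matrix.vecMul x (c.map φ) := by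
  let _ := rowComodule c hc
  change (slice H (Fin n → ℂ) φ ∘ₗ coaction H) x = (Matrix.vecMulLinear (c.map φ)) x
  congr 1
  refine (Pi.basisFun ℂ (Fin n)).ext fun i => ?_
  rw [LinearMap.comp_apply, rowComodule_coaction]
  ext k
  simp [Pi.single_apply]

lemma rowComodule_isSimple {n : ℕ} (c : Matrix (Fin n) (Fin n) H)
    (hc : IsCorepresentation H c) (hi : IsIrreducibleMatrix H c) :
    letI := rowComodule c hc
    IsSimpleModule (DualRing H) (Fin n → ℂ) := by
  let _ := rowComodule c hc
  rw [isSimpleModule_iff_isIrreducible]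
  have : Nonempty (Fin n) := ⟨⟨0, hi.1⟩⟩
  refine ⟨inferInstance, fun U hU => hi.2 U fun φ x hx => ?_⟩
  rw [isSubcomodule_iff] at hU
  rw [← rowComodule_slice c hc]
  exact hU φ x hx

/-- The colinear map `eᵢ ↦ cᵢⱼ`. -/
noncomputable def rowToAlg {n : ℕ} (c : Matrix (Fin n) (Fin n) H) (j : Fin n) :
    (Fin n → ℂ) →ₗ[ℂ] H :=
  (Pi.basisFun ℂ (Fin n)).constr ℂ fun i => c i j

lemma rowToAlg_basis {n : ℕ} (c : Matrix (Fin n) (Fin n) H) (i j : Fin n) :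
    rowToAlg c j (Pi.basisFun ℂ (Fin n) i) = c i j :=
  Module.Basis.constr_basis _ _ _ _

/-- With `j` fixed, the formula for `Δ(cᵢⱼ)` is the row coaction in the index `i`; each column of
`c` thus spans an image of the row comodule in `H`. -/
lemma rowToAlg_colinear {n : ℕ} (c : Matrix (Fin n) (Fin n) H)
    (hc : IsCorepresentation H c) (j : Fin n) :
    letI := rowComodule c hc
    IsColinear H (rowToAlg c j) := by
  let _ := rowComodule c hc
  intro x
  rw [← LinearMap.comp_apply, ← LinearMap.comp_apply]
  congr 1
  refine (Pi.basisFun ℂ (Fin n)).ext fun i => ?_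
  rw [LinearMap.comp_apply, LinearMap.comp_apply, rowComodule_coaction, rowToAlg_basis, map_sum]
  simp only [LinearMap.lTensor_tmul, rowToAlg_basis]
  exact hc.comul i j

variable [StarRing H]

/-- Every spanning coefficient lies in the image of a simple row comodule, which is zero or simple.
Hence the simple submodules add up to `H`. -/
lemma IsCQGAlgebra.isSemisimpleModule (hH : IsCQGAlgebra H) :
    IsSemisimpleModule (DualRing H) H := by
  refine IsSemisimpleModule.of_sSup_simples_eq_top ?_
  rw [eq_top_iff]
  set T := sSup {m : Submodule (DualRing H) H | IsSimpleModule (DualRing H) m} with hT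
  suffices h : (⊤ : Submodule ℂ H) ≤ T.restrictScalars ℂ from fun x _ => h (x := x) trivial
  rw [← hH, Submodule.span_le]
  rintro _ ⟨n, c, hc, -, hi, i, j, rfl⟩
  let _ := rowComodule c hc
  have hs := rowComodule_isSimple c hc hi
  change c i j ∈ T
  set g := (rowToAlg_colinear c hc j).toLinearMap
  have hg : g (Pi.basisFun ℂ (Fin n) i) = c i j := rowToAlg_basis c i j
  rcases g.injective_or_eq_zero with h | h
  · have : IsSimpleModule (DualRing H) (LinearMap.range g) :=
      IsSimpleModule.congr (LinearEquiv.ofInjective g h).symm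
    have hle : LinearMap.range g ≤ T := le_sSup this
    exact hle ⟨_, hg⟩
  · rw [← hg, h]
    exact T.zero_mem

/-- A simple module that maps nontrivially to `H` is the row comodule of a unitary
corepresentation. -/
lemma IsCQGAlgebra.exists_rowComodule_equiv (hH : IsCQGAlgebra H) {W : Type*} [AddCommGroup W]
    [Module (DualRing H) W] [IsSimpleModule (DualRing H) W] (f : W →ₗ[DualRing H] H) (hf : f ≠ 0) :
    ∃ (n : ℕ) (c : Matrix (Fin n) (Fin n) H) (hc : IsCorepresentation H c),
      c ∈ unitary (Matrix (Fin n) (Fin n) H) ∧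
      letI := rowComodule c hc
      Nonempty ((Fin n → ℂ) ≃ₗ[DualRing H] W) := by
  have := hH.isSemisimpleModule
  -- A nonzero map out of a simple module is injective, and semisimplicity of `H` gives it a
  -- colinear retraction `h`.
  obtain ⟨h, hh⟩ := IsSemisimpleModule.extension_property f (LinearMap.injective_of_ne_zero hf)
    LinearMap.id
  by_contra! hcon
  -- If `W` is no unitary row comodule, Schur's lemma makes `h` vanish on all the spanning
  -- coefficients. Then `h = 0`, although `h ∘ f = id` and `f ≠ 0`.
  have hker : (⊤ : Submodule ℂ H) ≤ (LinearMap.ker h).restrictScalars ℂ := by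
    rw [← hH, Submodule.span_le]
    rintro _ ⟨n, c, hc, hu, hi, i, j, rfl⟩
    let _ := rowComodule c hc
    have hs := rowComodule_isSimple c hc hi
    set g := (rowToAlg_colinear c hc j).toLinearMap
    have hg : g (Pi.basisFun ℂ (Fin n) i) = c i j := rowToAlg_basis c i j
    rcases (h ∘ₗ g).bijective_or_eq_zero with hb | hb
    · exact ((hcon n c hc hu).false (LinearEquiv.ofBijective _ hb)).elim
    · change h (c i j) = 0
      rw [← hg, ← LinearMap.comp_apply, hb, LinearMap.zero_apply]
  apply hf
  have h0 : h = 0 := by ext x; exact hker (x := x) trivial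
  rw [h0, LinearMap.zero_comp] at hh
  ext x
  have : (x : W) = 0 := (LinearMap.congr_fun hh x).symm
  simp [this]

variable {V : Type*} [AddCommGroup V] [Module ℂ V] [LeftComodule H V] [FiniteDimensional ℂ V]

/-- The coefficient maps of a dual basis embed `V` into a finite power of the semisimple module `H`.
-/
lemma IsCQGAlgebra.isSemisimpleModule_comodule (hH : IsCQGAlgebra H) :
    IsSemisimpleModule (DualRing H) V := by
  have := hH.isSemisimpleModule
  let b := Module.finBasis ℂ V
  let F : V →ₗ[DualRing H] (Fin (Module.finrank ℂ V) → H) :=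
    LinearMap.pi fun i => (coefMap_colinear (b.coord i)).toLinearMap
  refine IsSemisimpleModule.of_injective F ?_
  rw [← LinearMap.ker_eq_bot, LinearMap.ker_eq_bot']
  intro v hv
  refine b.ext_elem fun i => ?_
  have : coefMap (H := H) (b.coord i) v = 0 := congrFun hv i
  have h2 := counit_coefMap (H := H) (b.coord i) v
  rw [this, map_zero] at h2
  simpa using h2.symm

/-- Every finite-dimensional comodule over a compact quantum group algebra is unitarizable. -/
lemma IsCQGAlgebra.exists_unitary_basis (hH : IsCQGAlgebra H) :
    ∃ (ι : Type) (_ : Fintype ι) (_ : DecidableEq ι) (e : Module.Basis ι ℂ V) (u : Matrix ι ι H),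
      u ∈ unitary (Matrix ι ι H) ∧ ∀ i, coaction H (e i) = ∑ j, u i j ⊗ₜ[ℂ] e j := by
  classical
  have := hH.isSemisimpleModule_comodule (V := V)
  have : Module.Finite (DualRing H) V := Module.Finite.of_restrictScalars_finite ℂ (DualRing H) V
  obtain ⟨m, S, Ψ, hS⟩ := IsSemisimpleModule.exists_linearEquiv_fin_dfinsupp (DualRing H) V
  have key : ∀ k, ∃ (n : ℕ) (c : Matrix (Fin n) (Fin n) H) (hc : IsCorepresentation H c),
      c ∈ unitary (Matrix (Fin n) (Fin n) H) ∧
      letI := rowComodule c hc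
      Nonempty ((Fin n → ℂ) ≃ₗ[DualRing H] S k) := by
    intro k
    have := hS k
    have := IsSimpleModule.nontrivial (DualRing H) (S k)
    obtain ⟨x, hx⟩ := exists_ne (0 : S k)
    have hx' : (x : V) ≠ 0 := fun h => hx (Subtype.ext h)
    -- A functional that does not vanish on `S k` has a coefficient map that does not vanish there,
    -- by the counit, so `S k` maps nontrivially to `H`.
    obtain ⟨ψ, hψ⟩ : ∃ ψ : V →ₗ[ℂ] ℂ, ψ x ≠ 0 := by
      by_contra! h
      exact hx' ((Module.forall_dual_apply_eq_zero_iff ℂ _).1 h)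
    refine hH.exists_rowComodule_equiv
      ((coefMap_colinear (H := H) ψ).toLinearMap ∘ₗ (S k).subtype) fun h => hψ ?_
    rw [← counit_coefMap (H := H) ψ]
    have := LinearMap.congr_fun h x
    simp only [LinearMap.comp_apply, Submodule.subtype_apply, IsColinear.toLinearMap_apply,
      LinearMap.zero_apply] at this
    rw [this, map_zero]
  choose n c hc hu E using key
  let E' : ∀ k, (Fin (n k) → ℂ) ≃ₗ[ℂ] S k := fun k =>
    letI := rowComodule (c k) (hc k)
    (E k).some.restrictScalars ℂ
  -- The standard bases of the row comodules are glued and transported to `V`; the coefficient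
  -- matrix is then block diagonal with unitary blocks.
  let b : Module.Basis (Σ k, Fin (n k)) ℂ (Π₀ k, S k) :=
    DFinsupp.basis fun k => (Pi.basisFun ℂ (Fin (n k))).map (E' k)
  let e := b.map (Ψ.symm.restrictScalars ℂ)
  have he : ∀ k i, e ⟨k, i⟩ = Ψ.symm (DFinsupp.single k (E' k (Pi.basisFun ℂ _ i))) := by
    intro k i
    simp [e, b, DFinsupp.basis, -Pi.basisFun_apply]
  refine ⟨_, inferInstance, inferInstance, e, Matrix.blockDiagonal' c, ?_, ?_⟩
  · rw [Unitary.mem_iff, Matrix.star_eq_conjTranspose, Matrix.blockDiagonal'_conjTranspose,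
      ← Matrix.blockDiagonal'_mul, ← Matrix.blockDiagonal'_mul]
    constructor
    · rw [← Matrix.blockDiagonal'_one]
      exact congrArg _ (funext fun k => (Unitary.mem_iff.1 (hu k)).1)
    · rw [← Matrix.blockDiagonal'_one]
      exact congrArg _ (funext fun k => (Unitary.mem_iff.1 (hu k)).2)
  · rintro ⟨k, i⟩
    let _ := rowComodule (c k) (hc k)
    let g : (Fin (n k) → ℂ) →ₗ[DualRing H] V :=
      Ψ.symm.toLinearMap ∘ₗ DFinsupp.lsingle k ∘ₗ (E k).some.toLinearMap
    have hg : ∀ i, g (Pi.basisFun ℂ _ i) = e ⟨k, i⟩ := fun i => (he k i).symm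
    have h1 := isColinear_of_dualRing g (Pi.basisFun ℂ _ i)
    rw [LinearMap.restrictScalars_apply, hg, rowComodule_coaction, map_sum] at h1
    rw [h1, Fintype.sum_sigma, Finset.sum_eq_single k]
    · refine Finset.sum_congr rfl fun j _ => ?_
      rw [LinearMap.lTensor_tmul, LinearMap.restrictScalars_apply, hg,
        Matrix.blockDiagonal'_apply_eq]
    · intro l _ hl
      refine Finset.sum_eq_zero fun j _ => ?_
      rw [Matrix.blockDiagonal'_apply_ne _ _ _ hl.symm, TensorProduct.zero_tmul]
    · simp

/-- The Haar functional of a compact quantum group algebra. -/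
lemma IsCQGAlgebra.exists_haar (hH : IsCQGAlgebra H) :
    ∃ h : H →ₗ[ℂ] ℂ, h 1 = 1 ∧
      ∀ x, TensorProduct.rid ℂ H (h.lTensor H (Coalgebra.comul (R := ℂ) x)) = algebraMap ℂ H (h x) := by
  have := hH.isSemisimpleModule
  have hone : ∀ φ, ∀ x ∈ Submodule.span ℂ {(1 : H)},
      slice H H φ (coaction H x) ∈ Submodule.span ℂ {(1 : H)} := by
    intro φ x hx
    obtain ⟨z, rfl⟩ := Submodule.mem_span_singleton.1 hx
    have : coaction H (1 : H) = 1 ⊗ₜ 1 := Bialgebra.comul_one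
    rw [map_smul, this, map_smul, slice_tmul]
    exact Submodule.smul_mem _ _ (Submodule.smul_mem _ _ (Submodule.mem_span_singleton_self _))
  -- `ℂ1` is a subcomodule because `Δ(1) = 1 ⊗ 1`; the Haar functional is a colinear projection onto
  -- it, read through `ε`.
  obtain ⟨p, hp⟩ := IsSemisimpleModule.extension_property (stableSubmodule _ hone).subtype
    Subtype.val_injective LinearMap.id
  let q : H →ₗ[DualRing H] H := (stableSubmodule _ hone).subtype ∘ₗ p
  have hq1 : q 1 = 1 := by
    have := LinearMap.congr_fun hp ⟨1, Submodule.mem_span_singleton_self (1 : H)⟩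
    exact congrArg Subtype.val this
  have hq : ∀ x, q x = algebraMap ℂ H (Coalgebra.counit (R := ℂ) (q x)) := by
    intro x
    obtain ⟨z, hz⟩ := Submodule.mem_span_singleton.1
      (show q x ∈ Submodule.span ℂ {(1 : H)} from (p x).2)
    rw [← hz, map_smul, Bialgebra.counit_one, smul_eq_mul, mul_one, Algebra.algebraMap_eq_smul_one]
  refine ⟨Coalgebra.counit (R := ℂ) (A := H) ∘ₗ q.restrictScalars ℂ, ?_, fun x => ?_⟩
  · simp [hq1]
  -- `x₍₁₎ h(x₍₂₎) = (id ⊗ ε)(id ⊗ q)Δ(x) = (id ⊗ ε)Δ(q x) = q x`, which is the scalar `h(x)`.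
  · have h1 := isColinear_of_dualRing q x
    rw [LinearMap.lTensor_comp_apply]
    have h2 : (q.restrictScalars ℂ).lTensor H (Coalgebra.comul (R := ℂ) x) =
        Coalgebra.comul (R := ℂ) (q x) := h1.symm
    rw [h2, Coalgebra.lTensor_counit_comul]
    simpa using hq x

end Reducibility

end QHS

namespace QHS

/-! ### Decompositions into irreducible comodules -/

section Decomposition

variable {C : Type u} [Ring C] [Bialgebra ℂ C]
variable {V : Type v} [AddCommGroup V] [Module ℂ V] [LeftComodule C V]

/-- The carrier of a submodule over the ring of functionals, as a comodule. -/
def SubCarrier (S : Submodule (DualRing C) V) : Type v := S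

noncomputable instance (S : Submodule (DualRing C) V) : AddCommGroup (SubCarrier S) :=
  inferInstanceAs (AddCommGroup S)

noncomputable instance (S : Submodule (DualRing C) V) : Module ℂ (SubCarrier S) :=
  inferInstanceAs (Module ℂ (S.restrictScalars ℂ))

/-- The inclusion of the carrier. -/
noncomputable def SubCarrier.incl (S : Submodule (DualRing C) V) : SubCarrier S →ₗ[ℂ] V :=
  (S.restrictScalars ℂ).subtype

noncomputable instance (S : Submodule (DualRing C) V) : LeftComodule C (SubCarrier S) :=
  LeftComodule.restrict C (SubCarrier.incl S) Subtype.val_injective fun x =>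
    (mem_range_lTensor_iff (S.restrictScalars ℂ) (coaction C (SubCarrier.incl S x))).2 fun φ => by
      rw [← ι_smul]
      exact S.smul_mem _ x.2

lemma SubCarrier.incl_colinear (S : Submodule (DualRing C) V) :
    IsColinear C (SubCarrier.incl S) :=
  fun x => (lTensor_restrictCoact C (coaction C) (SubCarrier.incl S)
    Subtype.val_injective _ x).symm

/-- The carrier is isomorphic to the submodule. -/
noncomputable def SubCarrier.equiv (S : Submodule (DualRing C) V) : SubCarrier S ≃ₗ[DualRing C] S where
  toFun x := x
  invFun x := x
  map_add' _ _ := rfl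
  map_smul' r x := Subtype.ext ((SubCarrier.incl_colinear S).toLinearMap.map_smul r x)

/-- A finite-dimensional semisimple comodule is a finite direct sum of irreducible ones. -/
lemma exists_irreducibleDecomposition [FiniteDimensional ℂ V]
    [IsSemisimpleModule (DualRing C) V] :
    ∃ D : IrreducibleDecomposition.{u, v, v} C V, ∀ i, 0 < D.n i := by
  classical
  have : Module.Finite (DualRing C) V := Module.Finite.of_restrictScalars_finite ℂ (DualRing C) V
  have : Finite (isotypicComponents (DualRing C) V) :=
    WellFoundedGT.finite_of_sSupIndep (sSupIndep_isotypicComponents (DualRing C) V)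
  obtain ⟨m, ⟨σ⟩⟩ := Finite.exists_equiv_fin (isotypicComponents (DualRing C) V)
  let N : Fin m → Submodule (DualRing C) V := fun i => (σ.symm i).1
  have hN : ∀ i, N i ∈ isotypicComponents (DualRing C) V := fun i => (σ.symm i).2
  have ind : iSupIndep N :=
    ((sSupIndep_iff _).1 (sSupIndep_isotypicComponents (DualRing C) V)).comp σ.symm.injective
  have htop : ⨆ i, N i = ⊤ := by
    rw [← sSup_isotypicComponents (DualRing C) V, sSup_eq_iSup']
    exact σ.symm.iSup_comp (g := fun c : isotypicComponents (DualRing C) V => c.1)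
  -- Each isotypic component is a finite power of one simple submodule, with nonzero exponent
  -- because the component is nontrivial.
  have hfun : ∀ i, ∃ (n : ℕ) (_ : NeZero n) (S : Submodule (DualRing C) V),
      S ≤ N i ∧ IsSimpleModule (DualRing C) S ∧ Nonempty (N i ≃ₗ[DualRing C] Fin n → S) := by
    intro i
    have : Nontrivial (N i) := inferInstanceAs (Nontrivial (σ.symm i).1)
    have : IsSemisimpleModule (DualRing C) (N i) := inferInstance
    exact (IsIsotypic.isotypicComponents (hN i)).submodule_linearEquiv_fun
  choose n hn S hSN hS e using hfun
  let Ψ : V ≃ₗ[DualRing C] (∀ i, Fin (n i) → SubCarrier (S i)) :=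
    (ind.linearEquiv htop).symm.trans ((DFinsupp.linearEquivFunOnFintype).trans
      (LinearEquiv.piCongrRight fun i => (e i).some.trans
        (LinearEquiv.piCongrRight fun _ => (SubCarrier.equiv (S i)).symm)))
  refine ⟨{
    m := m
    n := n
    W := fun i => SubCarrier (S i)
    irreducible := fun i => isSimpleModule_iff_isIrreducible.1
      (IsSimpleModule.congr (SubCarrier.equiv (S i)))
    not_iso := fun i j hij h => hij ?_
    equiv := Ψ.restrictScalars ℂ
    colinear := fun i k => isColinear_of_dualRing
      (LinearMap.proj k ∘ₗ LinearMap.proj i ∘ₗ Ψ.toLinearMap) },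
    fun i => Nat.pos_of_ne_zero (hn i).1⟩
  -- Isomorphic simple submodules have the same isotypic component, so the indices agree.
  obtain ⟨f, hf⟩ := h
  let f' : SubCarrier (S i) ≃ₗ[DualRing C] SubCarrier (S j) :=
    LinearEquiv.ofBijective hf.toLinearMap f.bijective
  apply σ.symm.injective
  apply Subtype.ext
  change N i = N j
  rw [eq_isotypicComponent_of_le (hN i) (hSN i), eq_isotypicComponent_of_le (hN j) (hSN j)]
  exact (((SubCarrier.equiv (S i)).symm.trans f').trans (SubCarrier.equiv (S j))).isotypicComponent_eq

/-! ### Schur's lemma and automorphisms of a decomposition -/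

/-- Action of families of matrices on multiplicities. -/
noncomputable def matAct {R : Type*} [Ring R] {m : ℕ} {n : Fin m → ℕ} {W : Fin m → Type*}
    [∀ i, AddCommGroup (W i)] [∀ i, Module ℂ (W i)] [∀ i, Module R (W i)]
    [∀ i, SMulCommClass R ℂ (W i)]
    (M : ∀ i, Matrix (Fin (n i)) (Fin (n i)) ℂ) :
    (∀ i, Fin (n i) → W i) →ₗ[R] (∀ i, Fin (n i) → W i) :=
  LinearMap.pi fun i => LinearMap.pi fun j =>
    ∑ k, M i j k • (LinearMap.proj (φ := fun _ => W i) k ∘ₗ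
      LinearMap.proj (R := R) (φ := fun i => Fin (n i) → W i) i)

section MatAct

variable {R : Type*} [Ring R] {m : ℕ} {n : Fin m → ℕ} {W : Fin m → Type*}
    [∀ i, AddCommGroup (W i)] [∀ i, Module ℂ (W i)] [∀ i, Module R (W i)]
    [∀ i, SMulCommClass R ℂ (W i)]

lemma matAct_apply (M : ∀ i, Matrix (Fin (n i)) (Fin (n i)) ℂ) (x : ∀ i, Fin (n i) → W i)
    (i : Fin m) (j : Fin (n i)) : matAct (R := R) M x i j = ∑ k, M i j k • x i k := by
  simp [matAct, LinearMap.sum_apply]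

lemma matAct_one (x : ∀ i, Fin (n i) → W i) :
    matAct (R := R) (fun i => (1 : Matrix (Fin (n i)) (Fin (n i)) ℂ)) x = x := by
  ext i j
  rw [matAct_apply]
  simp [Matrix.one_apply]

lemma matAct_mul (M N : ∀ i, Matrix (Fin (n i)) (Fin (n i)) ℂ) (x : ∀ i, Fin (n i) → W i) :
    matAct (R := R) (fun i => M i * N i) x = matAct (R := R) M (matAct (R := R) N x) := by
  ext i j
  simp only [matAct_apply, Matrix.mul_apply, Finset.sum_smul, Finset.smul_sum, mul_smul]
  exact Finset.sum_comm

/-- A vector supported at one index `(i, k)`, with a nonzero entry, reads off column `k` of the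
`i`-th matrix. -/
lemma matAct_injective [∀ i, Nontrivial (W i)] {M N : ∀ i, Matrix (Fin (n i)) (Fin (n i)) ℂ}
    (h : ∀ x : (∀ i, Fin (n i) → W i), matAct (R := R) M x = matAct (R := R) N x) : M = N := by
  classical
  ext i j k
  obtain ⟨w, hw⟩ := exists_ne (0 : W i)
  have h1 := congrFun (congrFun (h (Pi.single i (Pi.single k w))) i) j
  simp only [matAct_apply, Pi.single_eq_same, Pi.single_apply, smul_ite, smul_zero,
    Finset.sum_ite_eq', Finset.mem_univ, if_true] at h1
  exact smul_left_injective ℂ hw h1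

/-- Endomorphisms of a direct sum of pairwise non-isomorphic simple modules act by matrices. -/
lemma exists_matAct_eq [Algebra ℂ R] [∀ i, IsScalarTower ℂ R (W i)] [∀ i, IsSimpleModule R (W i)]
    [FiniteDimensional ℂ (∀ i, Fin (n i) → W i)]
    (hW : ∀ i j, i ≠ j → IsEmpty (W i ≃ₗ[R] W j))
    (T : (∀ i, Fin (n i) → W i) →ₗ[R] (∀ i, Fin (n i) → W i)) :
    ∃ M : ∀ i, Matrix (Fin (n i)) (Fin (n i)) ℂ, ∀ x, T x = matAct (R := R) M x := by
  classical
  let c : ∀ (i : Fin m) (j : Fin (n i)) (i' : Fin m) (k : Fin (n i')), W i' →ₗ[R] W i :=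
    fun i j i' k => LinearMap.proj j ∘ₗ LinearMap.proj i ∘ₗ T ∘ₗ
      LinearMap.single R (fun i => Fin (n i) → W i) i' ∘ₗ LinearMap.single R (fun _ => W i') k
  have hne : ∀ i j i' k, i ≠ i' → c i j i' k = 0 := by
    intro i j i' k h
    rcases (c i j i' k).bijective_or_eq_zero with hb | h0
    · exact ((hW i' i h.symm).false (LinearEquiv.ofBijective _ hb)).elim
    · exact h0
  have hscal : ∀ i j k, ∃ z : ℂ, ∀ w, c i j i k w = z • w := by
    intro i j k
    -- The index `k` embeds `W i` in the finite-dimensional sum, so Schur's lemma over `ℂ` gives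
    -- scalars. If `n i = 0`, no such `k` exists and nothing is required of `W i`.
    have : FiniteDimensional ℂ (W i) :=
      FiniteDimensional.of_injective
        (LinearMap.single ℂ (fun i => Fin (n i) → W i) i ∘ₗ LinearMap.single ℂ (fun _ => W i) k)
        ((Pi.single_injective (M := fun i => Fin (n i) → W i) i).comp
          (Pi.single_injective (M := fun _ => W i) k))
    obtain ⟨z, hz⟩ :=
      (IsSimpleModule.algebraMap_end_bijective_of_isAlgClosed (A := R) (V := W i) ℂ).2 (c i j i k)
    exact ⟨z, fun w => by rw [← hz]; rfl⟩
  choose M' hM using hscal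
  let M : ∀ i, Matrix (Fin (n i)) (Fin (n i)) ℂ := fun i => Matrix.of (M' i)
  refine ⟨M, fun x => ?_⟩
  ext i j
  rw [matAct_apply]
  have hx : x = ∑ i', ∑ k, Pi.single i' (Pi.single k (x i' k)) := by
    conv_lhs => rw [← Finset.univ_sum_single x]
    refine Finset.sum_congr rfl fun i' _ => ?_
    conv_lhs => rw [← Finset.univ_sum_single (x i')]
    exact map_sum (LinearMap.single R (fun i => Fin (n i) → W i) i') _ _
  conv_lhs => rw [hx]
  simp only [map_sum, Finset.sum_apply]
  have hc : ∀ i' k, T (Pi.single i' (Pi.single k (x i' k))) i j = c i j i' k (x i' k) :=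
    fun _ _ => rfl
  simp only [hc]
  rw [Finset.sum_eq_single i]
  · exact Finset.sum_congr rfl fun k _ => hM i j k _
  · intro i' _ h
    exact Finset.sum_eq_zero fun k _ => by rw [hne _ _ _ _ h.symm, LinearMap.zero_apply]
  · simp

end MatAct

variable (D : IrreducibleDecomposition.{u, v, w} C V)

/-- The isomorphism of a decomposition is linear over the ring of functionals. -/
noncomputable def IrreducibleDecomposition.equivDual :
    V ≃ₗ[DualRing C] (∀ i, Fin (D.n i) → D.W i) :=
  { D.equiv with
    map_smul' := fun r x => by
      ext i k
      exact (D.colinear i k).toLinearMap.map_smul r x }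

@[simp] lemma IrreducibleDecomposition.equivDual_apply (x : V) : D.equivDual x = D.equiv x := rfl

/-- The automorphism of `V` given by a family of invertible matrices. -/
noncomputable def IrreducibleDecomposition.glEquiv (γ : ∀ i, GL (Fin (D.n i)) ℂ) :
    V ≃ₗ[DualRing C] V where
  toFun v := D.equivDual.symm (matAct (R := DualRing C) (fun i => (γ i).1) (D.equivDual v))
  invFun v := D.equivDual.symm (matAct (R := DualRing C) (fun i => (γ i).2) (D.equivDual v))
  map_add' := by simp
  map_smul' := by simp
  left_inv v := by
    beta_reduce
    rw [LinearEquiv.apply_symm_apply, ← matAct_mul]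
    simp only [Units.inv_eq_val_inv, Units.inv_mul, matAct_one,
      LinearEquiv.symm_apply_apply]
  right_inv v := by
    beta_reduce
    rw [LinearEquiv.apply_symm_apply, ← matAct_mul]
    simp only [Units.inv_eq_val_inv, Units.mul_inv, matAct_one, LinearEquiv.symm_apply_apply]

lemma IrreducibleDecomposition.equivDual_glEquiv (γ : ∀ i, GL (Fin (D.n i)) ℂ) (v : V) :
    D.equivDual (D.glEquiv γ v) = matAct (R := DualRing C) (fun i => (γ i).1) (D.equivDual v) :=
  D.equivDual.apply_symm_apply
    (matAct (R := DualRing C) (fun i => (γ i).1) (D.equivDual v))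

/-- Invertible matrices act by comodule automorphisms. -/
noncomputable def IrreducibleDecomposition.glToAut :
    (∀ i, GL (Fin (D.n i)) ℂ) →* ComoduleAut C V where
  toFun γ := ⟨(D.glEquiv γ).restrictScalars ℂ, isColinear_of_dualRing (D.glEquiv γ).toLinearMap⟩
  map_one' := by
    ext x
    apply D.equivDual.injective
    exact (D.equivDual_glEquiv 1 x).trans (matAct_one (D.equivDual x))
  map_mul' γ γ' := by
    ext x
    apply D.equivDual.injective
    refine (D.equivDual_glEquiv (γ * γ') x).trans ?_
    refine (matAct_mul (fun i => (γ i).1) (fun i => (γ' i).1) _).trans ?_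
    rw [← D.equivDual_glEquiv, ← D.equivDual_glEquiv]
    rfl

lemma IrreducibleDecomposition.equivDual_glToAut (γ : ∀ i, GL (Fin (D.n i)) ℂ) (v : V) :
    D.equivDual ((D.glToAut γ).1 v) =
      matAct (R := DualRing C) (fun i => (γ i).1) (D.equivDual v) :=
  D.equivDual_glEquiv γ v

lemma IrreducibleDecomposition.equiv_glToAut (γ : ∀ i, GL (Fin (D.n i)) ℂ) (v : V) (i : Fin D.m)
    (j : Fin (D.n i)) :
    D.equiv ((D.glToAut γ).1 v) i j = ∑ k, (γ i).1 j k • D.equiv v i k := by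
  have h := congrFun (congrFun (D.equivDual_glToAut γ v) i) j
  rwa [matAct_apply] at h

/-- By Schur's lemma `τ` and `τ⁻¹` both act by matrices; these are mutually inverse because the
matrix action is faithful. -/
lemma IrreducibleDecomposition.glToAut_bijective [FiniteDimensional ℂ V] :
    Function.Bijective D.glToAut := by
  have hnt : ∀ i, Nontrivial (D.W i) := fun i => (D.irreducible i).1
  have hs : ∀ i, IsSimpleModule (DualRing C) (D.W i) := fun i =>
    isSimpleModule_iff_isIrreducible.2 (D.irreducible i)
  have : FiniteDimensional ℂ (∀ i, Fin (D.n i) → D.W i) := Module.Finite.equiv D.equiv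
  have hW : ∀ i j, i ≠ j → IsEmpty (D.W i ≃ₗ[DualRing C] D.W j) := fun i j hij =>
    ⟨fun e => D.not_iso i j hij ⟨e.restrictScalars ℂ, isColinear_of_dualRing e.toLinearMap⟩⟩
  constructor
  · intro γ γ' h
    have h1 : (fun i => (γ i).1) = fun i => (γ' i).1 := by
      refine matAct_injective (R := DualRing C) (W := D.W) fun x => ?_
      obtain ⟨v, rfl⟩ := D.equivDual.surjective x
      rw [← D.equivDual_glToAut, ← D.equivDual_glToAut, h]
    funext i
    exact Units.ext (congrFun h1 i)
  · intro τ
    have key : ∀ σ : ComoduleAut C V, ∃ M : ∀ i, Matrix (Fin (D.n i)) (Fin (D.n i)) ℂ,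
        ∀ v, D.equivDual (σ.1 v) = matAct (R := DualRing C) (W := D.W) M (D.equivDual v) := by
      intro σ
      obtain ⟨M, hM⟩ := exists_matAct_eq (R := DualRing C) (W := D.W) hW
        (D.equivDual.toLinearMap ∘ₗ (IsColinear.toLinearMap σ.2) ∘ₗ D.equivDual.symm.toLinearMap)
      refine ⟨M, fun v => ?_⟩
      rw [← hM]
      simp only [LinearMap.comp_apply, LinearEquiv.coe_coe, LinearEquiv.symm_apply_apply]
      rfl
    obtain ⟨M, hM⟩ := key τ
    obtain ⟨N, hN⟩ := key τ⁻¹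
    have h1 : (fun i => M i * N i) = fun i => 1 := by
      refine matAct_injective (R := DualRing C) (W := D.W) fun x => ?_
      obtain ⟨v, rfl⟩ := D.equivDual.surjective x
      rw [matAct_mul, matAct_one, ← hN, ← hM]
      exact congrArg _ (τ.1.apply_symm_apply v)
    have h2 : (fun i => N i * M i) = fun i => 1 := by
      refine matAct_injective (R := DualRing C) (W := D.W) fun x => ?_
      obtain ⟨v, rfl⟩ := D.equivDual.surjective x
      rw [matAct_mul, matAct_one, ← hM, ← hN]
      exact congrArg _ (τ.1.symm_apply_apply v)
    refine ⟨fun i => ⟨M i, N i, congrFun h1 i, congrFun h2 i⟩, ?_⟩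
    ext v
    apply D.equivDual.injective
    rw [D.equivDual_glToAut, hM]

end Decomposition

end QHS

namespace QHS

/-! ### Antipode identities -/

section Antipode

variable {A : Type*} [Ring A] [HopfAlgebra ℂ A]

/-- `y ⊗ z ↦ Δ(y) (1 ⊗ S(z))` -/
noncomputable def comulMulAntipode : A ⊗[ℂ] A →ₗ[ℂ] A ⊗[ℂ] A :=
  (LinearMap.mul' ℂ A ∘ₗ (HopfAlgebra.antipode ℂ).lTensor A).lTensor A ∘ₗ
    (TensorProduct.assoc ℂ A A A).toLinearMap ∘ₗ (Coalgebra.comul (R := ℂ) (A := A)).rTensor A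

lemma comulMulAntipode_tmul (y z : A) : comulMulAntipode (y ⊗ₜ[ℂ] z) =
    Coalgebra.comul (R := ℂ) y * (1 ⊗ₜ[ℂ] HopfAlgebra.antipode ℂ z) := by
  simp only [comulMulAntipode, LinearMap.comp_apply, LinearMap.rTensor_tmul]
  generalize Coalgebra.comul (R := ℂ) y = t
  induction t with
  | zero => simp
  | add a b ha hb => simp only [TensorProduct.add_tmul, map_add, add_mul, ha, hb]
  | tmul a b => simp

lemma comulMulAntipode_comul (y : A) :
    comulMulAntipode (Coalgebra.comul (R := ℂ) y) = y ⊗ₜ[ℂ] 1 := by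
  simp only [comulMulAntipode, LinearMap.comp_apply, LinearEquiv.coe_coe, Coalgebra.coassoc_apply]
  rw [← LinearMap.lTensor_comp_apply, LinearMap.comp_assoc, HopfAlgebra.mul_antipode_lTensor_comul,
    LinearMap.lTensor_comp_apply, Coalgebra.lTensor_counit_comul]
  simp

/-- `x ⊗ y ↦ Δ(S(x)) (y ⊗ 1)` -/
noncomputable def comulAntipodeMul : A ⊗[ℂ] A →ₗ[ℂ] A ⊗[ℂ] A :=
  LinearMap.mul' ℂ (A ⊗[ℂ] A) ∘ₗ TensorProduct.map
    (Coalgebra.comul (R := ℂ) ∘ₗ HopfAlgebra.antipode ℂ) ((TensorProduct.mk ℂ A A).flip 1)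

@[simp] lemma comulAntipodeMul_tmul (x y : A) : comulAntipodeMul (x ⊗ₜ[ℂ] y) =
    Coalgebra.comul (R := ℂ) (HopfAlgebra.antipode ℂ x) * (y ⊗ₜ[ℂ] 1) := by
  simp [comulAntipodeMul]

/-- `Δ(S(z₍₁₎)) (z₍₂₎ ⊗ 1) = 1 ⊗ S(z)` -/
lemma comulAntipodeMul_comul (z : A) :
    comulAntipodeMul (Coalgebra.comul (R := ℂ) z) = 1 ⊗ₜ[ℂ] HopfAlgebra.antipode ℂ z := by
  -- `Q` is `x ⊗ y ⊗ z ↦ Δ(S(x)) Δ(y) (1 ⊗ S(z))`, evaluated on `z₍₁₎ ⊗ z₍₂₎ ⊗ z₍₃₎` in two ways.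
  -- Contracting the last two legs leaves `Δ(S(z₍₁₎))(z₍₂₎ ⊗ 1)`; contracting the first two leaves
  -- `1 ⊗ S(z)`.
  let Q : A ⊗[ℂ] (A ⊗[ℂ] A) →ₗ[ℂ] A ⊗[ℂ] A := LinearMap.mul' ℂ (A ⊗[ℂ] A) ∘ₗ TensorProduct.map
    (Coalgebra.comul (R := ℂ) ∘ₗ HopfAlgebra.antipode ℂ) comulMulAntipode
  have h1 : ∀ t : A ⊗[ℂ] A, Q ((Coalgebra.comul (R := ℂ)).lTensor A t) = comulAntipodeMul t := by
    intro t
    induction t with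
    | zero => simp
    | add a b ha hb => simp only [map_add, ha, hb]
    | tmul a b => simp [Q, comulMulAntipode_comul]
  have h2 : ∀ t : A ⊗[ℂ] A, ∀ b, Q (TensorProduct.assoc ℂ A A A (t ⊗ₜ b)) =
      Coalgebra.comul (R := ℂ) (LinearMap.mul' ℂ A ((HopfAlgebra.antipode ℂ).rTensor A t)) *
        (1 ⊗ₜ[ℂ] HopfAlgebra.antipode ℂ b) := by
    intro t b
    induction t with
    | zero => simp
    | add x y ha hb => simp only [map_add, TensorProduct.add_tmul, ha, hb, add_mul]
    | tmul x y => simp [Q, comulMulAntipode_tmul, mul_assoc]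
  have h3 : ∀ t : A ⊗[ℂ] A, Q (TensorProduct.assoc ℂ A A A
      ((Coalgebra.comul (R := ℂ)).rTensor A t)) =
      1 ⊗ₜ[ℂ] HopfAlgebra.antipode ℂ (TensorProduct.lid ℂ A
        ((Coalgebra.counit (R := ℂ) (A := A)).rTensor A t)) := by
    intro t
    induction t with
    | zero => simp
    | add a b ha hb => simp only [map_add, TensorProduct.tmul_add, ha, hb]
    | tmul a b =>
      rw [LinearMap.rTensor_tmul, h2, HopfAlgebra.mul_antipode_rTensor_comul_apply]
      simp [Algebra.algebraMap_eq_smul_one]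
  rw [← h1, ← Coalgebra.coassoc_apply, h3, Coalgebra.rTensor_counit_comul]
  simp

/-- Bialgebra maps between Hopf algebras preserve the antipode. -/
lemma map_antipode {H : Type*} [Ring H] [HopfAlgebra ℂ H] (f : A →ₐc[ℂ] H) (x : A) :
    f (HopfAlgebra.antipode ℂ x) = HopfAlgebra.antipode ℂ (f x) := by
  let F : A →ₗ[ℂ] H := (f : A →ₗ[ℂ] H)
  -- `F ∘ S` is a left and `S ∘ F` a right inverse of `F` for convolution, so they coincide.
  have h1 : WithConv.toConv (F ∘ₗ HopfAlgebra.antipode ℂ) * WithConv.toConv F = 1 := by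
    apply WithConv.ext
    rw [LinearMap.convMul_def, LinearMap.convOne_def]
    ext c
    have e1 : ∀ t : A ⊗[ℂ] A, LinearMap.mul' ℂ H
        (TensorProduct.map (F ∘ₗ HopfAlgebra.antipode ℂ) F t) =
        F (LinearMap.mul' ℂ A ((HopfAlgebra.antipode ℂ).rTensor A t)) := by
      intro t
      induction t with
      | zero => simp
      | add x y hx hy => simp only [map_add, hx, hy]
      | tmul x y => exact (_root_.map_mul f _ _).symm
    refine (e1 _).trans ?_
    rw [HopfAlgebra.mul_antipode_rTensor_comul_apply]
    exact AlgHomClass.commutes f _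
  have h2 : WithConv.toConv F * WithConv.toConv (HopfAlgebra.antipode ℂ ∘ₗ F) = 1 := by
    apply WithConv.ext
    rw [LinearMap.convMul_def, LinearMap.convOne_def]
    ext c
    have e1 : ∀ t : A ⊗[ℂ] A, LinearMap.mul' ℂ H
        (TensorProduct.map F (HopfAlgebra.antipode ℂ ∘ₗ F) t) =
        LinearMap.mul' ℂ H ((HopfAlgebra.antipode ℂ).lTensor H (TensorProduct.map F F t)) := by
      intro t
      induction t with
      | zero => simp
      | add x y hx hy => simp only [map_add, hx, hy]
      | tmul x y => simp
    refine (e1 _).trans ?_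
    have e2 : TensorProduct.map F F (Coalgebra.comul (R := ℂ) c) = Coalgebra.comul (R := ℂ) (F c) :=
      CoalgHomClass.map_comp_comul_apply f c
    rw [e2, HopfAlgebra.mul_antipode_lTensor_comul_apply]
    exact congrArg (algebraMap ℂ H) (CoalgHomClass.counit_comp_apply f c)
  have h3 := left_inv_eq_right_inv h1 h2
  exact LinearMap.congr_fun (WithConv.toConv_injective h3) x

end Antipode

/-! ### The conditional expectation and the averaging map -/

/-- A normalized invariant functional. -/
structure HaarFunctional (H : Type*) [Ring H] [HopfAlgebra ℂ H] where
  toFun : H →ₗ[ℂ] ℂ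
  map_one : toFun 1 = 1
  invariant : ∀ x, TensorProduct.rid ℂ H (toFun.lTensor H (Coalgebra.comul (R := ℂ) x)) =
    algebraMap ℂ H (toFun x)

/-- Left modules over a left comodule algebra with a compatible left coaction. -/
class LeftHopfModule (A B M : Type*) [Ring A] [HopfAlgebra ℂ A] [Ring B] [Algebra ℂ B]
    [LeftComodule A B] [AddCommGroup M] [Module ℂ M] [Module B M] [IsScalarTower ℂ B M]
    [LeftComodule A M] : Prop where
  coact_smul : ∀ (b : B) (m : M), coaction A (b • m) =
    TensorProduct.map₂ (LinearMap.mul ℂ A) (lact B M) (coaction A b) (coaction A m)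

instance (A B M : Type*) [Ring A] [HopfAlgebra ℂ A] [Ring B] [Algebra ℂ B]
    [LeftComodule A B] [AddCommGroup M] [Module ℂ M] [Module B M] [Module Bᵐᵒᵖ M]
    [IsScalarTower ℂ B M] [IsScalarTower ℂ Bᵐᵒᵖ M] [SMulCommClass B Bᵐᵒᵖ M] [LeftComodule A M]
    [RelHopfModule A B M] : LeftHopfModule A B M :=
  ⟨RelHopfModule.coact_smul⟩

section Averaging

variable {A H : Type*} [Ring A] [HopfAlgebra ℂ A] [StarRing A]
  [Ring H] [HopfAlgebra ℂ H] [StarRing H] (π : HopfStarHom A H)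

/-- The underlying linear map of `π`. -/
noncomputable abbrev HopfStarHom.lin : A →ₗ[ℂ] H := (π.toBialgHom : A →ₗ[ℂ] H)

lemma rightCoaction_coassoc (a : A) :
    TensorProduct.assoc ℂ A H H ((rightCoaction π).toLinearMap.rTensor H (rightCoaction π a)) =
      (Coalgebra.comul (R := ℂ) (A := H)).lTensor A (rightCoaction π a) := by
  have h1 : ∀ t : A ⊗[ℂ] A, TensorProduct.assoc ℂ A H H
      ((rightCoaction π).toLinearMap.rTensor H (π.lin.lTensor A t)) =
      (TensorProduct.map π.lin π.lin).lTensor A (TensorProduct.assoc ℂ A A A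
        ((Coalgebra.comul (R := ℂ) (A := A)).rTensor A t)) := by
    intro t
    induction t with
    | zero => simp
    | add x y hx hy => simp only [map_add, hx, hy]
    | tmul x y =>
      simp only [LinearMap.lTensor_tmul, LinearMap.rTensor_tmul, AlgHom.toLinearMap_apply,
        rightCoaction_eq]
      generalize Coalgebra.comul (R := ℂ) x = z
      induction z with
      | zero => simp
      | add x y hx hy => simp only [map_add, TensorProduct.add_tmul, hx, hy]
      | tmul x y => simp
  have h2 : TensorProduct.map π.lin π.lin ∘ₗ Coalgebra.comul (R := ℂ) (A := A) =
      Coalgebra.comul (R := ℂ) (A := H) ∘ₗ π.lin := CoalgHomClass.map_comp_comul π.toBialgHom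
  rw [rightCoaction_eq, h1, Coalgebra.coassoc_apply, ← LinearMap.lTensor_comp_apply, h2,
    LinearMap.lTensor_comp_apply]

variable (h : HaarFunctional H)

/-- `a ↦ a₍₁₎ h(π(a₍₂₎))`, with values in `A`. -/
noncomputable def condExpAux : A →ₗ[ℂ] A :=
  TensorProduct.rid ℂ A ∘ₗ h.toFun.lTensor A ∘ₗ (rightCoaction π).toLinearMap

lemma condExpAux_apply (a : A) :
    condExpAux π h a = TensorProduct.rid ℂ A (h.toFun.lTensor A (rightCoaction π a)) := rfl

/-- The right coaction sends `E(a)` to `a₍₁₎ ⊗ π(a₍₂₎) h(π(a₍₃₎))`, and invariance of `h` turns this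
into `E(a) ⊗ 1`. -/
lemma condExpAux_mem (a : A) : condExpAux π h a ∈ coinv π := by
  rw [mem_coinv]
  have h1 : ∀ t : A ⊗[ℂ] H, rightCoaction π (TensorProduct.rid ℂ A (h.toFun.lTensor A t)) =
      (TensorProduct.rid ℂ H ∘ₗ h.toFun.lTensor H).lTensor A
        (TensorProduct.assoc ℂ A H H ((rightCoaction π).toLinearMap.rTensor H t)) := by
    intro t
    induction t with
    | zero => simp
    | add x y hx hy => simp only [map_add, hx, hy]
    | tmul x y =>
      simp only [LinearMap.lTensor_tmul, LinearMap.rTensor_tmul, AlgHom.toLinearMap_apply,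
        TensorProduct.rid_tmul, map_smul]
      generalize rightCoaction π x = z
      induction z with
      | zero => simp
      | add x y hx hy => simp only [map_add, TensorProduct.add_tmul, smul_add, hx, hy]
      | tmul x y => simp
  have h2 : (TensorProduct.rid ℂ H ∘ₗ h.toFun.lTensor H) ∘ₗ Coalgebra.comul (R := ℂ) (A := H) =
      Algebra.linearMap ℂ H ∘ₗ h.toFun := LinearMap.ext h.invariant
  rw [condExpAux_apply, h1, rightCoaction_coassoc, ← LinearMap.lTensor_comp_apply, h2]
  generalize rightCoaction π a = z
  induction z with
  | zero => simp
  | add x y hx hy => simp only [map_add, TensorProduct.add_tmul, hx, hy]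
  | tmul x y => simp [Algebra.algebraMap_eq_smul_one, TensorProduct.smul_tmul]

/-- The conditional expectation `a ↦ a₍₁₎ h(π(a₍₂₎))` onto the coinvariants. -/
noncomputable def condExp : A →ₗ[ℂ] coinv π :=
  (condExpAux π h).codRestrict (Subalgebra.toSubmodule (coinv π)) (condExpAux_mem π h)

lemma coe_condExp (a : A) : (condExp π h a : A) = condExpAux π h a := rfl

/-- The right coaction is multiplicative and sends `b` to `b ⊗ 1`. This linearity is what lets the
averaging map descend to `Φ`. -/
lemma condExp_mul_coinv (a : A) (b : coinv π) : condExp π h (a * b) = condExp π h a * b := by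
  apply Subtype.ext
  rw [MulMemClass.coe_mul, coe_condExp, coe_condExp, condExpAux_apply, condExpAux_apply,
    _root_.map_mul, (mem_coinv π).1 b.2]
  generalize rightCoaction π a = z
  induction z with
  | zero => simp
  | add x y hx hy => simp only [map_add, add_mul, hx, hy]
  | tmul x y => simp

lemma condExp_one : condExp π h 1 = 1 := by
  apply Subtype.ext
  rw [coe_condExp, condExpAux_apply, _root_.map_one, Algebra.TensorProduct.one_def]
  simp [h.map_one]

/-- On `Φ` the algebra `B` acts through `ε`, so this computes the action of `E(a)` there as the Haar
integral of `π(a)`. -/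
lemma counit_condExp (a : A) :
    Coalgebra.counit (R := ℂ) (condExp π h a : A) = h.toFun (π.lin a) := by
  have h1 : ∀ t : A ⊗[ℂ] A, Coalgebra.counit (R := ℂ)
      (TensorProduct.rid ℂ A (h.toFun.lTensor A (π.lin.lTensor A t))) =
      h.toFun (π.lin (TensorProduct.lid ℂ A ((Coalgebra.counit (R := ℂ) (A := A)).rTensor A t))) := by
    intro t
    induction t with
    | zero => simp
    | add x y hx hy => simp only [map_add, hx, hy]
    | tmul x y => simp [mul_comm]
  rw [coe_condExp, condExpAux_apply, rightCoaction_eq, h1, Coalgebra.rTensor_counit_comul]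
  simp

/-- Averaging touches only the rightmost leg of the iterated coproduct, so it commutes with the left
coaction. -/
lemma coaction_condExp (a : A) : coaction A (condExp π h a) =
    (condExp π h).lTensor A (Coalgebra.comul (R := ℂ) a) := by
  apply lTensor_injective (f := (coinv π).val.toLinearMap) Subtype.val_injective A
  rw [lTensor_val_coaction, ← LinearMap.lTensor_comp_apply]
  have h2 : (coinv π).val.toLinearMap ∘ₗ condExp π h =
      (TensorProduct.rid ℂ A ∘ₗ h.toFun.lTensor A ∘ₗ π.lin.lTensor A) ∘ₗ
        Coalgebra.comul (R := ℂ) (A := A) := rfl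
  have h1 : ∀ t : A ⊗[ℂ] A, Coalgebra.comul (R := ℂ)
      (TensorProduct.rid ℂ A (h.toFun.lTensor A (π.lin.lTensor A t))) =
      (TensorProduct.rid ℂ A ∘ₗ h.toFun.lTensor A ∘ₗ π.lin.lTensor A).lTensor A
        (TensorProduct.assoc ℂ A A A ((Coalgebra.comul (R := ℂ) (A := A)).rTensor A t)) := by
    intro t
    induction t with
    | zero => simp
    | add x y hx hy => simp only [map_add, hx, hy]
    | tmul x y =>
      simp only [LinearMap.lTensor_tmul, LinearMap.rTensor_tmul, TensorProduct.rid_tmul, map_smul]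
      generalize Coalgebra.comul (R := ℂ) x = z
      induction z with
      | zero => simp
      | add x y hx hy => simp only [map_add, TensorProduct.add_tmul, smul_add, hx, hy]
      | tmul x y => simp
  rw [h2, LinearMap.lTensor_comp_apply, ← Coalgebra.coassoc_apply, ← h1]
  rfl

/-! ### The averaging map on modules with compatible coaction -/

section Module

variable (N : Type*) [AddCommGroup N] [Module ℂ N] [Module (coinv π) N]
  [IsScalarTower ℂ (coinv π) N]

/-- `a ⊗ n ↦ E(a) n` -/
noncomputable def condExpAct : A ⊗[ℂ] N →ₗ[ℂ] N :=
  TensorProduct.lift (lact (coinv π) N ∘ₗ condExp π h)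

@[simp] lemma condExpAct_tmul (a : A) (n : N) :
    condExpAct π h N (a ⊗ₜ n) = condExp π h a • n := rfl

/-- `a ⊗ x ⊗ n ↦ E(a S(x)) n` -/
noncomputable def averageAux : A ⊗[ℂ] (A ⊗[ℂ] N) →ₗ[ℂ] N :=
  condExpAct π h N ∘ₗ (LinearMap.mul' ℂ A ∘ₗ (HopfAlgebra.antipode ℂ).lTensor A).rTensor N ∘ₗ
    (TensorProduct.assoc ℂ A A N).symm.toLinearMap

@[simp] lemma averageAux_tmul (a x : A) (n : N) :
    averageAux π h N (a ⊗ₜ (x ⊗ₜ n)) = condExp π h (a * HopfAlgebra.antipode ℂ x) • n := by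
  simp [averageAux]

variable [LeftComodule A N]

/-- The averaging map `a ⊗ n ↦ E(a S(n₍₋₁₎)) n₍₀₎`. -/
noncomputable def average : A ⊗[ℂ] N →ₗ[ℂ] N :=
  averageAux π h N ∘ₗ (coaction A).lTensor A

lemma average_tmul (a : A) (n : N) :
    average π h N (a ⊗ₜ n) = averageAux π h N (a ⊗ₜ coaction A n) := rfl

/-- `E(n₍₋₂₎ S(n₍₋₁₎)) n₍₀₎ = E(1) n = n`. -/
lemma average_coaction (n : N) : average π h N (coaction A n) = n := by
  have h1 : ∀ t : A ⊗[ℂ] N, averageAux π h N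
      (TensorProduct.assoc ℂ A A N ((Coalgebra.comul (R := ℂ) (A := A)).rTensor N t)) =
      TensorProduct.lid ℂ N ((Coalgebra.counit (R := ℂ) (A := A)).rTensor N t) := by
    intro t
    induction t with
    | zero => simp
    | add x y hx hy => simp only [map_add, hx, hy]
    | tmul x y =>
      have h2 : ∀ s : A ⊗[ℂ] A, averageAux π h N (TensorProduct.assoc ℂ A A N (s ⊗ₜ y)) =
          condExp π h (LinearMap.mul' ℂ A ((HopfAlgebra.antipode ℂ).lTensor A s)) • y := by
        intro s
        induction s with
        | zero => simp
        | add x y hx hy => simp only [map_add, TensorProduct.add_tmul, add_smul, hx, hy]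
        | tmul x y => simp
      rw [LinearMap.rTensor_tmul, h2, HopfAlgebra.mul_antipode_lTensor_comul_apply,
        Algebra.algebraMap_eq_smul_one, map_smul, condExp_one]
      simp
  change averageAux π h N ((coaction A).lTensor A (coaction A n)) = n
  rw [coaction, ← LeftComodule.coassoc, h1, LeftComodule.counit]
  simp

variable [LeftHopfModule A (coinv π) N]

/-- The averaging map is colinear for the coaction on the first factor. -/
lemma coaction_average (y : A ⊗[ℂ] N) : coaction A (average π h N y) =
    (average π h N).lTensor A (TensorProduct.assoc ℂ A A N
      ((Coalgebra.comul (R := ℂ) (A := A)).rTensor N y)) := by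
  induction y with
  | zero => simp
  | add x y hx hy => simp only [map_add, hx, hy]
  | tmul a n =>
  -- `J` is `p ⊗ q ⊗ n ↦ p ⊗ E(q) n`, and `Y` is `x ⊗ y ⊗ n ↦ J(Δ(a) Δ(S(x)) (y ⊗ 1) ⊗ n)`. The
  -- coaction of the average is `Y` of the twice coacted `n`, and `Δ(S(z₍₁₎))(z₍₂₎ ⊗ 1) = 1 ⊗ S(z)`
  -- removes the contribution of `n` from the first leg.
  let J : (A ⊗[ℂ] A) ⊗[ℂ] N →ₗ[ℂ] A ⊗[ℂ] N :=
    (condExpAct π h N).lTensor A ∘ₗ (TensorProduct.assoc ℂ A A N).toLinearMap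
  let Y : A ⊗[ℂ] (A ⊗[ℂ] N) →ₗ[ℂ] A ⊗[ℂ] N :=
    J ∘ₗ (LinearMap.mulLeft ℂ (Coalgebra.comul (R := ℂ) a) ∘ₗ comulAntipodeMul).rTensor N ∘ₗ
      (TensorProduct.assoc ℂ A A N).symm.toLinearMap
  have e1 : ∀ (c : A ⊗[ℂ] A) (t : A ⊗[ℂ] N),
      TensorProduct.map₂ (LinearMap.mul ℂ A) (lact (coinv π) N) ((condExp π h).lTensor A c) t =
      J ((LinearMap.mul' ℂ (A ⊗[ℂ] A) ∘ₗ
        (TensorProduct.mk ℂ (A ⊗[ℂ] A) (A ⊗[ℂ] A) c) ∘ₗ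
        (TensorProduct.mk ℂ A A).flip 1).rTensor N t) := by
    intro c t
    induction t with
    | zero => simp
    | add x y hx hy => simp only [map_add, hx, hy]
    | tmul y n =>
      simp only [LinearMap.rTensor_tmul, LinearMap.comp_apply, LinearMap.flip_apply,
        TensorProduct.mk_apply, LinearMap.mul'_apply]
      induction c with
      | zero => simp
      | add x y hx hy =>
        simp only [map_add, LinearMap.add_apply, hx, hy, add_mul, TensorProduct.add_tmul]
      | tmul p q => simp [J, TensorProduct.map₂_apply_tmul]
  have e2 : ∀ (x : A) (n : N), coaction A (averageAux π h N (a ⊗ₜ (x ⊗ₜ n))) =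
      Y (x ⊗ₜ coaction A n) := by
    intro x n
    rw [averageAux_tmul, LeftHopfModule.coact_smul, coaction_condExp, e1, Bialgebra.comul_mul]
    generalize coaction A n = t
    induction t with
    | zero => simp
    | add x y hx hy => simp only [map_add, TensorProduct.tmul_add, hx, hy]
    | tmul y n => simp [Y, mul_assoc]
  have e3 : ∀ t : A ⊗[ℂ] N, coaction A (averageAux π h N (a ⊗ₜ t)) =
      Y ((coaction A).lTensor A t) := by
    intro t
    induction t with
    | zero => simp
    | add x y hx hy => simp only [map_add, TensorProduct.tmul_add, hx, hy]
    | tmul y n => rw [e2, LinearMap.lTensor_tmul]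
  have e4 : ∀ t : A ⊗[ℂ] N, Y (TensorProduct.assoc ℂ A A N
      ((Coalgebra.comul (R := ℂ) (A := A)).rTensor N t)) =
      (averageAux π h N).lTensor A (TensorProduct.assoc ℂ A A (A ⊗[ℂ] N)
        (Coalgebra.comul (R := ℂ) a ⊗ₜ t)) := by
    intro t
    induction t with
    | zero => simp
    | add x y hx hy => simp only [map_add, TensorProduct.tmul_add, hx, hy]
    | tmul z n =>
      simp only [Y, LinearMap.comp_apply, LinearMap.rTensor_tmul, LinearEquiv.coe_coe,
        LinearEquiv.symm_apply_apply, comulAntipodeMul_comul, LinearMap.mulLeft_apply]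
      generalize Coalgebra.comul (R := ℂ) a = s
      induction s with
      | zero => simp
      | add x y hx hy => simp only [map_add, TensorProduct.add_tmul, add_mul, hx, hy]
      | tmul p q => simp [J]
  rw [average_tmul, e3, coaction, ← LeftComodule.coassoc, e4, LinearMap.rTensor_tmul]
  change _ = _
  generalize Coalgebra.comul (R := ℂ) a = s
  induction s with
  | zero => simp
  | add x y hx hy => simp only [map_add, TensorProduct.add_tmul, hx, hy]
  | tmul p q => rfl

variable {Q : Type*} [AddCommGroup Q] [Module ℂ Q] [LeftComodule H Q]

/-- Averaging an element of `A ⊗ N` whose image in `A ⊗ Q` lies in the cotensor product. -/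
lemma lTensor_coaction_average (q : N →ₗ[ℂ] Q)
    (hq : ∀ (b : coinv π) n, q (b • n) = Coalgebra.counit (R := ℂ) (b : A) • q n)
    (hcol : ∀ n, coaction H (q n) = TensorProduct.map π.lin q (coaction A n))
    (y : A ⊗[ℂ] N)
    (hy : TensorProduct.assoc ℂ A H Q ((rightCoaction π).toLinearMap.rTensor Q (q.lTensor A y)) =
      (coaction H).lTensor A (q.lTensor A y)) :
    q.lTensor A (coaction A (average π h N y)) = q.lTensor A y := by
  -- `K` is `x ⊗ y ⊗ v ↦ h(x S(y)) v`. Averaging followed by `q` is `K` after `π` and the coaction.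
  -- The cotensor condition `hy` replaces `π(a₍₂₎)` by a coaction leg of `v`, and `K` of a twice
  -- coacted vector is the vector, as `h(1) = 1`.
  let K : H ⊗[ℂ] (H ⊗[ℂ] Q) →ₗ[ℂ] Q :=
    TensorProduct.lid ℂ Q ∘ₗ (h.toFun ∘ₗ LinearMap.mul' ℂ H ∘ₗ
      (HopfAlgebra.antipode ℂ).lTensor H).rTensor Q ∘ₗ (TensorProduct.assoc ℂ H H Q).symm.toLinearMap
  have hK : ∀ v, K ((coaction H).lTensor H (coaction H v)) = v := by
    intro v
    have h1 : ∀ t : H ⊗[ℂ] Q, K (TensorProduct.assoc ℂ H H Q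
        ((Coalgebra.comul (R := ℂ) (A := H)).rTensor Q t)) =
        TensorProduct.lid ℂ Q ((Coalgebra.counit (R := ℂ) (A := H)).rTensor Q t) := by
      intro t
      induction t with
      | zero => simp
      | add x y hx hy => simp only [map_add, hx, hy]
      | tmul x y =>
        simp only [K, LinearMap.comp_apply, LinearMap.rTensor_tmul, LinearEquiv.coe_coe,
          LinearEquiv.symm_apply_apply, HopfAlgebra.mul_antipode_lTensor_comul_apply]
        simp [Algebra.algebraMap_eq_smul_one, h.map_one]
    rw [coaction, ← LeftComodule.coassoc, h1, LeftComodule.counit]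
    simp
  have e1 : ∀ a n, q (average π h N (a ⊗ₜ n)) = K (π.lin a ⊗ₜ coaction H (q n)) := by
    intro a n
    rw [average_tmul, hcol]
    generalize coaction A n = t
    induction t with
    | zero => simp
    | add x y hx hy => simp only [map_add, TensorProduct.tmul_add, hx, hy]
    | tmul x n =>
      have hS : π.lin (HopfAlgebra.antipode ℂ x) = HopfAlgebra.antipode ℂ (π.lin x) :=
        map_antipode π.toBialgHom x
      have hm : π.lin (a * HopfAlgebra.antipode ℂ x) =
          π.lin a * π.lin (HopfAlgebra.antipode ℂ x) := _root_.map_mul π.toBialgHom _ _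
      rw [averageAux_tmul, hq, counit_condExp, hm, hS]
      simp [K]
  have e2 : ∀ y : A ⊗[ℂ] N, q.lTensor A ((average π h N).lTensor A (TensorProduct.assoc ℂ A A N
      ((Coalgebra.comul (R := ℂ) (A := A)).rTensor N y))) =
      (K ∘ₗ (coaction H).lTensor H).lTensor A
        (TensorProduct.assoc ℂ A H Q ((rightCoaction π).toLinearMap.rTensor Q (q.lTensor A y))) := by
    intro y
    induction y with
    | zero => simp
    | add x y hx hy => simp only [map_add, hx, hy]
    | tmul a n =>
      simp only [LinearMap.rTensor_tmul, LinearMap.lTensor_tmul, AlgHom.toLinearMap_apply,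
        rightCoaction_eq]
      generalize Coalgebra.comul (R := ℂ) a = s
      induction s with
      | zero => simp
      | add x y hx hy => simp only [map_add, TensorProduct.add_tmul, hx, hy]
      | tmul p r => simp [e1]
  rw [coaction_average, e2, hy, ← LinearMap.lTensor_comp_apply]
  have hid : (K ∘ₗ (coaction H).lTensor H) ∘ₗ coaction H = (LinearMap.id : Q →ₗ[ℂ] Q) :=
    LinearMap.ext hK
  rw [hid, LinearMap.lTensor_id_apply]

end Module

end Averaging

end QHS

namespace QHS

/-! ### Takeuchi's unit map -/

section Takeuchi

open MulOpposite

variable {A H : Type*} [Ring A] [HopfAlgebra ℂ A] [StarRing A]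
  [Ring H] [HopfAlgebra ℂ H] [StarRing H] (π : HopfStarHom A H)

/-- In `b₍₁₎ n₍₋₁₎ ⊗ q(b₍₂₎ n₍₀₎)` the factor `b₍₂₎` becomes `ε(b₍₂₎)`, which leaves left
multiplication by `b` on the `A`-leg. -/
lemma lTensor_coaction_smul {N Q : Type*} [AddCommGroup N] [Module ℂ N] [Module (coinv π) N]
    [IsScalarTower ℂ (coinv π) N] [LeftComodule A N] [LeftHopfModule A (coinv π) N]
    [AddCommGroup Q] [Module ℂ Q] (q : N →ₗ[ℂ] Q)
    (hq : ∀ (b : coinv π) n, q (b • n) = Coalgebra.counit (R := ℂ) (b : A) • q n)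
    (b : coinv π) (n : N) :
    q.lTensor A (coaction A (b • n)) =
      (LinearMap.mulLeft ℂ (b : A)).rTensor Q (q.lTensor A (coaction A n)) := by
  have h : ∀ (x : A ⊗[ℂ] coinv π) (y : A ⊗[ℂ] N),
      q.lTensor A (TensorProduct.map₂ (LinearMap.mul ℂ A) (lact (coinv π) N) x y) =
      (LinearMap.mulLeft ℂ (TensorProduct.rid ℂ A ((Coalgebra.counit (R := ℂ) (A := A)).lTensor A
        ((coinv π).val.toLinearMap.lTensor A x)))).rTensor Q (q.lTensor A y) := by
    intro x y
    induction y with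
    | zero => simp
    | add y y' hy hy' => simp only [map_add, hy, hy']
    | tmul c m =>
      induction x with
      | zero => simp
      | add x x' hx hx' =>
        simp only [map_add, LinearMap.add_apply, hx, hx']
        simp [add_mul, TensorProduct.add_tmul]
      | tmul a b =>
        simp [TensorProduct.map₂_apply_tmul, hq, TensorProduct.smul_tmul']
  rw [LeftHopfModule.coact_smul, h, lTensor_val_coaction, Coalgebra.lTensor_counit_comul]
  simp

lemma lTensor_coaction_op_smul {N Q : Type*} [AddCommGroup N] [Module ℂ N] [Module (coinv π) N]
    [Module (coinv π)ᵐᵒᵖ N] [IsScalarTower ℂ (coinv π) N] [IsScalarTower ℂ (coinv π)ᵐᵒᵖ N]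
    [SMulCommClass (coinv π) (coinv π)ᵐᵒᵖ N] [LeftComodule A N] [RelHopfModule A (coinv π) N]
    [AddCommGroup Q] [Module ℂ Q] (q : N →ₗ[ℂ] Q)
    (hq : ∀ (b : coinv π) n, q (op b • n) = Coalgebra.counit (R := ℂ) (b : A) • q n)
    (b : coinv π) (n : N) :
    q.lTensor A (coaction A (op b • n)) =
      (LinearMap.mulRight ℂ (b : A)).rTensor Q (q.lTensor A (coaction A n)) := by
  have h : ∀ (x : A ⊗[ℂ] coinv π) (y : A ⊗[ℂ] N),
      q.lTensor A (TensorProduct.map₂ (LinearMap.mul ℂ A) (ract (coinv π) N) y x) =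
      (LinearMap.mulRight ℂ (TensorProduct.rid ℂ A ((Coalgebra.counit (R := ℂ) (A := A)).lTensor A
        ((coinv π).val.toLinearMap.lTensor A x)))).rTensor Q (q.lTensor A y) := by
    intro x y
    induction y with
    | zero => simp
    | add y y' hy hy' => simp only [map_add, LinearMap.add_apply, hy, hy']
    | tmul c m =>
      induction x with
      | zero => simp
      | add x x' hx hx' =>
        simp only [map_add, hx, hx']
        simp [mul_add, TensorProduct.add_tmul]
      | tmul a b =>
        simp [TensorProduct.map₂_apply_tmul, hq, TensorProduct.smul_tmul']
  rw [RelHopfModule.coact_op_smul, h, lTensor_val_coaction, Coalgebra.lTensor_counit_comul]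
  simp

variable (h : HaarFunctional H) (M : Type*) [AddCommGroup M] [Module ℂ M] [Module (coinv π) M]
  [IsScalarTower ℂ (coinv π) M] [LeftComodule A M]

/-- Takeuchi's unit map `m ↦ m₍₋₁₎ ⊗ [m₍₀₎]`. -/
noncomputable def takeuchi : M →ₗ[ℂ] A ⊗[ℂ] Phi π M :=
  (Phi.mk π M).lTensor A ∘ₗ coaction A

lemma takeuchi_apply (m : M) :
    takeuchi π M m = (Phi.mk π M).lTensor A (coaction A m) := rfl

/-- Coassociativity: the unit map intertwines the coaction of `M` with `Δ` on the `A`-leg. -/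
lemma lTensor_takeuchi_coaction (m : M) : (takeuchi π M).lTensor A (coaction A m) =
    TensorProduct.assoc ℂ A A (Phi π M)
      ((Coalgebra.comul (R := ℂ) (A := A)).rTensor (Phi π M) (takeuchi π M m)) := by
  have h1 : ∀ t : A ⊗[ℂ] M, ((Phi.mk π M).lTensor A).lTensor A (TensorProduct.assoc ℂ A A M
      ((Coalgebra.comul (R := ℂ) (A := A)).rTensor M t)) = TensorProduct.assoc ℂ A A (Phi π M)
      ((Coalgebra.comul (R := ℂ) (A := A)).rTensor (Phi π M) ((Phi.mk π M).lTensor A t)) := by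
    intro t
    induction t with
    | zero => simp
    | add x y hx hy => simp only [map_add, hx, hy]
    | tmul x y =>
      simp only [LinearMap.rTensor_tmul, LinearMap.lTensor_tmul]
      generalize Coalgebra.comul (R := ℂ) x = s
      induction s with
      | zero => simp
      | add x y hx hy => simp only [map_add, TensorProduct.add_tmul, hx, hy]
      | tmul p r => simp
  rw [takeuchi, LinearMap.lTensor_comp_apply, LinearMap.comp_apply, ← h1]
  exact congrArg _ (LeftComodule.coassoc m).symm

lemma counit_takeuchi (m : M) : TensorProduct.lid ℂ (Phi π M)
    ((Coalgebra.counit (R := ℂ) (A := A)).rTensor (Phi π M) (takeuchi π M m)) = Phi.mk π M m := by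
  rw [takeuchi_apply, ← LinearMap.comp_apply (LinearMap.rTensor _ _),
    LinearMap.rTensor_comp_lTensor, ← LinearMap.lTensor_comp_rTensor, LinearMap.comp_apply, coaction,
    LeftComodule.counit]
  simp

variable [LeftHopfModule A (coinv π) M]

lemma takeuchi_smul (b : coinv π) (m : M) : takeuchi π M (b • m) =
    (LinearMap.mulLeft ℂ (b : A)).rTensor (Phi π M) (takeuchi π M m) :=
  lTensor_coaction_smul π (Phi.mk π M) (fun b n => Phi.mk_smul π b n) b m

-- `E(a S(b₍₁₎ m₍₋₁₎)) b₍₂₎ m₍₀₎ = E(a S(m₍₋₁₎) S(b₍₁₎) b₍₂₎) m₍₀₎`, by right `B`-linearity of `E`.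
-- Hence the averaging map kills `A ⊗ B⁺M`.
variable {M} in
lemma average_tmul_smul (a : A) (b : coinv π) (m : M) : average π h M (a ⊗ₜ (b • m)) =
    Coalgebra.counit (R := ℂ) (b : A) • average π h M (a ⊗ₜ m) := by
  have h2 : ∀ (x : A ⊗[ℂ] coinv π) (y : A) (m : M),
      averageAux π h M (a ⊗ₜ
        TensorProduct.map₂ (LinearMap.mul ℂ A) (lact (coinv π) M) x (y ⊗ₜ m)) =
      condExp π h (a * HopfAlgebra.antipode ℂ y *
        LinearMap.mul' ℂ A ((HopfAlgebra.antipode ℂ).rTensor A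
          ((coinv π).val.toLinearMap.lTensor A x))) • m := by
    intro x y m
    induction x with
    | zero => simp
    | add x x' hx hx' =>
      simp only [map_add, LinearMap.add_apply, TensorProduct.tmul_add, hx, hx', mul_add, add_smul]
    | tmul x b =>
      rw [TensorProduct.map₂_apply_tmul, TensorProduct.map_tmul, averageAux_tmul]
      simp only [LinearMap.mul_apply', lact_apply, LinearMap.lTensor_tmul, LinearMap.rTensor_tmul,
        LinearMap.mul'_apply, HopfAlgebra.antipode_mul_antidistrib, AlgHom.toLinearMap_apply,
        Subalgebra.coe_val]
      rw [smul_smul, ← condExp_mul_coinv]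
      simp only [mul_assoc]
  rw [average_tmul, average_tmul, LeftHopfModule.coact_smul]
  generalize coaction A m = t
  induction t with
  | zero => simp
  | add x y hx hy => simp only [map_add, TensorProduct.tmul_add, smul_add, hx, hy]
  | tmul y m =>
    rw [h2, lTensor_val_coaction, HopfAlgebra.mul_antipode_rTensor_comul_apply, averageAux_tmul]
    simp [Algebra.algebraMap_eq_smul_one]

/-- The inverse `a ⊗ [m] ↦ E(a S(m₍₋₁₎)) m₍₀₎` of Takeuchi's unit map. -/
noncomputable def takeuchiInv : A ⊗[ℂ] Phi π M →ₗ[ℂ] M :=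
  TensorProduct.lift ((plusLeft π M).liftQ (TensorProduct.curry (average π h M)).flip (by
    refine Submodule.span_le.2 ?_
    rintro _ ⟨b, m, hb, rfl⟩
    refine LinearMap.ext fun a => ?_
    simp [average_tmul_smul, hb])).flip

lemma takeuchiInv_lTensor_mk (y : A ⊗[ℂ] M) :
    takeuchiInv π h M ((Phi.mk π M).lTensor A y) = average π h M y := by
  induction y with
  | zero => simp
  | add x y hx hy => simp only [map_add, hx, hy]
  | tmul a m => rfl

lemma takeuchiInv_takeuchi (m : M) : takeuchiInv π h M (takeuchi π M m) = m := by
  rw [takeuchi_apply, takeuchiInv_lTensor_mk, average_coaction]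

lemma takeuchi_injective (h : HaarFunctional H) : Function.Injective (takeuchi π M) :=
  Function.LeftInverse.injective (takeuchiInv_takeuchi π h M)

end Takeuchi

/-! ### Lifting automorphisms from `Φ(M)` to `M` -/

section Automorphisms

open MulOpposite

variable {A H : Type*} [Ring A] [HopfAlgebra ℂ A] [StarRing A]
  [Ring H] [HopfAlgebra ℂ H] [StarRing H] (π : HopfStarHom A H) (h : HaarFunctional H)
  {M : Type*} [AddCommGroup M] [Module ℂ M] [Module (coinv π) M] [Module (coinv π)ᵐᵒᵖ M]
  [IsScalarTower ℂ (coinv π) M] [IsScalarTower ℂ (coinv π)ᵐᵒᵖ M]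
  [SMulCommClass (coinv π) (coinv π)ᵐᵒᵖ M] [LeftComodule A M] [RelHopfModule A (coinv π) M]

/-- The inverse is defined on all of `A ⊗ Φ(M)`, but it is a right inverse only on the cotensor
product cut out by `hY`; there a lift of `Y` to `A ⊗ M` can be averaged. -/
lemma takeuchi_takeuchiInv (Y : A ⊗[ℂ] Phi π M)
    (hY : TensorProduct.assoc ℂ A H (Phi π M)
      ((rightCoaction π).toLinearMap.rTensor (Phi π M) Y) = (coaction H).lTensor A Y) :
    takeuchi π M (takeuchiInv π h M Y) = Y := by
  obtain ⟨y, rfl⟩ := LinearMap.lTensor_surjective A (Phi.mk_surjective π M) Y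
  rw [takeuchiInv_lTensor_mk, takeuchi_apply]
  exact lTensor_coaction_average π h M (Phi.mk π M) (fun b n => Phi.mk_smul π b n)
    (fun n => Phi.coaction_mk π M n) y hY

/-- Both sides are `m₍₋₂₎ ⊗ π(m₍₋₁₎) ⊗ [m₍₀₎]`. -/
lemma takeuchi_cotensor (m : M) : TensorProduct.assoc ℂ A H (Phi π M)
    ((rightCoaction π).toLinearMap.rTensor (Phi π M) (takeuchi π M m)) =
    (coaction H).lTensor A (takeuchi π M m) := by
  have h1 : ∀ t : A ⊗[ℂ] Phi π M, TensorProduct.assoc ℂ A H (Phi π M)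
      ((rightCoaction π).toLinearMap.rTensor (Phi π M) t) =
      (π.lin.rTensor (Phi π M)).lTensor A (TensorProduct.assoc ℂ A A (Phi π M)
        ((Coalgebra.comul (R := ℂ) (A := A)).rTensor (Phi π M) t)) := by
    intro t
    induction t with
    | zero => simp
    | add x y hx hy => simp only [map_add, hx, hy]
    | tmul x y =>
      simp only [LinearMap.rTensor_tmul, AlgHom.toLinearMap_apply, rightCoaction_eq]
      generalize Coalgebra.comul (R := ℂ) x = s
      induction s with
      | zero => simp
      | add x y hx hy => simp only [map_add, TensorProduct.add_tmul, hx, hy]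
      | tmul p r => simp
  have h2 : π.lin.rTensor (Phi π M) ∘ₗ takeuchi π M = coaction H ∘ₗ Phi.mk π M := by
    ext m
    rw [LinearMap.comp_apply, LinearMap.comp_apply, Phi.coaction_mk, takeuchi_apply,
      ← LinearMap.comp_apply, LinearMap.rTensor_comp_lTensor]
  rw [h1, ← lTensor_takeuchi_coaction, ← LinearMap.lTensor_comp_apply, h2,
    LinearMap.lTensor_comp_apply, ← takeuchi_apply]

/-- `m (b - ε(b))` lies in `MB⁺ = B⁺M`. Without this equality the right action would not pass to
`Φ(M)`. -/
lemma Phi.mk_op_smul (hplus : plusRight π M = plusLeft π M) (b : coinv π) (m : M) :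
    Phi.mk π M (op b • m) = Coalgebra.counit (R := ℂ) (b : A) • Phi.mk π M m := by
  rw [← map_smul]
  refine (Submodule.Quotient.eq (plusLeft π M)).2 ?_
  rw [← hplus]
  refine Submodule.subset_span ⟨b - algebraMap ℂ _ (Coalgebra.counit (R := ℂ) (b : A)), m, ?_, ?_⟩
  · simp
  · rw [op_sub, sub_smul]
    congr 1
    exact (algebraMap_smul (coinv π)ᵐᵒᵖ _ m).symm

lemma takeuchi_op_smul (hplus : plusRight π M = plusLeft π M) (b : coinv π) (m : M) :
    takeuchi π M (op b • m) =
      (LinearMap.mulRight ℂ (b : A)).rTensor (Phi π M) (takeuchi π M m) :=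
  lTensor_coaction_op_smul π (Phi.mk π M) (fun b n => Phi.mk_op_smul π hplus b n) b m

/-- The endomorphism of `M` with `Φ(f) = τ`. -/
noncomputable def liftEnd (τ : Phi π M →ₗ[ℂ] Phi π M) : M →ₗ[ℂ] M :=
  takeuchiInv π h M ∘ₗ τ.lTensor A ∘ₗ takeuchi π M

/-- Colinearity of `τ` keeps `id ⊗ τ` inside the cotensor product. Every property of the lift is
then checked after the injective unit map. -/
lemma takeuchi_liftEnd {τ : Phi π M →ₗ[ℂ] Phi π M} (hτ : IsColinear H τ) (m : M) :
    takeuchi π M (liftEnd π h τ m) = τ.lTensor A (takeuchi π M m) := by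
  refine takeuchi_takeuchiInv π h _ ?_
  have h1 : ∀ t : A ⊗[ℂ] Phi π M, TensorProduct.assoc ℂ A H (Phi π M)
      ((rightCoaction π).toLinearMap.rTensor (Phi π M) (τ.lTensor A t)) =
      (τ.lTensor H).lTensor A (TensorProduct.assoc ℂ A H (Phi π M)
      ((rightCoaction π).toLinearMap.rTensor (Phi π M) t)) := by
    intro t
    induction t with
    | zero => simp
    | add x y hx hy => simp only [map_add, hx, hy]
    | tmul x y =>
      simp only [LinearMap.rTensor_tmul, LinearMap.lTensor_tmul, AlgHom.toLinearMap_apply]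
      generalize rightCoaction π x = s
      induction s with
      | zero => simp
      | add x y hx hy => simp only [map_add, TensorProduct.add_tmul, hx, hy]
      | tmul p r => simp
  have h2 : coaction H ∘ₗ τ = τ.lTensor H ∘ₗ coaction H := LinearMap.ext hτ
  rw [LinearMap.comp_apply, h1, takeuchi_cotensor, ← LinearMap.lTensor_comp_apply, ← LinearMap.lTensor_comp_apply, h2]

lemma liftEnd_smul {τ : Phi π M →ₗ[ℂ] Phi π M} (hτ : IsColinear H τ) (b : coinv π) (m : M) :
    liftEnd π h τ (b • m) = b • liftEnd π h τ m := by
  apply takeuchi_injective π M h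
  rw [takeuchi_liftEnd π h hτ, takeuchi_smul, takeuchi_smul, takeuchi_liftEnd π h hτ,
    ← LinearMap.comp_apply, LinearMap.lTensor_comp_rTensor, ← LinearMap.rTensor_comp_lTensor,
    LinearMap.comp_apply]

lemma liftEnd_op_smul (hplus : plusRight π M = plusLeft π M)
    {τ : Phi π M →ₗ[ℂ] Phi π M} (hτ : IsColinear H τ) (b : coinv π) (m : M) :
    liftEnd π h τ (op b • m) = op b • liftEnd π h τ m := by
  apply takeuchi_injective π M h
  rw [takeuchi_liftEnd π h hτ, takeuchi_op_smul π hplus, takeuchi_op_smul π hplus,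
    takeuchi_liftEnd π h hτ, ← LinearMap.comp_apply, LinearMap.lTensor_comp_rTensor,
    ← LinearMap.rTensor_comp_lTensor, LinearMap.comp_apply]

lemma liftEnd_colinear {τ : Phi π M →ₗ[ℂ] Phi π M} (hτ : IsColinear H τ) :
    IsColinear A (liftEnd π h τ) := by
  intro m
  apply lTensor_injective (takeuchi_injective π M h) A
  have h1 : ∀ t : A ⊗[ℂ] Phi π M, TensorProduct.assoc ℂ A A (Phi π M)
      ((Coalgebra.comul (R := ℂ) (A := A)).rTensor (Phi π M) (τ.lTensor A t)) =
      (τ.lTensor A).lTensor A (TensorProduct.assoc ℂ A A (Phi π M)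
      ((Coalgebra.comul (R := ℂ) (A := A)).rTensor (Phi π M) t)) := by
    intro t
    induction t with
    | zero => simp
    | add x y hx hy => simp only [map_add, hx, hy]
    | tmul x y =>
      simp only [LinearMap.rTensor_tmul, LinearMap.lTensor_tmul]
      generalize Coalgebra.comul (R := ℂ) x = s
      induction s with
      | zero => simp
      | add x y hx hy => simp only [map_add, TensorProduct.add_tmul, hx, hy]
      | tmul p r => simp
  have h2 : takeuchi π M ∘ₗ liftEnd π h τ = τ.lTensor A ∘ₗ takeuchi π M :=
    LinearMap.ext (takeuchi_liftEnd π h hτ)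
  rw [lTensor_takeuchi_coaction, takeuchi_liftEnd π h hτ, h1, ← lTensor_takeuchi_coaction,
    ← LinearMap.lTensor_comp_apply, ← LinearMap.lTensor_comp_apply, h2]

lemma liftEnd_comp {σ τ : Phi π M →ₗ[ℂ] Phi π M} (hσ : IsColinear H σ) (hτ : IsColinear H τ)
    (hστ : σ ∘ₗ τ = LinearMap.id) (m : M) : liftEnd π h σ (liftEnd π h τ m) = m := by
  apply takeuchi_injective π M h
  rw [takeuchi_liftEnd π h hσ, takeuchi_liftEnd π h hτ, ← LinearMap.lTensor_comp_apply, hστ,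
    LinearMap.lTensor_id_apply]

lemma mk_liftEnd {τ : Phi π M →ₗ[ℂ] Phi π M} (hτ : IsColinear H τ) (m : M) :
    Phi.mk π M (liftEnd π h τ m) = τ (Phi.mk π M m) := by
  rw [← counit_takeuchi π M, takeuchi_liftEnd π h hτ, ← counit_takeuchi π M,
    ← LinearMap.comp_apply (LinearMap.rTensor _ _),
    LinearMap.rTensor_comp_lTensor, ← LinearMap.lTensor_comp_rTensor, LinearMap.comp_apply]
  generalize (Coalgebra.counit (R := ℂ) (A := A)).rTensor (Phi π M) (takeuchi π M m) = t
  induction t with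
  | zero => simp
  | add x y hx hy => simp only [map_add, hx, hy]
  | tmul x y => simp

/-- The unit map conjugates `f` into `id ⊗ Φ(f)`, so `Φ(f)` determines `f`. Conversely the lifts of
`τ` and `τ⁻¹` are mutually inverse. -/
theorem Phi.aut_bijective (h : HaarFunctional H) (hplus : plusRight π M = plusLeft π M) :
    Function.Bijective (Phi.aut π M) := by
  constructor
  · intro f g hfg
    ext m
    apply takeuchi_injective π M h
    have h1 : ∀ f : RelHopfAut A (coinv π) M, takeuchi π M (f.1 m) =
        ((Phi.aut π M f).1 : Phi π M →ₗ[ℂ] Phi π M).lTensor A (takeuchi π M m) := by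
      intro f
      have hf := f.2.2.2 m
      rw [LinearEquiv.coe_coe] at hf
      rw [takeuchi_apply, takeuchi_apply, hf]
      generalize coaction A m = y
      induction y with
      | zero => simp
      | add y y' hy hy' => simp only [map_add, hy, hy']
      | tmul c m => rfl
    rw [h1, h1, hfg]
  · intro τ
    have hτ := τ.2
    have hτ' := (τ⁻¹).2
    let f : M ≃ₗ[ℂ] M := LinearEquiv.ofLinearMap (liftEnd π h τ.1.toLinearMap)
      (liftEnd π h (τ⁻¹).1.toLinearMap)
      (LinearMap.ext fun m => liftEnd_comp π h hτ hτ'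
        (LinearMap.ext fun x => τ.1.apply_symm_apply x) m)
      (LinearMap.ext fun m => liftEnd_comp π h hτ' hτ
        (LinearMap.ext fun x => τ.1.symm_apply_apply x) m)
    refine ⟨⟨f, liftEnd_smul π h hτ, liftEnd_op_smul π h hplus hτ, liftEnd_colinear π h hτ⟩, ?_⟩
    ext x
    obtain ⟨m, rfl⟩ := Phi.mk_surjective π M x
    exact mk_liftEnd π h hτ m

end Automorphisms

end QHS

namespace QHS

/-! ### The automorphism group acts simply transitively on covariant metrics -/

noncomputable section MetricAction

open MulOpposite

variable {A B : Type*} [Ring A] [HopfAlgebra ℂ A] [Ring B] [Algebra ℂ B] [LeftComodule A B]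
variable {M : Type*} [AddCommGroup M] [Module ℂ M] [Module B M] [Module Bᵐᵒᵖ M]
  [IsScalarTower ℂ B M] [IsScalarTower ℂ Bᵐᵒᵖ M] [SMulCommClass B Bᵐᵒᵖ M] [LeftComodule A M]

@[simp] lemma BTensor.map_mk {M N M' N' : Type*} [AddCommGroup M] [Module ℂ M] [Module Bᵐᵒᵖ M]
    [AddCommGroup N] [Module ℂ N] [Module B N] [AddCommGroup M'] [Module ℂ M'] [Module Bᵐᵒᵖ M']
    [AddCommGroup N'] [Module ℂ N'] [Module B N'] (f : M →ₗ[ℂ] M') (g : N →ₗ[ℂ] N')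
    (hf : ∀ m (b : B), f (op b • m) = op b • f m) (hg : ∀ (b : B) n, g (b • n) = b • g n)
    (m : M) (n : N) :
    BTensor.map B f g hf hg (BTensor.mk B M N m n) = BTensor.mk B M' N' (f m) (g n) := rfl

lemma BTensor.lsmul_one (t : BTensor B M M) : BTensor.lsmul B 1 t = t := by
  have : BTensor.lsmul B 1 = (LinearMap.id : BTensor B M M →ₗ[ℂ] BTensor B M M) :=
    BTensor.ext B fun m n => by
      change BTensor.mk B M M ((1 : B) • m) n = BTensor.mk B M M m n
      rw [one_smul]
  rw [this, LinearMap.id_apply]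

variable [RelHopfModule A B M]

@[simp] lemma tensorCoact_mk (m n : M) : tensorCoact A B M (BTensor.mk B M M m n) =
    TensorProduct.map₂ (LinearMap.mul ℂ A) (BTensor.mk B M M) (coaction A m) (coaction A n) := rfl

lemma tensorCoact_map (f g : M →ₗ[ℂ] M)
    (hf : ∀ m (b : B), f (op b • m) = op b • f m) (hg : ∀ (b : B) n, g (b • n) = b • g n)
    (hf' : IsColinear A f) (hg' : IsColinear A g) (t : BTensor B M M) :
    tensorCoact A B M (BTensor.map B f g hf hg t) =
      (BTensor.map B f g hf hg).lTensor A (tensorCoact A B M t) := by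
  rw [← LinearMap.comp_apply, ← LinearMap.comp_apply]
  congr 1
  refine BTensor.ext B fun m n => ?_
  simp only [LinearMap.comp_apply, BTensor.map_mk, tensorCoact_mk, hf' m, hg' n]
  generalize coaction A m = x
  generalize coaction A n = y
  induction x with
  | zero => simp
  | add x x' hx hx' => simp only [map_add, LinearMap.add_apply, hx, hx']
  | tmul a m =>
    induction y with
    | zero => simp
    | add y y' hy hy' => simp only [map_add, hy, hy']
    | tmul c n => simp [TensorProduct.map₂_apply_tmul]

namespace CovariantMetric

variable (p q : CovariantMetric A B M)

/-- `(x, m ⊗ n) ↦ (x, m) n` -/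
def leftContract : M →ₗ[ℂ] BTensor B M M →ₗ[ℂ] M where
  toFun x := BTensor.lift B ((lact B M) ∘ₗ p.pairing ∘ₗ (BTensor.mk B M M x))
    (fun m b n => by simp [p.pairing_op_smul, mul_smul])
  map_add' x y := BTensor.ext B fun m n => by
    change p.pairing (BTensor.mk B M M (x + y) m) • n = p.pairing (BTensor.mk B M M x m) • n +
      p.pairing (BTensor.mk B M M y m) • n
    simp [add_smul]
  map_smul' z x := BTensor.ext B fun m n => by
    change p.pairing (BTensor.mk B M M (z • x) m) • n = z • p.pairing (BTensor.mk B M M x m) • n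
    simp

/-- `(x, m ⊗ n) ↦ m (n, x)` -/
def rightContract : M →ₗ[ℂ] BTensor B M M →ₗ[ℂ] M where
  toFun x := BTensor.lift B ((ract B M).compl₂ (p.pairing ∘ₗ (BTensor.mk B M M).flip x))
    (fun m b n => by simp [p.pairing_smul, mul_smul])
  map_add' x y := BTensor.ext B fun m n => by
    change op (p.pairing (BTensor.mk B M M n (x + y))) • m =
      op (p.pairing (BTensor.mk B M M n x)) • m + op (p.pairing (BTensor.mk B M M n y)) • m
    simp [add_smul]
  map_smul' z x := BTensor.ext B fun m n => by
    change op (p.pairing (BTensor.mk B M M n (z • x))) • m =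
      z • op (p.pairing (BTensor.mk B M M n x)) • m
    simp

@[simp] lemma leftContract_mk (x m n : M) : p.leftContract x (BTensor.mk B M M m n) =
    p.pairing (BTensor.mk B M M x m) • n := rfl

@[simp] lemma rightContract_mk (x m n : M) : p.rightContract x (BTensor.mk B M M m n) =
    op (p.pairing (BTensor.mk B M M n x)) • m := rfl

lemma leftContract_g (x : M) : p.leftContract x p.g = x := p.left_inv x

lemma rightContract_g (x : M) : p.rightContract x p.g = x := p.right_inv x

lemma leftContract_smul (b : B) (x : M) (t : BTensor B M M) :
    p.leftContract (b • x) t = b • p.leftContract x t := by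
  change _ = (lact B M b ∘ₗ p.leftContract x) t
  congr 1
  exact BTensor.ext B fun m n => by simp [p.pairing_smul, mul_smul]

lemma rightContract_op_smul (b : B) (x : M) (t : BTensor B M M) :
    p.rightContract (op b • x) t = op b • p.rightContract x t := by
  change _ = ((ract B M).flip b ∘ₗ p.rightContract x) t
  congr 1
  exact BTensor.ext B fun m n => by simp [p.pairing_op_smul, mul_smul]

-- Nondegeneracy: `x = (x, g⁽¹⁾) g⁽²⁾` depends on `x` only through the functional `(x, ·)`.
variable {p} in
lemma eq_of_pairing_eq {x y : M}
    (h : ∀ ω, p.pairing (BTensor.mk B M M x ω) = p.pairing (BTensor.mk B M M y ω)) : x = y := by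
  have h1 : p.leftContract x = p.leftContract y := BTensor.ext B fun m n => by simp [h]
  rw [← p.leftContract_g x, h1, p.leftContract_g]

/-- `((x, m)_p n, ω)_q = (x, m)_p (n, ω)_q = (x, m (n, ω)_q)_p`. -/
lemma pairing_leftContract (x ω : M) (t : BTensor B M M) :
    q.pairing (BTensor.mk B M M (p.leftContract x t) ω) =
      p.pairing (BTensor.mk B M M x (q.rightContract ω t)) := by
  change (q.pairing ∘ₗ (BTensor.mk B M M).flip ω ∘ₗ p.leftContract x) t =
    (p.pairing ∘ₗ BTensor.mk B M M x ∘ₗ q.rightContract ω) t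
  congr 1
  exact BTensor.ext B fun m n => by simp [q.pairing_smul, p.pairing_op_smul]

/-- A covariant metric is determined by its pairing. -/
lemma ext_pairing {p q : CovariantMetric A B M} (h : p.pairing = q.pairing) : p = q := by
  let K : BTensor B M M →ₗ[ℂ] BTensor B M M →ₗ[ℂ] BTensor B M M :=
    { toFun := fun s => BTensor.map B (p.rightContract.flip s) LinearMap.id
        (fun n b => p.rightContract_op_smul b n s) (fun _ _ => rfl)
      map_add' := fun s s' => BTensor.ext B fun m n => by
        change BTensor.mk B M M (p.rightContract m (s + s')) n =
          BTensor.mk B M M (p.rightContract m s) n + BTensor.mk B M M (p.rightContract m s') n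
        simp
      map_smul' := fun z s => BTensor.ext B fun m n => by
        change BTensor.mk B M M (p.rightContract m (z • s)) n =
          z • BTensor.mk B M M (p.rightContract m s) n
        simp }
  -- On `m ⊗ n` and `m' ⊗ n'` this is `m ⊗ (n, m') n' = m (n, m') ⊗ n'`. With the two candidate
  -- tensors for `s` and `t`, one side returns `s` and the other `t`: the uniqueness of an inverse.
  have key : ∀ s t : BTensor B M M,
      BTensor.map B LinearMap.id (p.leftContract.flip t) (fun _ _ => rfl)
        (fun b n => p.leftContract_smul b n t) s =
      BTensor.map B (p.rightContract.flip s) LinearMap.id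
        (fun n b => p.rightContract_op_smul b n s) (fun _ _ => rfl) t := by
    intro s t
    change _ = K.flip t s
    congr 1
    refine BTensor.ext B fun m n => ?_
    change (BTensor.mk B M M m ∘ₗ p.leftContract n) t = K (BTensor.mk B M M m n) t
    congr 1
    exact BTensor.ext B fun m' n' => (BTensor.balanced B m _ n').symm
  have hr : q.rightContract = p.rightContract :=
    LinearMap.ext fun x => BTensor.ext B fun m n => by simp [h]
  have hg : p.g = q.g := by
    have h1 := key q.g p.g
    have e1 : p.leftContract.flip p.g = LinearMap.id := LinearMap.ext p.leftContract_g
    have e2 : p.rightContract.flip q.g = LinearMap.id := by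
      rw [← hr]; exact LinearMap.ext q.rightContract_g
    simp only [e1, e2] at h1
    have e3 : BTensor.map B LinearMap.id LinearMap.id (fun _ _ => rfl) (fun _ _ => rfl) =
        (LinearMap.id : BTensor B M M →ₗ[ℂ] BTensor B M M) := BTensor.ext B fun m n => rfl
    rw [e3] at h1
    exact h1.symm
  obtain ⟨g, s, _, _, _, _, _, _⟩ := p
  obtain ⟨g', s', _, _, _, _, _, _⟩ := q
  simp only at h hg
  subst h hg
  rfl

/-- The action of automorphisms on covariant metrics. -/
def act (f : RelHopfAut A B M) (x : CovariantMetric A B M) : CovariantMetric A B M where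
  g := BTensor.map B LinearMap.id f.1.toLinearMap (fun _ _ => rfl) f.2.1 x.g
  pairing := x.pairing ∘ₗ BTensor.map B (f⁻¹).1.toLinearMap LinearMap.id
    (fun m b => (f⁻¹).2.2.1 b m) (fun _ _ => rfl)
  pairing_smul b m n := by
    have h := (f⁻¹).2.1 b m
    simp only [LinearMap.comp_apply, BTensor.map_mk, LinearEquiv.coe_coe, h, x.pairing_smul]
  pairing_op_smul b m n := by
    simp [x.pairing_op_smul]
  left_inv ω := by
    have h : ∀ t, BTensor.lift B ((lact B M) ∘ₗ (x.pairing ∘ₗ BTensor.map B (f⁻¹).1.toLinearMap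
        LinearMap.id (fun m b => (f⁻¹).2.2.1 b m) (fun _ _ => rfl)) ∘ₗ (BTensor.mk B M M ω))
        (fun m b n => by simp [x.pairing_op_smul, mul_smul])
        (BTensor.map B LinearMap.id f.1.toLinearMap (fun _ _ => rfl) f.2.1 t) =
        f.1 (x.leftContract ((f⁻¹).1 ω) t) := by
      intro t
      rw [← LinearMap.comp_apply]
      change _ = (f.1.toLinearMap ∘ₗ x.leftContract ((f⁻¹).1 ω)) t
      congr 1
      exact BTensor.ext B fun m n => (f.2.1 _ _).symm
    rw [h, x.leftContract_g]
    exact f.1.apply_symm_apply ω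
  right_inv ω := by
    have h : ∀ t, BTensor.lift B ((ract B M).compl₂ ((x.pairing ∘ₗ BTensor.map B
        (f⁻¹).1.toLinearMap LinearMap.id (fun m b => (f⁻¹).2.2.1 b m) (fun _ _ => rfl)) ∘ₗ
        (BTensor.mk B M M).flip ω))
        (fun m b n => by
          have h := (f⁻¹).2.1 b n
          simp only [LinearMap.compl₂_apply, LinearMap.comp_apply, LinearMap.flip_apply,
            BTensor.map_mk, LinearEquiv.coe_coe, h, x.pairing_smul, ract_apply, op_mul, mul_smul])
        (BTensor.map B LinearMap.id f.1.toLinearMap (fun _ _ => rfl) f.2.1 t) =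
        x.rightContract ω t := by
      intro t
      rw [← LinearMap.comp_apply]
      congr 1
      refine BTensor.ext B fun m n => ?_
      have h : (f⁻¹).1 (f.1 n) = n := f.1.symm_apply_apply n
      change op (x.pairing (BTensor.mk B M M ((f⁻¹).1 (f.1 n)) ω)) • m =
        op (x.pairing (BTensor.mk B M M n ω)) • m
      rw [h]
    rw [h, x.rightContract_g]
  pairing_colinear t := by
    rw [LinearMap.comp_apply, x.pairing_colinear, tensorCoact_map _ _ _ _ (f⁻¹).2.2.2 (fun _ => by simp),
      LinearMap.lTensor_comp_apply]
  coev_colinear b := by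
    have h : BTensor.orbit B (BTensor.map B LinearMap.id f.1.toLinearMap (fun _ _ => rfl) f.2.1 x.g) =
        BTensor.map B LinearMap.id f.1.toLinearMap (fun _ _ => rfl) f.2.1 ∘ₗ BTensor.orbit B x.g := by
      ext b
      change (BTensor.lsmul B b ∘ₗ _) x.g = (_ ∘ₗ BTensor.lsmul B b) x.g
      congr 1
      exact BTensor.ext B fun m n => rfl
    rw [h, LinearMap.comp_apply, tensorCoact_map _ _ _ _ (fun _ => by simp) f.2.2.2,
      x.coev_colinear, LinearMap.lTensor_comp_apply]

lemma act_pairing (f : RelHopfAut A B M) (x : CovariantMetric A B M) (ω η : M) :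
    (act f x).pairing (BTensor.mk B M M ω η) =
      x.pairing (BTensor.mk B M M (f.1.symm ω) η) := rfl

instance : MulAction (RelHopfAut A B M) (CovariantMetric A B M) where
  smul := act
  one_smul _ := ext_pairing (BTensor.ext B fun _ _ => rfl)
  mul_smul _ _ _ := ext_pairing (BTensor.ext B fun _ _ => rfl)

/-- A stabilizing `f` satisfies `(f⁻¹ ω, η) = (ω, η)` for all `η`, so nondegeneracy forces `f = 1`.
-/
lemma eq_one_of_smul_eq {f : RelHopfAut A B M} {x : CovariantMetric A B M} (h : f • x = x) :
    f = 1 := by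
  ext m
  have h1 : f.1.symm (f.1 m) = f.1 m := by
    refine eq_of_pairing_eq (p := x) fun ω => ?_
    rw [← act_pairing f x]
    exact congrArg (fun y : CovariantMetric A B M => y.pairing (BTensor.mk B M M (f.1 m) ω)) h
  rw [LinearEquiv.symm_apply_apply] at h1
  exact h1.symm

/-- The endomorphism `x ↦ (x, g'⁽¹⁾) g'⁽²⁾` comparing two metrics. -/
def compare : M →ₗ[ℂ] M := p.leftContract.flip q.g

/-- The contraction moves to the second argument, where the inverse identity of `q` removes it. With
nondegeneracy this characterizes `compare`. -/
lemma pairing_compare (x ω : M) : q.pairing (BTensor.mk B M M (compare p q x) ω) =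
    p.pairing (BTensor.mk B M M x ω) := by
  rw [compare, LinearMap.flip_apply, pairing_leftContract, rightContract_g]

lemma compare_smul (b : B) (x : M) : compare p q (b • x) = b • compare p q x :=
  eq_of_pairing_eq (p := q) fun ω => by
    rw [pairing_compare, p.pairing_smul, q.pairing_smul, pairing_compare]

/-- A left contraction is not visibly right linear; it is so here because both pairings are
`B`-balanced. -/
lemma compare_op_smul (b : B) (x : M) : compare p q (op b • x) = op b • compare p q x :=
  eq_of_pairing_eq (p := q) fun ω => by
    rw [pairing_compare, BTensor.balanced, BTensor.balanced, pairing_compare]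

lemma compare_compare (x : M) : compare q p (compare p q x) = x :=
  eq_of_pairing_eq (p := p) fun ω => by rw [pairing_compare, pairing_compare]

lemma coaction_leftContract (x : M) (t : BTensor B M M) : coaction A (p.leftContract x t) =
    TensorProduct.map₂ (LinearMap.mul ℂ A) p.leftContract (coaction A x) (tensorCoact A B M t) := by
  change (coaction A ∘ₗ p.leftContract x) t = (TensorProduct.map₂ (LinearMap.mul ℂ A)
    p.leftContract (coaction A x) ∘ₗ tensorCoact A B M) t
  congr 1
  refine BTensor.ext B fun m n => ?_
  simp only [LinearMap.comp_apply, leftContract_mk, RelHopfModule.coact_smul, p.pairing_colinear,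
    tensorCoact_mk]
  generalize coaction A m = y
  generalize coaction A n = z
  generalize coaction A x = x
  induction x with
  | zero => simp
  | add x x' hx hx' => simp only [map_add, LinearMap.add_apply, hx, hx']
  | tmul a x =>
    induction y with
    | zero => simp
    | add y y' hy hy' => simp only [map_add, LinearMap.add_apply, hy, hy']
    | tmul c m =>
      induction z with
      | zero => simp
      | add z z' hz hz' => simp only [map_add, hz, hz']
      | tmul d n => simp [TensorProduct.map₂_apply_tmul, mul_assoc]

variable [ComoduleAlgebra A B]

/-- Colinearity of `b ↦ b g` at `b = 1`: the metric tensor is coinvariant. -/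
lemma tensorCoact_g : tensorCoact A B M p.g = 1 ⊗ₜ p.g := by
  have h := p.coev_colinear 1
  have h1 : BTensor.orbit B p.g 1 = p.g := BTensor.lsmul_one p.g
  rw [ComoduleAlgebra.coact_one, Algebra.TensorProduct.one_def, LinearMap.lTensor_tmul, h1] at h
  exact h

lemma compare_colinear : IsColinear A (compare p q) := by
  intro x
  rw [compare, LinearMap.flip_apply, coaction_leftContract, tensorCoact_g]
  generalize coaction A x = y
  induction y with
  | zero => simp
  | add y y' hy hy' => simp only [map_add, LinearMap.add_apply, hy, hy']
  | tmul a m => simp [TensorProduct.map₂_apply_tmul]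

/-- The witness is `compare p q`. The action uses its inverse `compare q p`, which turns the pairing
of `p` into that of `q`. -/
lemma exists_smul_eq : ∃ f : RelHopfAut A B M, f • p = q := by
  let f : M ≃ₗ[ℂ] M := LinearEquiv.ofLinearMap (compare p q) (compare q p)
    (LinearMap.ext fun x => compare_compare q p x) (LinearMap.ext fun x => compare_compare p q x)
  refine ⟨⟨f, compare_smul p q, compare_op_smul p q, compare_colinear p q⟩, ?_⟩
  refine ext_pairing (BTensor.ext B fun ω η => ?_)
  exact pairing_compare q p ω η

end CovariantMetric

end MetricAction

end QHS

namespace QHS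

/-! ### The diagonal coaction -/

noncomputable section Diagonal

section

variable {C V W : Type*} [Ring C] [Bialgebra ℂ C] [AddCommGroup V] [Module ℂ V]
  [AddCommGroup W] [Module ℂ W] [LeftComodule C V] [LeftComodule C W]

variable (C V W) in
/-- The diagonal coaction `v ⊗ w ↦ v₍₋₁₎ w₍₋₁₎ ⊗ (v₍₀₎ ⊗ w₍₀₎)`. -/
def diagCoact : V ⊗[ℂ] W →ₗ[ℂ] C ⊗[ℂ] (V ⊗[ℂ] W) :=
  TensorProduct.lift ((TensorProduct.map₂ (LinearMap.mul ℂ C)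
    (TensorProduct.mk ℂ V W)).compl₁₂ (coaction C) (coaction C))

lemma diagCoact_tmul (x : V) (y : W) : diagCoact C V W (x ⊗ₜ y) =
    TensorProduct.map₂ (LinearMap.mul ℂ C) (TensorProduct.mk ℂ V W) (coaction C x)
      (coaction C y) := rfl

instance : LeftComodule C (V ⊗[ℂ] W) where
  coact := diagCoact C V W
  coassoc z := by
    induction z with
    | zero => simp
    | add x y hx hy => simp only [map_add, hx, hy]
    | tmul x y =>
      have h1 : ∀ (s : C ⊗[ℂ] V) (t : C ⊗[ℂ] W), TensorProduct.assoc ℂ C C (V ⊗[ℂ] W)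
          ((Coalgebra.comul (R := ℂ)).rTensor (V ⊗[ℂ] W) (TensorProduct.map₂ (LinearMap.mul ℂ C)
            (TensorProduct.mk ℂ V W) s t)) =
          TensorProduct.map₂ (LinearMap.mul ℂ C) (TensorProduct.map₂ (LinearMap.mul ℂ C)
            (TensorProduct.mk ℂ V W))
            (TensorProduct.assoc ℂ C C V ((Coalgebra.comul (R := ℂ)).rTensor V s))
            (TensorProduct.assoc ℂ C C W ((Coalgebra.comul (R := ℂ)).rTensor W t)) := by
        intro s t
        induction s with
        | zero => simp
        | add s s' hs hs' => simp only [map_add, LinearMap.add_apply, hs, hs']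
        | tmul a x =>
          induction t with
          | zero => simp
          | add t t' ht ht' => simp only [map_add, ht, ht']
          | tmul b y =>
            simp only [TensorProduct.map₂_apply_tmul, LinearMap.rTensor_tmul,
              LinearMap.mul_apply', TensorProduct.mk_apply, TensorProduct.map_tmul, Bialgebra.comul_mul]
            generalize Coalgebra.comul (R := ℂ) a = p
            generalize Coalgebra.comul (R := ℂ) b = r
            induction p with
            | zero => simp
            | add p p' hp hp' =>
              simp only [map_add, add_mul, TensorProduct.add_tmul, LinearMap.add_apply, hp, hp']
            | tmul a a' =>
              induction r with
              | zero => simp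
              | add p p' hp hp' => simp only [map_add, mul_add, TensorProduct.add_tmul, hp, hp']
              | tmul b b' => simp [TensorProduct.map₂_apply_tmul]
      have h2 : ∀ (s : C ⊗[ℂ] V) (t : C ⊗[ℂ] W), (diagCoact C V W).lTensor C
          (TensorProduct.map₂ (LinearMap.mul ℂ C) (TensorProduct.mk ℂ V W) s t) =
          TensorProduct.map₂ (LinearMap.mul ℂ C) (TensorProduct.map₂ (LinearMap.mul ℂ C)
            (TensorProduct.mk ℂ V W)) ((coaction C).lTensor C s) ((coaction C).lTensor C t) := by
        intro s t
        induction s with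
        | zero => simp
        | add s s' hs hs' => simp only [map_add, LinearMap.add_apply, hs, hs']
        | tmul a x =>
          induction t with
          | zero => simp
          | add t t' ht ht' => simp only [map_add, ht, ht']
          | tmul b y => simp [TensorProduct.map₂_apply_tmul, diagCoact_tmul]
      rw [diagCoact_tmul, h1, h2]
      congr 1
      · exact congrArg _ (LeftComodule.coassoc x)
      · exact LeftComodule.coassoc y
  counit z := by
    induction z with
    | zero => simp
    | add x y hx hy => simp only [map_add, TensorProduct.tmul_add, hx, hy]
    | tmul x y =>
      have h1 : ∀ (s : C ⊗[ℂ] V) (t : C ⊗[ℂ] W), (Coalgebra.counit (R := ℂ)).rTensor (V ⊗[ℂ] W)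
          (TensorProduct.map₂ (LinearMap.mul ℂ C) (TensorProduct.mk ℂ V W) s t) =
          TensorProduct.map₂ (LinearMap.mul ℂ ℂ) (TensorProduct.mk ℂ V W)
            ((Coalgebra.counit (R := ℂ)).rTensor V s)
            ((Coalgebra.counit (R := ℂ)).rTensor W t) := by
        intro s t
        induction s with
        | zero => simp
        | add s s' hs hs' => simp only [map_add, LinearMap.add_apply, hs, hs']
        | tmul a x =>
          induction t with
          | zero => simp
          | add t t' ht ht' => simp only [map_add, ht, ht']
          | tmul b y => simp [TensorProduct.map₂_apply_tmul]
      rw [diagCoact_tmul, h1, coaction, coaction, LeftComodule.counit, LeftComodule.counit]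
      simp [TensorProduct.map₂_apply_tmul]

lemma coaction_tmul (x : V) (y : W) : coaction C (x ⊗ₜ[ℂ] y) =
    TensorProduct.map₂ (LinearMap.mul ℂ C) (TensorProduct.mk ℂ V W) (coaction C x)
      (coaction C y) := rfl

lemma map_map₂_mk {D V' W' : Type*} [Ring D] [Algebra ℂ D] [AddCommGroup V'] [Module ℂ V']
    [AddCommGroup W'] [Module ℂ W'] (φ : C →ₐ[ℂ] D) (f : V →ₗ[ℂ] V') (g : W →ₗ[ℂ] W')
    (s : C ⊗[ℂ] V) (t : C ⊗[ℂ] W) :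
    TensorProduct.map φ.toLinearMap (TensorProduct.map f g)
      (TensorProduct.map₂ (LinearMap.mul ℂ C) (TensorProduct.mk ℂ V W) s t) =
    TensorProduct.map₂ (LinearMap.mul ℂ D) (TensorProduct.mk ℂ V' W')
      (TensorProduct.map φ.toLinearMap f s) (TensorProduct.map φ.toLinearMap g t) := by
  induction s with
  | zero => simp
  | add s s' hs hs' => simp only [map_add, LinearMap.add_apply, hs, hs']
  | tmul a x =>
    induction t with
    | zero => simp
    | add t t' ht ht' => simp only [map_add, ht, ht']
    | tmul b y => simp [TensorProduct.map₂_apply_tmul]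

end

/-- Makes the averaging map available on `M ⊗ M` over `ℂ`, where the invariant tensor is lifted. -/
instance {A B M N : Type*} [Ring A] [HopfAlgebra ℂ A] [Ring B] [Algebra ℂ B]
    [LeftComodule A B] [AddCommGroup M] [Module ℂ M] [Module B M] [IsScalarTower ℂ B M]
    [LeftComodule A M] [LeftHopfModule A B M] [AddCommGroup N] [Module ℂ N] [LeftComodule A N] :
    LeftHopfModule A B (M ⊗[ℂ] N) where
  coact_smul b z := by
    induction z with
    | zero => simp
    | add x y hx hy => simp only [smul_add, map_add, hx, hy]
    | tmul m n =>
      rw [TensorProduct.smul_tmul', coaction_tmul, coaction_tmul, LeftHopfModule.coact_smul]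
      generalize coaction A b = r
      generalize coaction A m = s
      generalize coaction A n = t
      induction r with
      | zero => simp
      | add s s' hs hs' => simp only [map_add, LinearMap.add_apply, hs, hs']
      | tmul c b =>
        induction s with
        | zero => simp
        | add s s' hs hs' => simp only [map_add, LinearMap.add_apply, hs, hs']
        | tmul a x =>
          induction t with
          | zero => simp
          | add t t' ht ht' => simp only [map_add, ht, ht']
          | tmul d y =>
            simp [TensorProduct.map₂_apply_tmul, mul_assoc, TensorProduct.smul_tmul']

end Diagonal

/-! ### Contractions with a bilinear form -/

noncomputable section Contraction

variable {X V : Type*} [Ring X] [Algebra ℂ X] [AddCommGroup V] [Module ℂ V]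
  (β : V →ₗ[ℂ] V →ₗ[ℂ] ℂ)

variable (X) in
/-- `(x ⊗ v, y ⊗ w) ↦ β(v, w) x y` -/
def formExt : X ⊗[ℂ] V →ₗ[ℂ] X ⊗[ℂ] V →ₗ[ℂ] X :=
  (TensorProduct.map₂ (LinearMap.mul ℂ X) β).compr₂ (TensorProduct.rid ℂ X).toLinearMap

@[simp] lemma formExt_tmul (x y : X) (v w : V) :
    formExt X β (x ⊗ₜ v) (y ⊗ₜ w) = β v w • (x * y) := by
  simp [formExt, TensorProduct.map₂_apply_tmul]

lemma formExt_mulLeft (z : X) (s t : X ⊗[ℂ] V) :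
    formExt X β ((LinearMap.mulLeft ℂ z).rTensor V s) t = z * formExt X β s t := by
  induction s with
  | zero => simp
  | add s s' hs hs' => simp only [map_add, LinearMap.add_apply, mul_add, hs, hs']
  | tmul a x =>
    induction t with
    | zero => simp
    | add t t' ht ht' => simp only [map_add, mul_add, ht, ht']
    | tmul b y => simp [mul_assoc]

lemma formExt_mulRight (z : X) (s t : X ⊗[ℂ] V) :
    formExt X β s ((LinearMap.mulRight ℂ z).rTensor V t) = formExt X β s t * z := by
  induction s with
  | zero => simp
  | add s s' hs hs' => simp only [map_add, LinearMap.add_apply, add_mul, hs, hs']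
  | tmul a x =>
    induction t with
    | zero => simp
    | add t t' ht ht' => simp only [map_add, add_mul, ht, ht']
    | tmul b y => simp [mul_assoc]

lemma formExt_balanced (z : X) (s t : X ⊗[ℂ] V) :
    formExt X β ((LinearMap.mulRight ℂ z).rTensor V s) t =
      formExt X β s ((LinearMap.mulLeft ℂ z).rTensor V t) := by
  induction s with
  | zero => simp
  | add s s' hs hs' => simp only [map_add, LinearMap.add_apply, hs, hs']
  | tmul a x =>
    induction t with
    | zero => simp
    | add t t' ht ht' => simp only [map_add, ht, ht']
    | tmul b y => simp [mul_assoc]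

/-- Used with `D` the right coaction, to see that the pairing takes values in `B`, and with `D = Δ`,
to see that it is colinear. -/
lemma algHom_formExt {Y : Type*} [Ring Y] [Algebra ℂ Y] (D : X →ₐ[ℂ] X ⊗[ℂ] Y)
    (s t : X ⊗[ℂ] V) : D (formExt X β s t) =
      TensorProduct.map₂ (LinearMap.mul ℂ X) (formExt Y β)
        (TensorProduct.assoc ℂ X Y V (D.toLinearMap.rTensor V s))
        (TensorProduct.assoc ℂ X Y V (D.toLinearMap.rTensor V t)) := by
  induction s with
  | zero => simp
  | add s s' hs hs' => simp only [map_add, LinearMap.add_apply, hs, hs']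
  | tmul a x =>
    induction t with
    | zero => simp
    | add t t' ht ht' => simp only [map_add, ht, ht']
    | tmul b y =>
      simp only [formExt_tmul, map_smul, map_mul, LinearMap.rTensor_tmul, AlgHom.toLinearMap_apply]
      generalize D a = p
      generalize D b = r
      induction p with
      | zero => simp
      | add p p' hp hp' =>
        simp only [map_add, add_mul, smul_add, TensorProduct.add_tmul, LinearMap.add_apply, hp, hp']
      | tmul a a' =>
        induction r with
        | zero => simp
        | add p p' hp hp' => simp only [map_add, mul_add, smul_add, TensorProduct.add_tmul, hp, hp']
        | tmul b b' => simp [TensorProduct.map₂_apply_tmul]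

/-- `(v, w ⊗ w') ↦ β(v, w) w'` -/
def contractLeft : V →ₗ[ℂ] V ⊗[ℂ] V →ₗ[ℂ] V :=
  (LinearMap.rTensorHom V ∘ₗ β).compr₂ (TensorProduct.lid ℂ V).toLinearMap

@[simp] lemma contractLeft_tmul (v w w' : V) : contractLeft β v (w ⊗ₜ w') = β v w • w' := rfl

/-- `(w ⊗ w', v) ↦ β(w', v) w` -/
def contractRight : V ⊗[ℂ] V →ₗ[ℂ] V →ₗ[ℂ] V :=
  ((LinearMap.lTensorHom V ∘ₗ β.flip).compr₂ (TensorProduct.rid ℂ V).toLinearMap).flip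

@[simp] lemma contractRight_tmul (v w w' : V) : contractRight β (w ⊗ₜ w') v = β w' v • w := rfl

/-- Reduces the inverse identity of the metric to that of the form: contracting in `X ⊗ V` is
multiplication by a value of the extended form. -/
lemma map₂_contractLeft (r s t : X ⊗[ℂ] V) :
    TensorProduct.map₂ (LinearMap.mul ℂ X) (contractLeft β) r
      (TensorProduct.map₂ (LinearMap.mul ℂ X) (TensorProduct.mk ℂ V V) s t) =
    (LinearMap.mulLeft ℂ (formExt X β r s)).rTensor V t := by
  induction t with
  | zero => simp
  | add t t' ht ht' => simp only [map_add, ht, ht']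
  | tmul c z =>
    rw [LinearMap.rTensor_tmul, LinearMap.mulLeft_apply]
    induction r with
    | zero => simp
    | add t t' ht ht' =>
      simp only [map_add, LinearMap.add_apply, add_mul, TensorProduct.add_tmul, ht, ht']
    | tmul a x =>
      induction s with
      | zero => simp
      | add t t' ht ht' =>
        simp only [map_add, LinearMap.add_apply, add_mul, TensorProduct.add_tmul, ht, ht']
      | tmul b y => simp [TensorProduct.map₂_apply_tmul, mul_assoc, TensorProduct.smul_tmul']

lemma map₂_contractRight (r s t : X ⊗[ℂ] V) :
    TensorProduct.map₂ (LinearMap.mul ℂ X) (contractRight β)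
      (TensorProduct.map₂ (LinearMap.mul ℂ X) (TensorProduct.mk ℂ V V) s t) r =
    (LinearMap.mulRight ℂ (formExt X β t r)).rTensor V s := by
  induction s with
  | zero => simp
  | add t t' ht ht' => simp only [map_add, LinearMap.add_apply, ht, ht']
  | tmul c z =>
    rw [LinearMap.rTensor_tmul, LinearMap.mulRight_apply]
    induction r with
    | zero => simp
    | add t t' ht ht' =>
      simp only [map_add, mul_add, TensorProduct.add_tmul, ht, ht']
    | tmul a x =>
      induction t with
      | zero => simp
      | add t t' ht ht' =>
        simp only [map_add, LinearMap.add_apply, mul_add, TensorProduct.add_tmul, ht, ht']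
      | tmul b y => simp [TensorProduct.map₂_apply_tmul, mul_assoc, TensorProduct.smul_tmul']

end Contraction

/-- An invariant nondegenerate bilinear form on a comodule, with its inverse. -/
structure InvariantForm (H V : Type*) [Ring H] [Bialgebra ℂ H] [AddCommGroup V] [Module ℂ V]
    [LeftComodule H V] where
  form : V →ₗ[ℂ] V →ₗ[ℂ] ℂ
  inv : V ⊗[ℂ] V
  form_invariant : ∀ v w, formExt H form (coaction H v) (coaction H w) = algebraMap ℂ H (form v w)
  inv_invariant : coaction H inv = 1 ⊗ₜ inv
  contractLeft_inv : ∀ v, contractLeft form v inv = v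
  contractRight_inv : ∀ v, contractRight form inv v = v

end QHS

namespace QHS

/-! ### Covariant metrics from invariant forms -/

noncomputable section MetricOfForm

open MulOpposite

variable {A H : Type*} [Ring A] [HopfAlgebra ℂ A] [StarRing A]
  [Ring H] [HopfAlgebra ℂ H] [StarRing H] (π : HopfStarHom A H)
  {M : Type*} [AddCommGroup M] [Module ℂ M] [Module (coinv π) M] [Module (coinv π)ᵐᵒᵖ M]
  [IsScalarTower ℂ (coinv π) M] [IsScalarTower ℂ (coinv π)ᵐᵒᵖ M]
  [SMulCommClass (coinv π) (coinv π)ᵐᵒᵖ M] [LeftComodule A M] [RelHopfModule A (coinv π) M]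

namespace InvariantForm

variable {π} (F : InvariantForm H (Phi π M))

/-- By the cotensor condition the right coaction on the value becomes the `H`-coaction on both
arguments of the form, and invariance makes that leg `1`. -/
lemma formExt_takeuchi_mem (ω η : M) :
    formExt A F.form (takeuchi π M ω) (takeuchi π M η) ∈ coinv π := by
  have h1 : ∀ s t : A ⊗[ℂ] Phi π M, TensorProduct.map₂ (LinearMap.mul ℂ A) (formExt H F.form)
      ((coaction H).lTensor A s) ((coaction H).lTensor A t) = formExt A F.form s t ⊗ₜ 1 := by
    intro s t
    induction s with
    | zero => simp
    | add s s' hs hs' =>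
      simp only [map_add, LinearMap.add_apply, TensorProduct.add_tmul, hs, hs']
    | tmul a x =>
      induction t with
      | zero => simp
      | add t t' ht ht' => simp only [map_add, TensorProduct.add_tmul, ht, ht']
      | tmul b y =>
        simp [TensorProduct.map₂_apply_tmul, F.form_invariant, Algebra.algebraMap_eq_smul_one,
          TensorProduct.smul_tmul']
  rw [mem_coinv, algHom_formExt, takeuchi_cotensor, takeuchi_cotensor, h1]

/-- `(ω, η) ↦ ω₍₋₁₎ η₍₋₁₎ β([ω₍₀₎], [η₍₀₎])` -/
def bilin : M →ₗ[ℂ] M →ₗ[ℂ] coinv π :=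
  LinearMap.mk₂ ℂ (fun ω η => ⟨_, F.formExt_takeuchi_mem ω η⟩)
    (fun _ _ _ => Subtype.ext (by simp)) (fun _ _ _ => Subtype.ext (by simp))
    (fun _ _ _ => Subtype.ext (by simp)) (fun _ _ _ => Subtype.ext (by simp))

lemma coe_bilin (ω η : M) : (F.bilin ω η : A) =
    formExt A F.form (takeuchi π M ω) (takeuchi π M η) := rfl

lemma bilin_smul (b : coinv π) (ω η : M) : F.bilin (b • ω) η = b * F.bilin ω η :=
  Subtype.ext <| by
    rw [MulMemClass.coe_mul, coe_bilin, coe_bilin, takeuchi_smul, formExt_mulLeft]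

lemma bilin_op_smul (hplus : plusRight π M = plusLeft π M) (b : coinv π) (ω η : M) :
    F.bilin ω (op b • η) = F.bilin ω η * b :=
  Subtype.ext <| by
    rw [MulMemClass.coe_mul, coe_bilin, coe_bilin, takeuchi_op_smul π hplus, formExt_mulRight]

lemma bilin_balanced (hplus : plusRight π M = plusLeft π M) (ω : M) (b : coinv π) (η : M) :
    F.bilin (op b • ω) η = F.bilin ω (b • η) :=
  Subtype.ext <| by
    rw [coe_bilin, coe_bilin, takeuchi_op_smul π hplus, takeuchi_smul, formExt_balanced]

/-- The pairing of the metric defined by an invariant form. -/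
def pairing (hplus : plusRight π M = plusLeft π M) : BTensor (coinv π) M M →ₗ[ℂ] coinv π :=
  BTensor.lift _ F.bilin (F.bilin_balanced hplus)

@[simp] lemma pairing_mk (hplus : plusRight π M = plusLeft π M) (ω η : M) :
    F.pairing hplus (BTensor.mk (coinv π) M M ω η) = F.bilin ω η := rfl

/-- Inside `A` the coaction is `Δ`, which is multiplicative, and the unit map is colinear for it. -/
lemma coaction_bilin (ω η : M) : coaction A (F.bilin ω η) =
    TensorProduct.map₂ (LinearMap.mul ℂ A) F.bilin (coaction A ω) (coaction A η) := by
  apply lTensor_injective (f := (coinv π).val.toLinearMap) Subtype.val_injective A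
  have h1 : ∀ s t : A ⊗[ℂ] M, (coinv π).val.toLinearMap.lTensor A
      (TensorProduct.map₂ (LinearMap.mul ℂ A) F.bilin s t) =
      TensorProduct.map₂ (LinearMap.mul ℂ A) (formExt A F.form)
        ((takeuchi π M).lTensor A s) ((takeuchi π M).lTensor A t) := by
    intro s t
    induction s with
    | zero => simp
    | add s s' hs hs' => simp only [map_add, LinearMap.add_apply, hs, hs']
    | tmul a x =>
      induction t with
      | zero => simp
      | add t t' ht ht' => simp only [map_add, ht, ht']
      | tmul b y => simp [TensorProduct.map₂_apply_tmul, coe_bilin]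
  rw [lTensor_val_coaction, h1, lTensor_takeuchi_coaction, lTensor_takeuchi_coaction]
  exact algHom_formExt F.form (Bialgebra.comulAlgHom ℂ A) _ _

lemma pairing_colinear (hplus : plusRight π M = plusLeft π M) (t : BTensor (coinv π) M M) :
    coaction A (F.pairing hplus t) =
    (F.pairing hplus).lTensor A (tensorCoact A (coinv π) M t) := by
  rw [← LinearMap.comp_apply, ← LinearMap.comp_apply]
  congr 1
  refine BTensor.ext _ fun m n => ?_
  rw [LinearMap.comp_apply, LinearMap.comp_apply, pairing_mk, coaction_bilin, tensorCoact_mk]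
  generalize coaction A m = s
  generalize coaction A n = t
  induction s with
  | zero => simp
  | add s s' hs hs' => simp only [map_add, LinearMap.add_apply, hs, hs']
  | tmul a x =>
    induction t with
    | zero => simp
    | add t t' ht ht' => simp only [map_add, ht, ht']
    | tmul b y => simp [TensorProduct.map₂_apply_tmul]

variable (π M) in
/-- The quotient map `M ⊗ M → Φ(M) ⊗ Φ(M)`. -/
abbrev quot : M ⊗[ℂ] M →ₗ[ℂ] Phi π M ⊗[ℂ] Phi π M :=
  TensorProduct.map (Phi.mk π M) (Phi.mk π M)

lemma quot_smul (b : coinv π) (t : M ⊗[ℂ] M) :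
    quot π M (b • t) = Coalgebra.counit (R := ℂ) (b : A) • quot π M t := by
  induction t with
  | zero => simp
  | add x y hx hy => simp only [smul_add, map_add, hx, hy]
  | tmul m n => simp [TensorProduct.smul_tmul', Phi.mk_smul]

lemma coaction_quot (t : M ⊗[ℂ] M) : coaction H (quot π M t) =
    TensorProduct.map π.lin (quot π M) (coaction A t) := by
  induction t with
  | zero => simp
  | add x y hx hy => simp only [map_add, hx, hy]
  | tmul m n =>
    rw [TensorProduct.map_tmul, coaction_tmul, coaction_tmul, Phi.coaction_mk, Phi.coaction_mk]
    exact (map_map₂_mk (π.toBialgHom : A →ₐ[ℂ] H) _ _ _ _).symm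

lemma lTensor_quot_coaction (m n : M) : (quot π M).lTensor A (coaction A (m ⊗ₜ[ℂ] n)) =
    TensorProduct.map₂ (LinearMap.mul ℂ A) (TensorProduct.mk ℂ (Phi π M) (Phi π M))
      (takeuchi π M m) (takeuchi π M n) :=
  map_map₂_mk (AlgHom.id ℂ A) _ _ _ _

lemma tensorCoact_proj (t : M ⊗[ℂ] M) :
    tensorCoact A (coinv π) M (BTensor.proj (coinv π) M M t) =
      (BTensor.proj (coinv π) M M).lTensor A (coaction A t) := by
  induction t with
  | zero => simp
  | add x y hx hy => simp only [map_add, hx, hy]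
  | tmul m n =>
    refine (tensorCoact_mk m n).trans ?_
    rw [coaction_tmul]
    generalize coaction A m = s
    generalize coaction A n = t
    induction s with
    | zero => simp
    | add s s' hs hs' => simp only [map_add, LinearMap.add_apply, hs, hs']
    | tmul a x =>
      induction t with
      | zero => simp
      | add t t' ht ht' => simp only [map_add, ht, ht']
      | tmul b y => simp [TensorProduct.map₂_apply_tmul, BTensor.mk]

/-- The invariant element of `Φ(M) ⊗ Φ(M)` lifts to an invariant element of `M ⊗ M`. -/
lemma exists_lift (h : HaarFunctional H) : ∃ t : M ⊗[ℂ] M, coaction A t = 1 ⊗ₜ t ∧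
    (quot π M).lTensor A (coaction A t) = 1 ⊗ₜ F.inv := by
  obtain ⟨c, hc⟩ := TensorProduct.map_surjective (Phi.mk_surjective π M) (Phi.mk_surjective π M)
    F.inv
  -- Averaging `1 ⊗ c` gives a coinvariant because `Δ(1) = 1 ⊗ 1`. The image is unchanged because `1
  -- ⊗ F.inv` satisfies the cotensor condition.
  refine ⟨average π h (M ⊗[ℂ] M) (1 ⊗ₜ c), ?_, ?_⟩
  · rw [coaction_average]
    simp [Algebra.TensorProduct.one_def]
  · rw [lTensor_coaction_average π h (M ⊗[ℂ] M) (quot π M) quot_smul coaction_quot]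
    · rw [LinearMap.lTensor_tmul, hc]
    · rw [LinearMap.lTensor_tmul, hc]
      simp [F.inv_invariant, Algebra.TensorProduct.one_def]

/-- An invariant form on `Φ(M)` defines a covariant metric on `M`. -/
lemma nonempty_covariantMetric (F : InvariantForm H (Phi π M)) (h : HaarFunctional H)
    (hplus : plusRight π M = plusLeft π M) :
    Nonempty (CovariantMetric A (coinv π) M) := by
  obtain ⟨t, ht, hq⟩ := F.exists_lift h
  refine ⟨{
    g := BTensor.proj (coinv π) M M t
    pairing := F.pairing hplus
    pairing_smul := F.bilin_smul
    pairing_op_smul := F.bilin_op_smul hplus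
    left_inv := fun x => ?_
    right_inv := fun x => ?_
    pairing_colinear := F.pairing_colinear hplus
    coev_colinear := fun b => ?_ }⟩
  -- Under the injective unit map, contraction with `g` becomes contraction of the form with `1 ⊗
  -- F.inv`.
  · apply takeuchi_injective π M h
    have h1 : ∀ t : M ⊗[ℂ] M, takeuchi π M (TensorProduct.lift (lact (coinv π) M ∘ₗ F.bilin x) t) =
        TensorProduct.map₂ (LinearMap.mul ℂ A) (contractLeft F.form) (takeuchi π M x)
          ((quot π M).lTensor A (coaction A t)) := by
      intro t
      induction t with
      | zero => simp
      | add x y hx hy => simp only [map_add, hx, hy]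
      | tmul m n =>
        rw [lTensor_quot_coaction, map₂_contractLeft, ← coe_bilin, ← takeuchi_smul]
        rfl
    refine (h1 t).trans ?_
    rw [hq]
    generalize takeuchi π M x = s
    induction s with
    | zero => simp
    | add s s' hs hs' => simp only [map_add, LinearMap.add_apply, hs, hs']
    | tmul a x => simp [TensorProduct.map₂_apply_tmul, F.contractLeft_inv]
  · apply takeuchi_injective π M h
    have h1 : ∀ t : M ⊗[ℂ] M, takeuchi π M (TensorProduct.lift
        ((ract (coinv π) M).compl₂ (F.bilin.flip x)) t) =
        TensorProduct.map₂ (LinearMap.mul ℂ A) (contractRight F.form)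
          ((quot π M).lTensor A (coaction A t)) (takeuchi π M x) := by
      intro t
      induction t with
      | zero => simp
      | add x y hx hy => simp only [map_add, LinearMap.add_apply, hx, hy]
      | tmul m n =>
        rw [lTensor_quot_coaction, map₂_contractRight, ← coe_bilin, ← takeuchi_op_smul π hplus]
        rfl
    refine (h1 t).trans ?_
    rw [hq]
    generalize takeuchi π M x = s
    induction s with
    | zero => simp
    | add s s' hs hs' => simp only [map_add, hs, hs']
    | tmul a x => simp [TensorProduct.map₂_apply_tmul, F.contractRight_inv]
  · have h1 : ∀ (b : coinv π) (t : M ⊗[ℂ] M), BTensor.orbit (coinv π)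
        (BTensor.proj (coinv π) M M t) b = BTensor.proj (coinv π) M M (b • t) := by
      intro b t
      induction t with
      | zero => simp [BTensor.orbit]
      | add x y hx hy =>
        rw [smul_add, map_add, map_add, ← hx, ← hy]
        exact map_add (BTensor.lsmul (coinv π) b) (BTensor.proj (coinv π) M M x)
          (BTensor.proj (coinv π) M M y)
      | tmul m n => rfl
    rw [h1, tensorCoact_proj, LeftHopfModule.coact_smul, ht]
    generalize coaction A b = s
    induction s with
    | zero => simp
    | add s s' hs hs' => simp only [map_add, LinearMap.add_apply, hs, hs']
    | tmul a b => simp [TensorProduct.map₂_apply_tmul, h1]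

end InvariantForm

end MetricOfForm

end QHS

namespace QHS

/-! ### The invariant form defined by an involution -/

noncomputable section FormOfInvolution

section

variable {H : Type*} [Ring H] [HopfAlgebra ℂ H] [StarRing H] [StarModule ℂ H]
  {V : Type*} [AddCommGroup V] [Module ℂ V] [LeftComodule H V] [FiniteDimensional ℂ V]

/-- A finite-dimensional comodule with a compatible involution carries an invariant form. -/
lemma IsCQGAlgebra.nonempty_invariantForm (hH : IsCQGAlgebra H) (J : V →ₗ⋆[ℂ] V)
    (hJ : ∀ v, J (J v) = v)
    (hδ : ∀ v, coaction H (J v) =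
      TensorProduct.map (starLinearEquiv ℂ (A := H)).toLinearMap J (coaction H v)) :
    Nonempty (InvariantForm H V) := by
  obtain ⟨ι, _, _, e, u, hu, he⟩ := hH.exists_unitary_basis (V := V)
  -- For the inner product making `e` orthonormal, linear in its first argument, `d i w = ⟨eᵢ, J
  -- w⟩`. It is linear in `w` because `J` and conjugation are both conjugate-linear, and it is dual
  -- to the basis `J(eᵢ)`. The form `β` below is `⟨v, J w⟩`.
  let d : ι → V →ₗ[ℂ] ℂ := fun i =>
    { toFun := fun w => star (e.coord i (J w))
      map_add' := fun x y => by simp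
      map_smul' := fun z x => by simp }
  have hd : ∀ i j, d i (J (e j)) = if j = i then 1 else 0 := by
    intro i j
    change star (e.coord i (J (J (e j)))) = _
    rw [hJ, Module.Basis.coord_apply, Module.Basis.repr_self, Finsupp.single_apply]
    split_ifs <;> simp
  have hsum : ∀ w, ∑ i, d i w • J (e i) = w := by
    intro w
    conv_rhs => rw [← hJ w, ← e.sum_repr (J w), map_sum]
    refine Finset.sum_congr rfl fun i _ => ?_
    rw [LinearMap.map_smulₛₗ]
    rfl
  let β : V →ₗ[ℂ] V →ₗ[ℂ] ℂ := ∑ i, (e.coord i).smulRight (d i)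
  have hβ : ∀ v w, β v w = ∑ i, e.coord i v * d i w := by
    intro v w
    simp [β]
  have hβ₁ : ∀ v i, β v (J (e i)) = e.coord i v := by
    intro v i
    simp [hβ, hd]
  have hβ₂ : ∀ i w, β (e i) w = d i w := by
    intro i w
    simp [hβ, Finsupp.single_apply]
  have heJ : ∀ i, coaction H (J (e i)) = ∑ j, star (u i j) ⊗ₜ J (e j) := by
    intro i
    rw [hδ, he, map_sum]
    rfl
  refine ⟨{
    form := β
    inv := ∑ i, J (e i) ⊗ₜ e i
    form_invariant := ?_
    inv_invariant := ?_
    contractLeft_inv := fun v => ?_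
    contractRight_inv := fun v => ?_ }⟩
  -- On the pairs `(eᵢ, J(eⱼ))` invariance of the form is the relation `u u* = 1`.
  · have h1 : ∀ i j, formExt H β (coaction H (e i)) (coaction H (J (e j))) =
        algebraMap ℂ H (β (e i) (J (e j))) := by
      intro i j
      have h2 := congrFun (congrFun (Unitary.mem_iff.1 hu).2 i) j
      rw [Matrix.mul_apply] at h2
      rw [he, heJ]
      simp only [map_sum, LinearMap.sum_apply, formExt_tmul, hβ₂, hd, ite_smul, one_smul, zero_smul]
      simp only [Finset.sum_ite_eq, Finset.mem_univ, if_true]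
      refine h2.trans ?_
      rw [Matrix.one_apply]
      by_cases hij : i = j
      · simp [hij]
      · simp [hij, Ne.symm hij]
    intro v w
    have h3 : ((formExt H β).compl₁₂ (coaction H) (coaction H)).flip w =
        (β.compr₂ (Algebra.linearMap ℂ H)).flip w := by
      refine e.ext fun i => ?_
      rw [← hsum w]
      simp only [map_sum, map_smul]
      simp only [LinearMap.sum_apply, LinearMap.smul_apply]
      refine Finset.sum_congr rfl fun j _ => congrArg _ ?_
      exact h1 i j
    exact LinearMap.congr_fun h3 v
  -- Invariance of `∑ J(eᵢ) ⊗ eᵢ` is the other relation, `u* u = 1`.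
  · simp only [map_sum, coaction_tmul, he, heJ, LinearMap.sum_apply,
      TensorProduct.map₂_apply_tmul]
    have h2 : ∀ k l, ∑ i, star (u i k) * u i l = (1 : Matrix ι ι H) k l := by
      intro k l
      have h2 := congrFun (congrFun (Unitary.mem_iff.1 hu).1 k) l
      rwa [Matrix.mul_apply] at h2
    have h3 : ∀ k l, ∑ i, (star (u i k) * u i l) ⊗ₜ[ℂ] (J (e k) ⊗ₜ[ℂ] e l) =
        if k = l then 1 ⊗ₜ (J (e k) ⊗ₜ e k) else 0 := by
      intro k l
      rw [← TensorProduct.sum_tmul, h2, Matrix.one_apply]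
      split_ifs with h
      · rw [h]
      · simp
    trans ∑ l, ∑ k, ∑ i, (star (u i k) * u i l) ⊗ₜ[ℂ] (J (e k) ⊗ₜ[ℂ] e l)
    · rw [Finset.sum_comm]
      refine Finset.sum_congr rfl fun l _ => ?_
      rw [Finset.sum_comm]
      rfl
    · rw [TensorProduct.tmul_sum]
      exact Finset.sum_congr rfl fun l _ => by simp [h3]
  · simp [hβ₁, e.sum_repr]
  · simp only [map_sum, LinearMap.sum_apply, contractRight_tmul, hβ₂]
    exact hsum v

end

/-! ### The involution of `Φ(Ω¹)` and its finite dimension -/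

section

open MulOpposite

variable {A H : Type*} [Ring A] [HopfAlgebra ℂ A] [StarRing A] [StarModule ℂ A]
  [HopfStarAlgebra A] [Ring H] [HopfAlgebra ℂ H] [StarRing H] [StarModule ℂ H] [HopfStarAlgebra H]
  (π : HopfStarHom A H)

/-- On `B` the map `π` is `ε` times the unit and it preserves `*`; hence `B⁺` is `*`-stable. -/
lemma counit_star_coinv (b : coinv π) (hb : Coalgebra.counit (R := ℂ) (b : A) = 0) :
    Coalgebra.counit (R := ℂ) ((star b : coinv π) : A) = 0 := by
  have h1 : π.toBialgHom ((star b : coinv π) : A) = star (π.toBialgHom (b : A)) := π.map_star _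
  rw [apply_coinv, apply_coinv, hb, map_zero, star_zero] at h1
  have h2 := congrArg (Coalgebra.counit (R := ℂ)) h1
  simpa using h2

variable {π} {Ω : Type*} [Ring Ω] [Algebra ℂ Ω] (C : CovariantStarCalculus A (coinv π) Ω)

namespace CovariantStarCalculus

/-- The involution of `Ω¹`. -/
def oneInvolution : C.OneForms →ₗ⋆[ℂ] C.OneForms where
  toFun ω := ⟨C.involution (C.incl ω), C.involution_mem 1 _ ω.2⟩
  map_add' ω η := C.incl_injective (by
    exact (congrArg C.involution (map_add C.incl ω η)).trans (map_add C.involution _ _))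
  map_smul' z ω := C.incl_injective (by
    exact (congrArg C.involution (map_smul C.incl z ω)).trans
      (LinearMap.map_smulₛₗ C.involution _ _))

lemma incl_oneInvolution (ω : C.OneForms) :
    C.incl (C.oneInvolution ω) = C.involution (C.incl ω) := rfl

lemma oneInvolution_oneInvolution (ω : C.OneForms) :
    C.oneInvolution (C.oneInvolution ω) = ω :=
  C.incl_injective (C.involution_involution _)

/-- The sign `(-1)^(kl)` is trivial because `b` has degree `0`. -/
lemma oneInvolution_smul (b : coinv π) (ω : C.OneForms) :
    C.oneInvolution (b • ω) = op (star b) • C.oneInvolution ω := by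
  apply C.incl_injective
  rw [incl_oneInvolution, incl_smul, C.involution_mul 0 1 _ (C.ι_mem b) (C.incl ω) ω.2, C.involution_ι,
    incl_op_smul, incl_oneInvolution]
  simp

lemma coaction_oneInvolution (ω : C.OneForms) : coaction A (C.oneInvolution ω) =
    TensorProduct.map (starLinearEquiv ℂ (A := A)).toLinearMap C.oneInvolution (coaction A ω) := by
  let _ := C.comodule
  apply lTensor_injective C.incl_injective A
  rw [lTensor_incl_coaction, incl_oneInvolution, C.coaction_involution, ← lTensor_incl_coaction]
  generalize coaction A ω = t
  induction t with
  | zero => simp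
  | add x y hx hy => simp only [map_add, hx, hy]
  | tmul a η => rfl

/-- The involution `[ω] ↦ [ω*]` of `Φ(Ω¹)`. -/
def phiInvolution (hplus : plusRight π C.OneForms = plusLeft π C.OneForms) :
    Phi π C.OneForms →ₗ⋆[ℂ] Phi π C.OneForms :=
  (plusLeft π C.OneForms).liftQ ((Phi.mk π C.OneForms).comp C.oneInvolution) <| by
    refine Submodule.span_le.2 ?_
    rintro _ ⟨b, ω, hb, rfl⟩
    change Phi.mk π C.OneForms (C.oneInvolution (b • ω)) = 0
    -- `(b ω)* = ω* b*` lies in `Ω¹B⁺ = B⁺Ω¹`.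
    rw [oneInvolution_smul, Phi.mk_op_smul π hplus, counit_star_coinv π b hb, zero_smul]

variable (hplus : plusRight π C.OneForms = plusLeft π C.OneForms)

lemma phiInvolution_mk (ω : C.OneForms) : C.phiInvolution hplus (Phi.mk π C.OneForms ω) =
    Phi.mk π C.OneForms (C.oneInvolution ω) := rfl

lemma phiInvolution_phiInvolution (v : Phi π C.OneForms) :
    C.phiInvolution hplus (C.phiInvolution hplus v) = v := by
  obtain ⟨ω, rfl⟩ := Phi.mk_surjective π _ v
  rw [phiInvolution_mk, phiInvolution_mk, oneInvolution_oneInvolution]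

lemma coaction_phiInvolution (v : Phi π C.OneForms) : coaction H (C.phiInvolution hplus v) =
    TensorProduct.map (starLinearEquiv ℂ (A := H)).toLinearMap (C.phiInvolution hplus)
      (coaction H v) := by
  obtain ⟨ω, rfl⟩ := Phi.mk_surjective π _ v
  rw [phiInvolution_mk, Phi.coaction_mk, coaction_oneInvolution, Phi.coaction_mk]
  generalize coaction A ω = t
  induction t with
  | zero => simp
  | add x y hx hy => simp only [map_add, hx, hy]
  | tmul a η => exact congrArg (· ⊗ₜ _) (π.map_star a)

end CovariantStarCalculus

/-- `Φ(M)` is finite-dimensional for a finitely generated `M`. -/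
lemma Phi.finiteDimensional (π : HopfStarHom A H) (M : Type*) [AddCommGroup M] [Module ℂ M]
    [Module (coinv π) M] [IsScalarTower ℂ (coinv π) M] [Module.Finite (coinv π) M] :
    FiniteDimensional ℂ (Phi π M) := by
  obtain ⟨s, hs⟩ := Module.Finite.fg_top (R := coinv π) (M := M)
  classical
  refine ⟨⟨s.image (Phi.mk π M), eq_top_iff.2 fun v _ => ?_⟩⟩
  obtain ⟨m, rfl⟩ := Phi.mk_surjective π M v
  have hm : m ∈ Submodule.span (coinv π) (s : Set M) := hs ▸ Submodule.mem_top
  induction hm using Submodule.span_induction with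
  | mem x hx =>
    exact Submodule.subset_span (Finset.mem_coe.2 (Finset.mem_image_of_mem _ hx))
  | zero => rw [map_zero]; exact zero_mem _
  | add x y _ _ hx hy => rw [map_add]; exact add_mem (hx trivial) (hy trivial)
  | smul b x _ hx => rw [Phi.mk_smul]; exact Submodule.smul_mem _ _ (hx trivial)

end

end FormOfInvolution

end QHS

namespace QHS

/-- A simply transitive action, transported along an isomorphism of groups. -/
lemma exists_transportedAction {G K X : Type*} [Group G] [Group K] [MulAction G X] (φ : G →* K)
    (hφ : Function.Bijective φ) (hfree : ∀ (g : G) (x : X), g • x = x → g = 1)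
    (htrans : ∀ x y : X, ∃ g : G, g • x = y) :
    ∃ act : MulAction K X, (∀ g x, act.smul (φ g) x = g • x) ∧
      (∀ k x, act.smul k x = x → k = 1) ∧ (∀ x y, ∃ k, act.smul k x = y) ∧
      ∀ x, Function.Bijective fun k => act.smul k x := by
  let e := MulEquiv.ofBijective φ hφ
  have hact : ∀ g (x : X), (MulAction.compHom X e.symm.toMonoidHom).smul (φ g) x = g • x :=
    fun g x => congrArg (· • x) (e.symm_apply_apply g)
  refine ⟨MulAction.compHom X e.symm.toMonoidHom, hact, fun k x hk => ?_, fun x y => ?_,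
    fun x => ⟨fun k l hkl => ?_, fun y => ?_⟩⟩
  · obtain ⟨g, rfl⟩ := hφ.2 k
    rw [hact] at hk
    rw [hfree g x hk, map_one]
  · obtain ⟨g, hg⟩ := htrans x y
    exact ⟨φ g, (hact g x).trans hg⟩
  · obtain ⟨g, rfl⟩ := hφ.2 k
    obtain ⟨g', rfl⟩ := hφ.2 l
    simp only [hact] at hkl
    have h := hfree (g'⁻¹ * g) x (by rw [mul_smul, hkl, inv_smul_smul])
    rw [inv_mul_eq_one.1 h]
  · obtain ⟨g, hg⟩ := htrans x y
    exact ⟨φ g, (hact g x).trans hg⟩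

end QHS

/-! ### The main theorem -/

set_option maxHeartbeats 1000000 in
theorem mainTheorem3
    {A : Type u} [Ring A] [HopfAlgebra ℂ A] [StarRing A] [StarModule ℂ A] [HopfStarAlgebra A]
    {H : Type v} [Ring H] [HopfAlgebra ℂ H] [StarRing H] [StarModule ℂ H] [HopfStarAlgebra H]
    (hH : IsCQGAlgebra H)
    (π : HopfStarHom A H) (hπ : Function.Surjective π.toBialgHom)
    (hflat : IsFaithfullyFlatRight (coinv π) A)
    {Ω : Type w} [Ring Ω] [Algebra ℂ Ω] (C : CovariantStarCalculus A (coinv π) Ω)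
    (hfin : Module.Finite (coinv π) C.OneForms)
    (hplus : plusRight π C.OneForms = plusLeft π C.OneForms) :
    -- covariant metrics exist
    Nonempty (CovariantMetric A (coinv π) C.OneForms) ∧
    -- every automorphism of `Φ(Ω¹)` is `Φ(f)` for a unique automorphism `f` of `Ω¹`
    Function.Bijective (Phi.aut π C.OneForms) ∧
    ∃ act : MulAction (ComoduleAut H (Phi π C.OneForms))
        (CovariantMetric A (coinv π) C.OneForms),
      -- the action is `Φ(f) • (g, ( , )) = ((id ⊗ f) g, (f⁻¹ · , · ))`
      (∀ (f : RelHopfAut A (coinv π) C.OneForms)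
          (x : CovariantMetric A (coinv π) C.OneForms),
        (act.smul (Phi.aut π C.OneForms f) x).g =
          BTensor.map (coinv π) LinearMap.id f.1.toLinearMap (fun _ _ => rfl) f.2.1 x.g ∧
        ∀ ω η : C.OneForms,
          (act.smul (Phi.aut π C.OneForms f) x).pairing (BTensor.mk (coinv π) _ _ ω η) =
            x.pairing (BTensor.mk (coinv π) _ _ (f.1.symm ω) η)) ∧
      -- the action is free and transitive
      (∀ (τ : ComoduleAut H (Phi π C.OneForms)) (x : CovariantMetric A (coinv π) C.OneForms),
        act.smul τ x = x → τ = 1) ∧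
      (∀ x y : CovariantMetric A (coinv π) C.OneForms, ∃ τ, act.smul τ x = y) ∧
      -- `Φ(Ω¹)` is a finite direct sum of irreducible comodules
      (∃ D : IrreducibleDecomposition.{v, w, w} H (Phi π C.OneForms), ∀ i, 0 < D.n i) ∧
      -- every such decomposition identifies `Aut(Φ(Ω¹))` with `∏ᵢ GL(nᵢ, ℂ)`, and thereby
      -- parametrizes the covariant metrics
      (∀ D : IrreducibleDecomposition.{v, w, w'} H (Phi π C.OneForms),
        ∃ E : (∀ i, GL (Fin (D.n i)) ℂ) ≃* ComoduleAut H (Phi π C.OneForms),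
          (∀ (γ : ∀ i, GL (Fin (D.n i)) ℂ) (v : Phi π C.OneForms) (i : Fin D.m)
              (j : Fin (D.n i)),
            D.equiv ((E γ).1 v) i j = ∑ k, (γ i).1 j k • D.equiv v i k) ∧
          ∀ x : CovariantMetric A (coinv π) C.OneForms,
            Function.Bijective fun γ : (∀ i, GL (Fin (D.n i)) ℂ) => act.smul (E γ) x) := by

  obtain ⟨h₀, h₁, h₂⟩ := hH.exists_haar
  let h : HaarFunctional H := ⟨h₀, h₁, h₂⟩
  have hfd : FiniteDimensional ℂ (Phi π C.OneForms) := Phi.finiteDimensional π C.OneForms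
  have hss : IsSemisimpleModule (DualRing H) (Phi π C.OneForms) := hH.isSemisimpleModule_comodule
  obtain ⟨F⟩ := hH.nonempty_invariantForm (C.phiInvolution hplus)
    (C.phiInvolution_phiInvolution hplus) (C.coaction_phiInvolution hplus)
  have hbij : Function.Bijective (Phi.aut π C.OneForms) := Phi.aut_bijective π h hplus
  -- The group `Aut(Φ(Ω¹))` acts through the inverse of `f ↦ Φ(f)`; composing its bijective orbit
  -- maps with the matrix isomorphism gives the parametrization.
  obtain ⟨act, hact, hfree, htrans, hreg⟩ := exists_transportedAction (Phi.aut π C.OneForms) hbij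
    (fun _ x hx => CovariantMetric.eq_one_of_smul_eq (x := x) hx) (fun x y => CovariantMetric.exists_smul_eq x y)
  refine ⟨F.nonempty_covariantMetric h hplus, hbij, act, fun f x => ?_, hfree, htrans,
    exists_irreducibleDecomposition, fun D => ?_⟩
  · rw [hact]
    exact ⟨rfl, fun _ _ => rfl⟩
  · exact ⟨MulEquiv.ofBijective D.glToAut D.glToAut_bijective, D.equiv_glToAut, fun x =>
      (hreg x).comp (MulEquiv.ofBijective D.glToAut D.glToAut_bijective).bijective⟩
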